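/- **Setting.** Let $\Omega\subset\mathbb R^2$ be a bounded polygonal domain, triangulated by a conforming (regular in the sense of Ciarlet) initial mesh $\mathcal T_0$: finitely many nondegenerate closed triangles with pairwise disjoint interiors, any two of which meet in a common edge, a common vertex or not at all, and $\Omega$ is the interior of their union. (This covers all open, bounded, simply connected polygonal Lipschitz domains.) In each triangle of $\mathcal T_0$ a refinement edge is chosen. Let $\mathbb T$ be the set of all conforming triangulations obtained from $\mathcal T_0$ by finitely many newest vertex bisections. Write $(\cdot,\cdot)$, $\|\cdot\|$ for the inner product and norm of $L^2(\Omega)$ and $L^2(\Omega)^2$, and put $a(\sigma,\tau)=(\sigma,\tau)$, $b(\tau,v)=(\operatorname{div}\tau,v)$. Let $k\ge 0$. For $\mathcal T_h\in\mathbb T$ let $M_h\subset L^2(\Omega)$ be the space of functions which are polynomials of degree at most $k$ on each triangle, and let $\Sigma_h\subset H(\operatorname{div};\Omega)$ be the corresponding Raviart–Thomas space (locally $P_k^2+xP_k$), Brezzi–Douglas–Marini space (locally $P_{k+1}^2$) or Brezzi–Douglas–Fortin–Marini space (locally the fields in $P_{k+1}^2$ whose normal component on each edge is a polynomial of degree at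 most $k$). The same family and the same $k$ are used on all meshes. For $w_h\in M_h$ let $G_h(w_h)\in\Sigma_h$ solve $a(G_h(w_h),\tau_h)+b(\tau_h,w_h)=0$ for all $\tau_h\in\Sigma_h$; similarly let $G(w)\in H(\operatorname{div};\Omega)$ solve $a(G(w),\tau)+b(\tau,w)=0$ for all $\tau\in H(\operatorname{div};\Omega)$. Let $(\lambda_{h,j},\sigma_{h,j},u_{h,j})$, $1\le j\le N(h)=\dim M_h$, be solutions of the discrete eigenvalue problem $$a(\sigma_{h,j},\tau_h)+b(\tau_h,u_{h,j})=0\quad\forall\tau_h\in\Sigma_h,\qquad b(\sigma_{h,j},v_h)=-\lambda_{h,j}(u_{h,j},v_h)\quad\forall v_h\in M_h,$$ with $0<\lambda_{h,1}\le\dots\le\lambda_{h,N(h)}$ and $\{u_{h,j}\}_j$ an orthonormal basis of $M_h$. Fix $J=\{n+1,\dots,n+m\}$ (independent of the mesh), let $W_h=\operatorname{span}\{u_{h,j}: j\in J,\ j\le N(h)\}$, and let $P^W_h$ be the $L^2$-orthogonal projection onto $W_h$. For $\lambda\in\mathbb R$ and $g\in L^2(\Omega)$ let $T^\lambda_hg\in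 M_h$ solve $b(G_h(T^\lambda_hg),v_h)=-(\lambda g,v_h)$ for all $v_h\in M_h$, and put $\Lambda_h g=P^W_hT^\lambda_hg$. For $T\in\mathcal T_h$ let $h_T$ be its diameter and $\mathcal E(T)$ the set of its edges; for $E\in\mathcal E(T)$ let $h_E$ be its length and $t_E$ a unit tangent, and let $[\cdot]_E\cdot t_E$ be the jump of the tangential trace if $E$ is an internal edge and the tangential trace if $E$ is a boundary edge. Let $\operatorname{curl}\psi=\partial_2\psi_1-\partial_1\psi_2$. For $g_h\in M_h$ put $$|g_h|_{\eta,T}^2=\|h_T(G_h(g_h)-\nabla g_h)\|_T^2+\|h_T\operatorname{curl}G_h(g_h)\|_T^2+\sum_{E\in\mathcal E(T)}h_E\|[G_h(g_h)]_E\cdot t_E\|_E^2,$$ where $\|\cdot\|_T$, $\|\cdot\|_E$ are the $L^2$ norms on $T$ and $E$. Finally put $$\mu_h(u;\mathcal T_h)^2=\sum_{T\in\mathcal T_h}|\Lambda_hu|_{\eta,T}^2,\qquad d(u,\Lambda_hu)=\sqrt{\|u-\Lambda_hu\|^2+\|G(u)-G_h(\Lambda_hu)\|^2}.$$ **Proposition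 (Efficiency).** Let $(\sigma,u)$ be an eigenpair with eigenvalue $\lambda$ of the mixed Dirichlet Laplace problem: $\sigma\in H(\operatorname{div};\Omega)$, $u\in L^2(\Omega)$, $\|u\|=1$, and $$a(\sigma,\tau)+b(\tau,u)=0\quad\forall\tau\in H(\operatorname{div};\Omega),\qquad b(\sigma,v)=-\lambda(u,v)\quad\forall v\in L^2(\Omega).$$ Then there is a constant $C_{\mathrm{eff}}>0$, independent of $h$, such that for every $\mathcal T_h\in\mathbb T$ and every choice of the discrete eigenpairs on $\mathcal T_h$ as above $$\mu_h(u;\mathcal T_h)\le C_{\mathrm{eff}}\,d(u,\Lambda_hu).$$ -/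

import Mathlib

open MeasureTheory
open scoped ContDiff RealInnerProductSpace

noncomputable section

namespace MixedFEM

/-! ### Function spaces -/

/-- The Euclidean plane. -/
abbrev Plane : Type := EuclideanSpace ℝ (Fin 2)

/-- `L²(Ω)`. -/
abbrev L2 (Ω : Set Plane) : Type := Lp ℝ 2 (volume.restrict Ω)

/-- `L²(Ω)²`. -/
abbrev L2v (Ω : Set Plane) : Type := Lp Plane 2 (volume.restrict Ω)

/-- `d ∈ L²(Ω)` is the weak divergence of the vector field `τ ∈ L²(Ω)²` in `Ω`. -/
def HasWeakDiv (Ω : Set Plane) (τ : L2v Ω) (d : L2 Ω) : Prop :=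
  ∀ φ : Plane → ℝ, ContDiff ℝ ∞ φ → HasCompactSupport φ → tsupport φ ⊆ Ω →
    ∫ x in Ω, ⟪τ x, gradient φ x⟫ = - ∫ x in Ω, d x * φ x

/-- The gradient of a test function is square integrable. -/
theorem memLp_gradient (Ω : Set Plane) {φ : Plane → ℝ} (hφ : ContDiff ℝ ∞ φ)
    (hc : HasCompactSupport φ) : MemLp (gradient φ) 2 (volume.restrict Ω) := by
  have h1 : Continuous (gradient φ) := by
    have : Continuous (fderiv ℝ φ) := hφ.continuous_fderiv (by simp)
    exact (InnerProductSpace.toDual ℝ Plane).symm.continuous.comp this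
  have h2 : HasCompactSupport (gradient φ) := by
    refine (hc.fderiv (𝕜 := ℝ)).comp_left (g := (InnerProductSpace.toDual ℝ Plane).symm) ?_
    simp
  exact (h1.memLp_of_hasCompactSupport (μ := volume) h2).restrict Ω

/-- The pairing of an `L²` field with the gradient of a test function is integrable. -/
theorem integrable_inner_gradient (Ω : Set Plane) (τ : L2v Ω) {φ : Plane → ℝ}
    (hφ : ContDiff ℝ ∞ φ) (hc : HasCompactSupport φ) :
    Integrable (fun x => ⟪τ x, gradient φ x⟫) (volume.restrict Ω) := by
  have h := memLp_gradient Ω hφ hc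
  refine (L2.integrable_inner (𝕜 := ℝ) τ h.toLp).congr ?_
  filter_upwards [h.coeFn_toLp] with x hx
  rw [hx]

/-- The pairing of an `L²` function with a test function is integrable. -/
theorem integrable_mul_test (Ω : Set Plane) (d : L2 Ω) {φ : Plane → ℝ}
    (hφ : ContDiff ℝ ∞ φ) (hc : HasCompactSupport φ) :
    Integrable (fun x => d x * φ x) (volume.restrict Ω) :=
  (Lp.memLp d).integrable_mul
    ((hφ.continuous.memLp_of_hasCompactSupport (μ := volume) (p := 2) hc).restrict Ω)

theorem HasWeakDiv.zero (Ω : Set Plane) : HasWeakDiv Ω 0 0 := by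
  intro φ hφ hc _
  have h1 : ∫ x in Ω, ⟪(0 : L2v Ω) x, gradient φ x⟫ = 0 := by
    rw [integral_eq_zero_of_ae]
    filter_upwards [Lp.coeFn_zero Plane 2 (volume.restrict Ω)] with x hx
    rw [hx]
    simp only [Pi.zero_apply, inner_zero_left]
  have h2 : ∫ x in Ω, (0 : L2 Ω) x * φ x = 0 := by
    rw [integral_eq_zero_of_ae]
    filter_upwards [Lp.coeFn_zero ℝ 2 (volume.restrict Ω)] with x hx
    rw [hx]
    simp only [Pi.zero_apply, zero_mul]
  rw [h1, h2, neg_zero]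

theorem HasWeakDiv.add {Ω : Set Plane} {τ τ' : L2v Ω} {d d' : L2 Ω}
    (h : HasWeakDiv Ω τ d) (h' : HasWeakDiv Ω τ' d') : HasWeakDiv Ω (τ + τ') (d + d') := by
  intro φ hφ hc hs
  have h1 : ∫ x in Ω, ⟪(τ + τ') x, gradient φ x⟫
      = (∫ x in Ω, ⟪τ x, gradient φ x⟫) + ∫ x in Ω, ⟪τ' x, gradient φ x⟫ := by
    rw [← integral_add (integrable_inner_gradient Ω τ hφ hc)
      (integrable_inner_gradient Ω τ' hφ hc)]
    refine integral_congr_ae ?_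
    filter_upwards [Lp.coeFn_add τ τ'] with x hx
    rw [hx, Pi.add_apply, inner_add_left]
  have h2 : ∫ x in Ω, (d + d') x * φ x
      = (∫ x in Ω, d x * φ x) + ∫ x in Ω, d' x * φ x := by
    rw [← integral_add (integrable_mul_test Ω d hφ hc) (integrable_mul_test Ω d' hφ hc)]
    refine integral_congr_ae ?_
    filter_upwards [Lp.coeFn_add d d'] with x hx
    rw [hx, Pi.add_apply, add_mul]
  rw [h1, h2, h φ hφ hc hs, h' φ hφ hc hs]
  ring

theorem HasWeakDiv.smul {Ω : Set Plane} {τ : L2v Ω} {d : L2 Ω} (c : ℝ)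
    (h : HasWeakDiv Ω τ d) : HasWeakDiv Ω (c • τ) (c • d) := by
  intro φ hφ hc hs
  have h1 : ∫ x in Ω, ⟪(c • τ) x, gradient φ x⟫ = c * ∫ x in Ω, ⟪τ x, gradient φ x⟫ := by
    rw [← integral_const_mul]
    refine integral_congr_ae ?_
    filter_upwards [Lp.coeFn_smul c τ] with x hx
    rw [hx, Pi.smul_apply, real_inner_smul_left]
  have h2 : ∫ x in Ω, (c • d) x * φ x = c * ∫ x in Ω, d x * φ x := by
    rw [← integral_const_mul]
    refine integral_congr_ae ?_
    filter_upwards [Lp.coeFn_smul c d] with x hx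
    rw [hx, Pi.smul_apply, smul_eq_mul, mul_assoc]
  rw [h1, h2, h φ hφ hc hs]
  ring

/-- `H(div; Ω)`. -/
def Hdiv (Ω : Set Plane) : Submodule ℝ (L2v Ω) where
  carrier := {τ | ∃ d, HasWeakDiv Ω τ d}
  zero_mem' := ⟨0, HasWeakDiv.zero Ω⟩
  add_mem' := by
    rintro τ τ' ⟨d, h⟩ ⟨d', h'⟩
    exact ⟨d + d', h.add h'⟩
  smul_mem' := by
    rintro c τ ⟨d, h⟩
    exact ⟨c • d, h.smul c⟩

open Classical in
/-- The weak divergence of `τ ∈ H(div; Ω)` (and zero for other fields). -/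
def weakDiv (Ω : Set Plane) (τ : L2v Ω) : L2 Ω :=
  if h : ∃ d, HasWeakDiv Ω τ d then h.choose else 0

theorem HasWeakDiv.unique {Ω : Set Plane} (hΩ : IsOpen Ω) {τ : L2v Ω} {d d' : L2 Ω}
    (h : HasWeakDiv Ω τ d) (h' : HasWeakDiv Ω τ d') : d = d' := by
  have key : ∀ᵐ x ∂(volume.restrict Ω), x ∈ Ω → d x - d' x = 0 := by
    refine hΩ.ae_eq_zero_of_integral_contDiff_smul_eq_zero (f := fun x => d x - d' x) ?_ ?_
    · have h1 : LocallyIntegrable (fun x => d x - d' x) (volume.restrict Ω) :=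
        ((Lp.memLp d).sub (Lp.memLp d')).locallyIntegrable (by norm_num)
      exact h1.locallyIntegrableOn Ω
    · intro g hg hc hs
      have e1 := h g hg hc hs
      have e2 := h' g hg hc hs
      have e3 : ∫ x in Ω, g x • (d x - d' x)
          = (∫ x in Ω, d x * g x) - ∫ x in Ω, d' x * g x := by
        rw [← integral_sub (integrable_mul_test Ω d hg hc) (integrable_mul_test Ω d' hg hc)]
        refine integral_congr_ae (Filter.Eventually.of_forall fun x => ?_)
        simp only [smul_eq_mul]
        ring
      rw [e3]
      linarith
  refine Lp.ext ?_
  filter_upwards [key, ae_restrict_mem hΩ.measurableSet] with x hx hxΩ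
  linarith [hx hxΩ]

theorem HasWeakDiv.weakDiv_eq {Ω : Set Plane} (hΩ : IsOpen Ω) {τ : L2v Ω} {d : L2 Ω}
    (h : HasWeakDiv Ω τ d) : weakDiv Ω τ = d := by
  have hex : ∃ d, HasWeakDiv Ω τ d := ⟨d, h⟩
  unfold weakDiv
  rw [dif_pos hex]
  exact hex.choose_spec.unique hΩ h

/-! ### The mixed eigenvalue problem, continuous and discrete

`S` is `H(div; Ω)` or a discrete subspace of it, `M` is `L²(Ω)` or a discrete subspace of it. -/

/-- `a(σ, τ) = (σ, τ)`. -/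
def aForm (Ω : Set Plane) (σ τ : L2v Ω) : ℝ := ⟪σ, τ⟫

/-- `b(τ, v) = (div τ, v)`. -/
def bForm (Ω : Set Plane) (τ : L2v Ω) (v : L2 Ω) : ℝ := ⟪weakDiv Ω τ, v⟫

/-- `(σ, u)` is a (normalized) eigenpair with eigenvalue `lam` of the mixed problem on `S × M`. -/
structure IsEigenpair (Ω : Set Plane) (S : Submodule ℝ (L2v Ω)) (M : Submodule ℝ (L2 Ω))
    (lam : ℝ) (σ : L2v Ω) (u : L2 Ω) : Prop where
  mem_S : σ ∈ S
  mem_M : u ∈ M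
  norm_eq : ‖u‖ = 1
  eq_a : ∀ τ ∈ S, aForm Ω σ τ + bForm Ω τ u = 0
  eq_b : ∀ v ∈ M, bForm Ω σ v = - lam * ⟪u, v⟫

/-- `s = G(w)`: `s ∈ S` solves `a(s, τ) + b(τ, w) = 0` for all `τ ∈ S`. -/
def IsG (Ω : Set Plane) (S : Submodule ℝ (L2v Ω)) (w : L2 Ω) (s : L2v Ω) : Prop :=
  s ∈ S ∧ ∀ τ ∈ S, aForm Ω s τ + bForm Ω τ w = 0

theorem IsG.unique {Ω : Set Plane} {S : Submodule ℝ (L2v Ω)} {w : L2 Ω} {s s' : L2v Ω}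
    (h : IsG Ω S w s) (h' : IsG Ω S w s') : s = s' := by
  have hm : s - s' ∈ S := S.sub_mem h.1 h'.1
  have e1 := h.2 _ hm
  have e2 := h'.2 _ hm
  have e3 : ⟪s - s', s - s'⟫ = 0 := by
    rw [inner_sub_left]
    simp only [aForm] at e1 e2
    linarith
  exact sub_eq_zero.mp (inner_self_eq_zero.mp e3)

open Classical in
/-- The operator `G` on `S`: for `S = H(div; Ω)` this is `G`, for `S = Σ_h` it is `G_h`. -/
def gradOp (Ω : Set Plane) (S : Submodule ℝ (L2v Ω)) (w : L2 Ω) : L2v Ω :=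
  if h : ∃ s, IsG Ω S w s then h.choose else 0

theorem IsG.gradOp_eq {Ω : Set Plane} {S : Submodule ℝ (L2v Ω)} {w : L2 Ω} {s : L2v Ω}
    (h : IsG Ω S w s) : gradOp Ω S w = s := by
  have hex : ∃ s, IsG Ω S w s := ⟨s, h⟩
  unfold gradOp
  rw [dif_pos hex]
  exact hex.choose_spec.unique h

/-- `t = T^λ_h g`: `t ∈ M` solves, together with `s = G(t) ∈ S`, the mixed source problem
with datum `λ g`. -/
def IsSourceSol (Ω : Set Plane) (S : Submodule ℝ (L2v Ω)) (M : Submodule ℝ (L2 Ω))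
    (lam : ℝ) (g t : L2 Ω) : Prop :=
  t ∈ M ∧ ∃ s, IsG Ω S t s ∧ ∀ v ∈ M, bForm Ω s v = - ⟪lam • g, v⟫

open Classical in
/-- The solution operator `T^λ_h`. -/
def sourceOp (Ω : Set Plane) (S : Submodule ℝ (L2v Ω)) (M : Submodule ℝ (L2 Ω))
    (lam : ℝ) (g : L2 Ω) : L2 Ω :=
  if h : ∃ t, IsSourceSol Ω S M lam g t then h.choose else 0

/-- An enumeration of the eigenpairs `(λ_j, σ_j, u_j)` of the discrete problem on `S × M`, with
ascending positive eigenvalues and with `u_1, …, u_N` an orthonormal basis of `M`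
(so that `N = dim M`). Index `j : Fin N` stands for the eigenpair with number `j + 1`. -/
structure DiscreteEigensystem (Ω : Set Plane) (S : Submodule ℝ (L2v Ω))
    (M : Submodule ℝ (L2 Ω)) where
  N : ℕ
  lam : Fin N → ℝ
  σ : Fin N → L2v Ω
  u : Fin N → L2 Ω
  lam_pos : ∀ j, 0 < lam j
  lam_mono : Monotone lam
  orthonormal : Orthonormal ℝ u
  span_eq : Submodule.span ℝ (Set.range u) = M
  eigenpair : ∀ j, IsEigenpair Ω S M (lam j) (σ j) (u j)

theorem bForm_sum {Ω : Set Plane} (hΩ : IsOpen Ω) {N : ℕ} (c : Fin N → ℝ) (σ : Fin N → L2v Ω)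
    (hσ : ∀ j, σ j ∈ Hdiv Ω) (v : L2 Ω) :
    bForm Ω (∑ j, c j • σ j) v = ∑ j, c j * bForm Ω (σ j) v := by
  choose d hd using hσ
  have h : HasWeakDiv Ω (∑ j, c j • σ j) (∑ j, c j • d j) := by
    classical
    induction (Finset.univ : Finset (Fin N)) using Finset.induction_on with
    | empty => exact HasWeakDiv.zero Ω
    | insert j t hj ih =>
      rw [Finset.sum_insert hj, Finset.sum_insert hj]
      exact ((hd j).smul (c j)).add ih
  simp only [bForm]
  rw [h.weakDiv_eq hΩ, sum_inner]
  refine Finset.sum_congr rfl fun j _ => ?_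
  rw [(hd j).weakDiv_eq hΩ, real_inner_smul_left]

/-- The discrete source problem is uniquely solvable, so that `sourceOp` is its solution. -/
theorem DiscreteEigensystem.existsUnique_sourceSol {Ω : Set Plane} (hΩ : IsOpen Ω)
    {S : Submodule ℝ (L2v Ω)} {M : Submodule ℝ (L2 Ω)} (hS : S ≤ Hdiv Ω)
    (D : DiscreteEigensystem Ω S M) (lam : ℝ) (g : L2 Ω) :
    ∃! t, IsSourceSol Ω S M lam g t := by
  have coef : ∀ t, IsSourceSol Ω S M lam g t → ∀ j, D.lam j * ⟪D.u j, t⟫ = ⟪lam • g, D.u j⟫ := by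
    rintro t ⟨ht, s, hs, hb⟩ j
    have e1 := (D.eigenpair j).eq_b t ht
    have e2 := hs.2 _ (D.eigenpair j).mem_S
    have e3 := (D.eigenpair j).eq_a s hs.1
    have e4 := hb _ (D.eigenpair j).mem_M
    have e5 : aForm Ω s (D.σ j) = aForm Ω (D.σ j) s := real_inner_comm _ _
    linarith
  refine existsUnique_of_exists_of_unique ?_ ?_
  · set c : Fin D.N → ℝ := fun j => ⟪lam • g, D.u j⟫ / D.lam j with hc
    have hsum : ∀ v ∈ M, ∀ w : L2 Ω, (∀ j, ⟪w, D.u j⟫ = 0) → ⟪w, v⟫ = 0 := by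
      intro v hv w hw
      rw [← D.span_eq] at hv
      induction hv using Submodule.span_induction with
      | mem x hx =>
        obtain ⟨j, rfl⟩ := hx
        exact hw j
      | zero => exact inner_zero_right _
      | add x y _ _ hx hy => rw [inner_add_right, hx, hy, add_zero]
      | smul a x _ hx => rw [real_inner_smul_right, hx, mul_zero]
    refine ⟨∑ j, c j • D.u j, Submodule.sum_mem _ fun j _ =>
      Submodule.smul_mem _ _ (D.eigenpair j).mem_M, ∑ j, c j • D.σ j,
      ⟨Submodule.sum_mem _ fun j _ => Submodule.smul_mem _ _ (D.eigenpair j).mem_S, ?_⟩, ?_⟩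
    · intro τ hτ
      simp only [aForm, bForm, sum_inner, inner_sum, real_inner_smul_left, real_inner_smul_right]
      rw [← Finset.sum_add_distrib]
      refine Finset.sum_eq_zero fun j _ => ?_
      have e := (D.eigenpair j).eq_a τ hτ
      simp only [aForm, bForm] at e
      rw [← mul_add, e, mul_zero]
    · intro v hv
      rw [bForm_sum hΩ c D.σ (fun j => hS (D.eigenpair j).mem_S) v]
      have e : ∀ j, c j * bForm Ω (D.σ j) v = - ⟪⟪lam • g, D.u j⟫ • D.u j, v⟫ := by
        intro j
        rw [(D.eigenpair j).eq_b v hv, real_inner_smul_left, hc]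
        have := (D.lam_pos j).ne'
        field_simp
      rw [Finset.sum_congr rfl fun j _ => e j, Finset.sum_neg_distrib, ← sum_inner]
      congr 1
      rw [← sub_eq_zero, ← inner_sub_left]
      refine hsum v hv _ fun i => ?_
      rw [inner_sub_left, sum_inner, sub_eq_zero]
      have horth := orthonormal_iff_ite.mp D.orthonormal
      simp only [real_inner_smul_left, horth]
      simp
  · intro t t' ht ht'
    have h0 : ∀ j, ⟪D.u j, t - t'⟫ = 0 := by
      intro j
      have e1 := coef t ht j
      have e2 := coef t' ht' j
      rw [inner_sub_right, sub_eq_zero]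
      exact mul_left_cancel₀ (D.lam_pos j).ne' (e1.trans e2.symm)
    have hmem : t - t' ∈ Submodule.span ℝ (Set.range D.u) := by
      rw [D.span_eq]
      exact M.sub_mem ht.1 ht'.1
    have hall : ∀ x ∈ Submodule.span ℝ (Set.range D.u), ⟪x, t - t'⟫ = 0 := by
      intro x hx
      induction hx using Submodule.span_induction with
      | mem x hx =>
        obtain ⟨j, rfl⟩ := hx
        exact h0 j
      | zero => exact inner_zero_left _
      | add x y _ _ hx hy => rw [inner_add_left, hx, hy, add_zero]
      | smul a x _ hx => rw [real_inner_smul_left, hx, mul_zero]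
    exact sub_eq_zero.mp (inner_self_eq_zero.mp (hall _ hmem))

/-- The discrete cluster space `W_h = span {u_{h,j} | j ∈ J}` with `J = {n + 1, …, n + m}`. -/
def DiscreteEigensystem.clusterSpace {Ω : Set Plane} {S : Submodule ℝ (L2v Ω)}
    {M : Submodule ℝ (L2 Ω)} (D : DiscreteEigensystem Ω S M) (n m : ℕ) :
    Submodule ℝ (L2 Ω) :=
  Submodule.span ℝ
    (Set.range fun j : {j : Fin D.N // (j : ℕ) + 1 ∈ Finset.Icc (n + 1) (n + m)} => D.u j)

instance {Ω : Set Plane} {S : Submodule ℝ (L2v Ω)} {M : Submodule ℝ (L2 Ω)}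
    (D : DiscreteEigensystem Ω S M) (n m : ℕ) : FiniteDimensional ℝ (D.clusterSpace n m) :=
  FiniteDimensional.span_of_finite ℝ (Set.finite_range _)

/-- `Λ_h = P^W_h ∘ T^λ_h`, where `P^W_h` is the `L²`-orthogonal projection onto `W_h`. -/
def DiscreteEigensystem.Lam {Ω : Set Plane} {S : Submodule ℝ (L2v Ω)}
    {M : Submodule ℝ (L2 Ω)} (D : DiscreteEigensystem Ω S M) (n m : ℕ) (lam : ℝ) (g : L2 Ω) :
    L2 Ω :=
  (D.clusterSpace n m).starProjection (sourceOp Ω S M lam g)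

/-! ### Triangles and meshes -/

/-- A triangle with vertices `T 0`, `T 1`, `T 2`. Its newest vertex is `T 2`, its refinement edge
is the opposite edge, from `T 0` to `T 1`. -/
abbrev Tri : Type := Fin 3 → Plane

namespace Tri

/-- The closed triangle. -/
def carrier (T : Tri) : Set Plane := convexHull ℝ (Set.range T)

/-- `h_T`. -/
def diam (T : Tri) : ℝ := Metric.diam T.carrier

/-- First endpoint of the edge opposite to vertex `i`. -/
def edgeA (T : Tri) (i : Fin 3) : Plane := T (i + 1)

/-- Second endpoint of the edge opposite to vertex `i`. -/
def edgeB (T : Tri) (i : Fin 3) : Plane := T (i + 2)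

/-- The length `h_E` of the edge opposite to vertex `i`. -/
def edgeLen (T : Tri) (i : Fin 3) : ℝ := dist (T.edgeA i) (T.edgeB i)

/-- A unit tangent `t_E` of the edge opposite to vertex `i`. -/
def tangent (T : Tri) (i : Fin 3) : Plane := (T.edgeLen i)⁻¹ • (T.edgeB i - T.edgeA i)

/-- A child of `T` under newest vertex bisection. The new vertex is the newest one. -/
def child₁ (T : Tri) : Tri := ![T 0, T 2, midpoint ℝ (T 0) (T 1)]

/-- The other child of `T` under newest vertex bisection. -/
def child₂ (T : Tri) : Tri := ![T 1, T 2, midpoint ℝ (T 0) (T 1)]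

end Tri

/-- Regularity of a triangulation in the sense of Ciarlet: the triangles are nondegenerate, and two
different ones have disjoint interiors and meet in the convex hull of their common
vertices (that is, in a common edge, a common vertex, or not at all). -/
structure IsConforming (𝒯 : Finset Tri) : Prop where
  nondegenerate : ∀ T ∈ 𝒯, AffineIndependent ℝ T
  disjoint_interior : ∀ T ∈ 𝒯, ∀ T' ∈ 𝒯, T ≠ T' →
    Disjoint (interior T.carrier) (interior T'.carrier)
  inter_eq : ∀ T ∈ 𝒯, ∀ T' ∈ 𝒯, T ≠ T' →
    T.carrier ∩ T'.carrier = convexHull ℝ (Set.range T ∩ Set.range T')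

/-- `𝒯` is a conforming triangulation of the polygonal domain `Ω`. -/
structure IsTriangulation (Ω : Set Plane) (𝒯 : Finset Tri) : Prop where
  conforming : IsConforming 𝒯
  interior_eq : interior (⋃ T ∈ 𝒯, T.carrier) = Ω

open Classical in
/-- `𝒯` arises from `𝒯₀` by finitely many newest vertex bisections of single triangles. -/
inductive BisectionRefines (𝒯₀ : Finset Tri) : Finset Tri → Prop
  | refl : BisectionRefines 𝒯₀ 𝒯₀
  | step {𝒯 : Finset Tri} {T : Tri} (h : BisectionRefines 𝒯₀ 𝒯) (hT : T ∈ 𝒯) :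
      BisectionRefines 𝒯₀ (insert T.child₁ (insert T.child₂ (𝒯.erase T)))

/-- The set `𝕋` of admissible meshes: the conforming triangulations that arise from the initial
mesh by newest vertex bisection. -/
def admissibleMeshes (𝒯₀ : Finset Tri) : Set (Finset Tri) :=
  {𝒯 | BisectionRefines 𝒯₀ 𝒯 ∧ IsConforming 𝒯}

/-! ### Mixed finite elements -/

/-- Polynomials in the two coordinates. -/
abbrev Poly : Type := MvPolynomial (Fin 2) ℝ

/-- The value of a polynomial at a point of the plane. -/
def Poly.evalAt (p : Poly) (x : Plane) : ℝ := MvPolynomial.eval (fun i => x i) p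

/-- The value of a polynomial vector field at a point of the plane. -/
def vecAt (q : Fin 2 → Poly) (x : Plane) : Plane := !₂[(q 0).evalAt x, (q 1).evalAt x]

/-- `P_k`: polynomials of total degree at most `k`. -/
def polyLE (k : ℕ) : Submodule ℝ Poly := MvPolynomial.restrictTotalDegree (Fin 2) ℝ k

/-- `P_k²`. -/
def vecLE (k : ℕ) : Submodule ℝ (Fin 2 → Poly) := Submodule.pi Set.univ fun _ => polyLE k

/-- The local Raviart–Thomas space `P_k² + x P_k`. -/
def rtLocal (k : ℕ) : Submodule ℝ (Fin 2 → Poly) where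
  carrier := {q | ∃ p ∈ vecLE k, ∃ r ∈ polyLE k, ∀ i, q i = p i + MvPolynomial.X i * r}
  zero_mem' := ⟨0, Submodule.zero_mem _, 0, Submodule.zero_mem _, by simp⟩
  add_mem' := by
    rintro q q' ⟨p, hp, r, hr, h⟩ ⟨p', hp', r', hr', h'⟩
    refine ⟨p + p', Submodule.add_mem _ hp hp', r + r', Submodule.add_mem _ hr hr', fun i => ?_⟩
    simp only [Pi.add_apply, h i, h' i]
    ring
  smul_mem' := by
    rintro c q ⟨p, hp, r, hr, h⟩
    refine ⟨c • p, Submodule.smul_mem _ c hp, c • r, Submodule.smul_mem _ c hr, fun i => ?_⟩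
    simp only [Pi.smul_apply, h i, smul_add, mul_smul_comm]

/-- The fields in `P_{k+1}²` whose normal component on each edge of `T` is a polynomial
of degree at most `k` along that edge (local space of Brezzi–Douglas–Fortin–Marini). -/
def bdfmLocal (k : ℕ) (T : Tri) : Submodule ℝ (Fin 2 → Poly) where
  carrier := {q | q ∈ vecLE (k + 1) ∧ ∀ i : Fin 3, ∃ r ∈ Polynomial.degreeLE ℝ (k : WithBot ℕ),
    ∀ s : ℝ, (vecAt q (AffineMap.lineMap (T.edgeA i) (T.edgeB i) s)) 0 * (T.tangent i) 1
      - (vecAt q (AffineMap.lineMap (T.edgeA i) (T.edgeB i) s)) 1 * (T.tangent i) 0 = r.eval s}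
  zero_mem' := ⟨Submodule.zero_mem _, fun i => ⟨0, Submodule.zero_mem _, fun s => by
    simp [vecAt, Poly.evalAt]⟩⟩
  add_mem' := by
    rintro q q' ⟨hq, h⟩ ⟨hq', h'⟩
    refine ⟨Submodule.add_mem _ hq hq', fun i => ?_⟩
    obtain ⟨r, hr, e⟩ := h i
    obtain ⟨r', hr', e'⟩ := h' i
    refine ⟨r + r', Submodule.add_mem _ hr hr', fun s => ?_⟩
    rw [Polynomial.eval_add, ← e s, ← e' s]
    simp only [vecAt, Poly.evalAt, Pi.add_apply, map_add, PiLp.toLp_apply, Matrix.cons_val_zero,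
      Matrix.cons_val_one]
    ring
  smul_mem' := by
    rintro c q ⟨hq, h⟩
    refine ⟨Submodule.smul_mem _ c hq, fun i => ?_⟩
    obtain ⟨r, hr, e⟩ := h i
    refine ⟨c • r, Submodule.smul_mem _ c hr, fun s => ?_⟩
    rw [Polynomial.eval_smul, ← e s]
    simp only [vecAt, Poly.evalAt, Pi.smul_apply, MvPolynomial.smul_eval, PiLp.toLp_apply,
      Matrix.cons_val_zero, Matrix.cons_val_one, smul_eq_mul]
    ring

/-- The standard families of mixed finite elements on triangles:
Raviart–Thomas, Brezzi–Douglas–Marini, Brezzi–Douglas–Fortin–Marini. -/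
inductive Family : Type
  | RT
  | BDM
  | BDFM

/-- The local space for the vector variable. The divergences of its elements are in `P_k`. -/
def localSpace : Family → ℕ → Tri → Submodule ℝ (Fin 2 → Poly)
  | Family.RT, k, _ => rtLocal k
  | Family.BDM, k, _ => vecLE (k + 1)
  | Family.BDFM, k, T => bdfmLocal k T

/-- The polynomial `p` represents `v ∈ L²(Ω)` on the triangle `T`. -/
def RepOn (Ω : Set Plane) (T : Tri) (v : L2 Ω) (p : Poly) : Prop :=
  ∀ᵐ x ∂(volume.restrict Ω), x ∈ T.carrier → v x = p.evalAt x

/-- The polynomial field `q` represents `τ ∈ L²(Ω)²` on the triangle `T`. -/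
def VecRepOn (Ω : Set Plane) (T : Tri) (τ : L2v Ω) (q : Fin 2 → Poly) : Prop :=
  ∀ᵐ x ∂(volume.restrict Ω), x ∈ T.carrier → τ x = vecAt q x

/-- `M_h`: the functions in `L²(Ω)` that are in `P_k` on each triangle. -/
def Mh (Ω : Set Plane) (k : ℕ) (𝒯 : Finset Tri) : Submodule ℝ (L2 Ω) where
  carrier := {v | ∀ T ∈ 𝒯, ∃ p ∈ polyLE k, RepOn Ω T v p}
  zero_mem' := fun T _ => ⟨0, Submodule.zero_mem _, by
    filter_upwards [Lp.coeFn_zero ℝ 2 (volume.restrict Ω)] with x hx _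
    rw [hx]
    simp [Poly.evalAt]⟩
  add_mem' := by
    intro v v' h h' T hT
    obtain ⟨p, hp, e⟩ := h T hT
    obtain ⟨p', hp', e'⟩ := h' T hT
    refine ⟨p + p', Submodule.add_mem _ hp hp', ?_⟩
    filter_upwards [Lp.coeFn_add v v', e, e'] with x hx ex ex' hxT
    rw [hx, Pi.add_apply, ex hxT, ex' hxT]
    simp [Poly.evalAt]
  smul_mem' := by
    intro c v h T hT
    obtain ⟨p, hp, e⟩ := h T hT
    refine ⟨c • p, Submodule.smul_mem _ c hp, ?_⟩
    filter_upwards [Lp.coeFn_smul c v, e] with x hx ex hxT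
    rw [hx, Pi.smul_apply, ex hxT]
    simp [Poly.evalAt, MvPolynomial.smul_eval]

/-- The fields in `L²(Ω)²` that are in the local space of the chosen family on each triangle. -/
def brokenSpace (Ω : Set Plane) (fam : Family) (k : ℕ) (𝒯 : Finset Tri) :
    Submodule ℝ (L2v Ω) where
  carrier := {τ | ∀ T ∈ 𝒯, ∃ q ∈ localSpace fam k T, VecRepOn Ω T τ q}
  zero_mem' := fun T _ => ⟨0, Submodule.zero_mem _, by
    filter_upwards [Lp.coeFn_zero Plane 2 (volume.restrict Ω)] with x hx _
    rw [hx]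
    ext i
    fin_cases i <;> simp [vecAt, Poly.evalAt]⟩
  add_mem' := by
    intro v v' h h' T hT
    obtain ⟨p, hp, e⟩ := h T hT
    obtain ⟨p', hp', e'⟩ := h' T hT
    refine ⟨p + p', Submodule.add_mem _ hp hp', ?_⟩
    filter_upwards [Lp.coeFn_add v v', e, e'] with x hx ex ex' hxT
    rw [hx, Pi.add_apply, ex hxT, ex' hxT]
    ext i
    fin_cases i <;> simp [vecAt, Poly.evalAt]
  smul_mem' := by
    intro c v h T hT
    obtain ⟨p, hp, e⟩ := h T hT
    refine ⟨c • p, Submodule.smul_mem _ c hp, ?_⟩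
    filter_upwards [Lp.coeFn_smul c v, e] with x hx ex hxT
    rw [hx, Pi.smul_apply, ex hxT]
    ext i
    fin_cases i <;> simp [vecAt, Poly.evalAt, MvPolynomial.smul_eval]

/-- `Σ_h`: the fields in `H(div; Ω)` that are in the local space on each triangle. -/
def Sh (Ω : Set Plane) (fam : Family) (k : ℕ) (𝒯 : Finset Tri) : Submodule ℝ (L2v Ω) :=
  Hdiv Ω ⊓ brokenSpace Ω fam k 𝒯

/-! ### Distance and error indicator -/

/-- The distance `d(v, w_h)` of `v ∈ L²(Ω)` and a discrete function `w_h` (where `G_h` is used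
for the second argument), with `S = Σ_h`. -/
def errDist (Ω : Set Plane) (S : Submodule ℝ (L2v Ω)) (v w : L2 Ω) : ℝ :=
  Real.sqrt (‖v - w‖ ^ 2
    + aForm Ω (gradOp Ω (Hdiv Ω) v - gradOp Ω S w) (gradOp Ω (Hdiv Ω) v - gradOp Ω S w))

open Classical in
/-- The restriction to `T` of a piecewise polynomial function, as a polynomial. -/
def polyOn (Ω : Set Plane) (T : Tri) (v : L2 Ω) : Poly :=
  if h : ∃ p, RepOn Ω T v p then h.choose else 0

open Classical in
/-- The restriction to `T` of a piecewise polynomial field, as a pair of polynomials. -/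
def vecOn (Ω : Set Plane) (T : Tri) (τ : L2v Ω) : Fin 2 → Poly :=
  if h : ∃ q, VecRepOn Ω T τ q then h.choose else 0

/-- `∇ p`. -/
def polyGrad (p : Poly) : Fin 2 → Poly := fun i => MvPolynomial.pderiv i p

/-- The scalar curl `∂₂ q₁ - ∂₁ q₂`. -/
def polyCurl (q : Fin 2 → Poly) : Poly := MvPolynomial.pderiv 1 (q 0) - MvPolynomial.pderiv 0 (q 1)

open Classical in
/-- The triangles of the mesh, other than `T`, that share the edge of `T` opposite to vertex `i`.
In a conforming triangulation this is one triangle for an internal edge, none for a boundary edge. -/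
def neighbors (𝒯 : Finset Tri) (T : Tri) (i : Fin 3) : Finset Tri :=
  𝒯.filter fun T' => T' ≠ T ∧ T.edgeA i ∈ Set.range T' ∧ T.edgeB i ∈ Set.range T'

/-- `[τ]_E · t_E` at `x ∈ E`, `E` the edge of `T` opposite to vertex `i`: the jump of the tangential
trace on internal edges, the tangential trace on boundary edges. -/
def tangentialJump (Ω : Set Plane) (𝒯 : Finset Tri) (τ : L2v Ω) (T : Tri) (i : Fin 3)
    (x : Plane) : ℝ :=
  ⟪vecAt (vecOn Ω T τ) x, T.tangent i⟫
    - ∑ T' ∈ neighbors 𝒯 T i, ⟪vecAt (vecOn Ω T' τ) x, T.tangent i⟫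

/-- `‖f‖_E²` with respect to arc length, `E` the edge of `T` opposite to vertex `i`. -/
def edgeNormSq (T : Tri) (i : Fin 3) (f : Plane → ℝ) : ℝ :=
  T.edgeLen i * ∫ s in (0 : ℝ)..1, f (AffineMap.lineMap (T.edgeA i) (T.edgeB i) s) ^ 2

/-- `|g|_{η,T}²` for `g ∈ M_h`, with `S = Σ_h`. -/
def etaSq (Ω : Set Plane) (S : Submodule ℝ (L2v Ω)) (𝒯 : Finset Tri) (g : L2 Ω) (T : Tri) : ℝ :=
  (∫ x in T.carrier,
      ‖T.diam • (vecAt (vecOn Ω T (gradOp Ω S g)) x - vecAt (polyGrad (polyOn Ω T g)) x)‖ ^ 2)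
    + (∫ x in T.carrier, (T.diam * (polyCurl (vecOn Ω T (gradOp Ω S g))).evalAt x) ^ 2)
    + ∑ i : Fin 3, T.edgeLen i * edgeNormSq T i (tangentialJump Ω 𝒯 (gradOp Ω S g) T i)

/-- The seminorm `|g|_{η,T}`. -/
def etaSeminorm (Ω : Set Plane) (S : Submodule ℝ (L2v Ω)) (𝒯 : Finset Tri) (g : L2 Ω)
    (T : Tri) : ℝ :=
  Real.sqrt (etaSq Ω S 𝒯 g T)

/-- The theoretical error indicator `μ_h(u; T) = |Λ_h u|_{η,T}` on a triangle. -/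
def muLocal {Ω : Set Plane} {S : Submodule ℝ (L2v Ω)} {M : Submodule ℝ (L2 Ω)}
    (D : DiscreteEigensystem Ω S M) (𝒯 : Finset Tri) (n m : ℕ) (lam : ℝ) (u : L2 Ω)
    (T : Tri) : ℝ :=
  etaSeminorm Ω S 𝒯 (D.Lam n m lam u) T

/-- The theoretical error estimator `μ_h(u; ℳ)` for a set `ℳ` of triangles of the mesh `𝒯`. -/
def mu {Ω : Set Plane} {S : Submodule ℝ (L2v Ω)} {M : Submodule ℝ (L2 Ω)}
    (D : DiscreteEigensystem Ω S M) (𝒯 : Finset Tri) (n m : ℕ) (lam : ℝ) (u : L2 Ω)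
    (ℳ : Finset Tri) : ℝ :=
  Real.sqrt (∑ T ∈ ℳ, muLocal D 𝒯 n m lam u T ^ 2)

end MixedFEM

end

noncomputable section

namespace MixedFEM

/-! ### Affine geometry of triangles -/

/-! The proof is the bubble function technique for residual estimators. The relation σ = G(u) says
weakly that σ is the gradient of u and that u vanishes on the boundary of Ω. Let w be any element of
M_h and s = G_h(w). The three residuals s - ∇w, curl s and the tangential jumps of s vanish formally
if (s, w) is replaced by (σ, u), so each of them measures the distance of (s, w) from (σ, u). To
quantify this, each residual is multiplied by a bubble function, and the resulting piecewise
polynomial field is used as a test field in the equation for σ.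

For the first residual the field is a bubble times s - ∇w on one triangle. Integration by parts
moves the gradient to the divergence of the field, and the errors s - σ and w - u remain
(`exists_gradient_residual_le`). For the second it is the Curl of a bubble times curl s, which has
divergence zero, so that σ is orthogonal to it (`exists_curl_residual_le`). For the third it is the
Curl of an extension of the jump into the triangles at the edge (`exists_jump_residual_le`). At an
interior edge this field has weak divergence zero because the two sides induce opposite
orientations. At an edge with no neighbour it does so because test functions vanish on the edge, by
`IsTriangulation.lineMap_notMem`. That such fields may be tested at all is
`IsG.sum_integral_eq_zero`. In each case Young's inequality with a suitable weight absorbs the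
residual into the left side.

The inequalities for bubbles are equivalences of norms on finite-dimensional spaces of polynomials
on the reference triangle (`exists_integral_sq_le`), transported by affine maps. The transport costs
powers of the shape constant κ in h_T² ≤ κ |det|. Newest vertex bisection halves both the area and
the quadratic quantity `Tri.quad`, which dominates h_T², so one κ serves all meshes
(`BisectionRefines.quad_le`).

Summation over the mesh uses that an edge has at most one neighbour across it
(`IsConforming.sum_neighbors_le`). The result is `exists_sum_etaSq_le`, valid for every w in M_h,
and the proposition is the case w = Λ_h u. -/

/-- The cross product of two plane vectors. -/
def cross (v w : Plane) : ℝ := v 0 * w 1 - v 1 * w 0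

/-- The closed reference triangle. -/
def refTri : Set Plane := {y | 0 ≤ y 0 ∧ 0 ≤ y 1 ∧ y 0 + y 1 ≤ 1}

theorem plane_ext {x y : Plane} (h0 : x 0 = y 0) (h1 : x 1 = y 1) : x = y := by
  ext i
  fin_cases i
  · exact h0
  · exact h1

theorem plane_norm_sq (v : Plane) : ‖v‖ ^ 2 = v 0 ^ 2 + v 1 ^ 2 := by
  rw [EuclideanSpace.norm_sq_eq, Fin.sum_univ_two]
  simp

theorem plane_inner (v w : Plane) : ⟪v, w⟫ = v 0 * w 0 + v 1 * w 1 := by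
  rw [PiLp.inner_apply, Fin.sum_univ_two]
  simp [mul_comm]

theorem isCompact_refTri : IsCompact refTri := by
  refine Metric.isCompact_of_isClosed_isBounded ?_ ?_
  · have c0 : Continuous fun y : Plane => y 0 := by fun_prop
    have c1 : Continuous fun y : Plane => y 1 := by fun_prop
    exact (isClosed_le continuous_const c0).inter
      ((isClosed_le continuous_const c1).inter (isClosed_le (c0.add c1) continuous_const))
  · refine (Metric.isBounded_closedBall (x := (0 : Plane)) (r := 2)).subset ?_
    rintro y ⟨h0, h1, h2⟩
    rw [mem_closedBall_zero_iff]
    have h := plane_norm_sq y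
    nlinarith [norm_nonneg y]

theorem convex_refTri : Convex ℝ refTri := by
  rintro x ⟨hx0, hx1, hx2⟩ y ⟨hy0, hy1, hy2⟩ a b ha hb hab
  refine ⟨?_, ?_, ?_⟩
  · simp only [PiLp.add_apply, PiLp.smul_apply, smul_eq_mul]; positivity
  · simp only [PiLp.add_apply, PiLp.smul_apply, smul_eq_mul]; positivity
  · simp only [PiLp.add_apply, PiLp.smul_apply, smul_eq_mul]
    nlinarith

namespace Tri

/-- Twice the signed area of a triangle. -/
def det (T : Tri) : ℝ := cross (T 1 - T 0) (T 2 - T 0)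

/-- The affine map of the reference triangle onto `T`. -/
def toPlane (T : Tri) (y : Plane) : Plane := T 0 + (y 0 • (T 1 - T 0) + y 1 • (T 2 - T 0))

/-- The inverse of `Tri.toPlane`. -/
def coord (T : Tri) (x : Plane) : Plane :=
  !₂[cross (x - T 0) (T 2 - T 0) / T.det, cross (T 1 - T 0) (x - T 0) / T.det]

theorem coord_zero (T : Tri) (x : Plane) :
    T.coord x 0 = cross (x - T 0) (T 2 - T 0) / T.det := rfl

theorem coord_one (T : Tri) (x : Plane) :
    T.coord x 1 = cross (T 1 - T 0) (x - T 0) / T.det := rfl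

theorem coord_toPlane {T : Tri} (h : T.det ≠ 0) (y : Plane) : T.coord (T.toPlane y) = y := by
  apply plane_ext
  · rw [coord_zero, div_eq_iff h]
    simp [det, cross, toPlane]
    ring
  · rw [coord_one, div_eq_iff h]
    simp [det, cross, toPlane]
    ring

theorem toPlane_coord {T : Tri} (h : T.det ≠ 0) (x : Plane) : T.toPlane (T.coord x) = x := by
  have key : ∀ i, T.det * (T.toPlane (T.coord x) i - x i) = 0 := by
    intro i
    have e0 : T.coord x 0 * T.det = cross (x - T 0) (T 2 - T 0) := by
      rw [coord_zero, div_mul_cancel₀ _ h]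
    have e1 : T.coord x 1 * T.det = cross (T 1 - T 0) (x - T 0) := by
      rw [coord_one, div_mul_cancel₀ _ h]
    have : T.det * (T.toPlane (T.coord x) i - x i) = T.det * (T 0 i - x i)
        + (T.coord x 0 * T.det * (T 1 i - T 0 i) + T.coord x 1 * T.det * (T 2 i - T 0 i)) := by
      simp [toPlane]
      ring
    rw [this, e0, e1]
    fin_cases i <;> simp [det, cross] <;> ring
  have e := fun i => sub_eq_zero.1 ((mul_eq_zero.1 (key i)).resolve_left h)
  exact plane_ext (e 0) (e 1)

theorem continuous_toPlane (T : Tri) : Continuous T.toPlane := by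
  unfold toPlane; fun_prop

theorem continuous_coord (T : Tri) : Continuous T.coord := by
  unfold coord cross; fun_prop

theorem toPlane_combo (T : Tri) (x y : Plane) {a b : ℝ} (hab : a + b = 1) :
    T.toPlane (a • x + b • y) = a • T.toPlane x + b • T.toPlane y := by
  have hb : b = 1 - a := by linarith
  subst hb
  apply plane_ext <;> simp [toPlane] <;> ring

theorem range_eq (T : Tri) : Set.range T = {T 0, T 1, T 2} := by
  ext x
  simp only [Set.mem_range, Fin.exists_fin_succ, Set.mem_insert_iff, Set.mem_singleton_iff]
  simp [eq_comm]

theorem carrier_eq_image (T : Tri) : T.carrier = T.toPlane '' refTri := by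
  apply Set.Subset.antisymm
  · refine convexHull_min ?_ ?_
    · rw [range_eq]
      rintro x (rfl | rfl | rfl)
      · exact ⟨0, by simp [refTri], by simp [toPlane]⟩
      · exact ⟨!₂[1, 0], by simp [refTri], by simp [toPlane]⟩
      · exact ⟨!₂[0, 1], by simp [refTri], by simp [toPlane]⟩
    · rintro _ ⟨x, hx, rfl⟩ _ ⟨y, hy, rfl⟩ a b ha hb hab
      exact ⟨a • x + b • y, convex_refTri hx hy ha hb hab, T.toPlane_combo x y hab⟩
  · rintro _ ⟨y, ⟨h0, h1, h2⟩, rfl⟩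
    have hc : Convex ℝ T.carrier := convex_convexHull _ _
    have hm : ∀ i, T i ∈ T.carrier := fun i => subset_convexHull _ _ ⟨i, rfl⟩
    have := hc.sum_mem (t := Finset.univ) (w := ![1 - y 0 - y 1, y 0, y 1]) (z := T)
      (by intro i _; fin_cases i <;> simp <;> linarith)
      (by simp [Fin.sum_univ_three]; ring) (fun i _ => hm i)
    convert this using 1
    simp only [Fin.sum_univ_three]
    apply plane_ext <;> simp [toPlane] <;> ring

theorem mem_carrier_iff {T : Tri} (h : T.det ≠ 0) {x : Plane} :
    x ∈ T.carrier ↔ T.coord x ∈ refTri := by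
  rw [carrier_eq_image]
  constructor
  · rintro ⟨y, hy, rfl⟩
    rwa [coord_toPlane h]
  · intro hx
    exact ⟨_, hx, toPlane_coord h x⟩

theorem isCompact_carrier (T : Tri) : IsCompact T.carrier := by
  rw [carrier_eq_image]
  exact isCompact_refTri.image T.continuous_toPlane

theorem convex_carrier (T : Tri) : Convex ℝ T.carrier := convex_convexHull _ _

theorem measurableSet_carrier (T : Tri) : MeasurableSet T.carrier :=
  T.isCompact_carrier.isClosed.measurableSet

theorem toPlane_mem_interior {T : Tri} (h : T.det ≠ 0) {y : Plane} (h0 : 0 < y 0) (h1 : 0 < y 1)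
    (h2 : y 0 + y 1 < 1) : T.toPlane y ∈ interior T.carrier := by
  rw [mem_interior]
  refine ⟨T.coord ⁻¹' {y | 0 < y 0 ∧ 0 < y 1 ∧ y 0 + y 1 < 1}, ?_, ?_, ?_⟩
  · rintro x ⟨a, b, c⟩
    exact (mem_carrier_iff h).2 ⟨a.le, b.le, c.le⟩
  · refine IsOpen.preimage T.continuous_coord ?_
    have c0 : Continuous fun y : Plane => y 0 := by fun_prop
    have c1 : Continuous fun y : Plane => y 1 := by fun_prop
    exact (isOpen_lt continuous_const c0).inter
      ((isOpen_lt continuous_const c1).inter (isOpen_lt (c0.add c1) continuous_const))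
  · rw [Set.mem_preimage, coord_toPlane h]
    exact ⟨h0, h1, h2⟩

/-- If the two edge vectors at `T 0` are parallel, crossing coordinates gives affine relations
between the vertices. -/
theorem det_ne_zero {T : Tri} (hT : AffineIndependent ℝ T) : T.det ≠ 0 := by
  intro h
  have key : ∀ w : Fin 3 → ℝ, w 0 + w 1 + w 2 = 0 →
      w 0 • T 0 + w 1 • T 1 + w 2 • T 2 = 0 → ∀ i, w i = 0 := by
    intro w h1 h2 i
    refine affineIndependent_iff.1 hT Finset.univ w ?_ ?_ i (Finset.mem_univ i)
    · rw [Fin.sum_univ_three, h1]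
    · rw [Fin.sum_univ_three, h2]
  have hd : (T 1 0 - T 0 0) * (T 2 1 - T 0 1) - (T 1 1 - T 0 1) * (T 2 0 - T 0 0) = 0 := h
  -- The relation is c₀ • b - b₀ • c = 0 for b = `T 1 - T 0` and c = `T 2 - T 0`. It yields b₀ = 0,
  -- and the analogous relation with second coordinates yields b₁ = 0. Then `T 1 = T 0`, which is
  -- itself a forbidden relation.
  have a := key ![-(T 2 0 - T 0 0) + (T 1 0 - T 0 0), T 2 0 - T 0 0, -(T 1 0 - T 0 0)]
    (by simp) (by apply plane_ext <;> simp <;> linarith)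
  have b := key ![-(T 2 1 - T 0 1) + (T 1 1 - T 0 1), T 2 1 - T 0 1, -(T 1 1 - T 0 1)]
    (by simp) (by apply plane_ext <;> simp <;> linarith)
  have a2 := a 2
  have b2 := b 2
  simp at a2 b2
  have c := key ![-1, 1, 0] (by simp) (by apply plane_ext <;> simp <;> linarith) 1
  simp at c

/-- The linear part of `Tri.toPlane`. -/
def lin (T : Tri) : Plane →L[ℝ] Plane :=
  (EuclideanSpace.proj (0 : Fin 2) : Plane →L[ℝ] ℝ).smulRight (T 1 - T 0)
    + (EuclideanSpace.proj (1 : Fin 2) : Plane →L[ℝ] ℝ).smulRight (T 2 - T 0)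

theorem hasFDerivAt_toPlane (T : Tri) (y : Plane) : HasFDerivAt T.toPlane T.lin y := by
  have h := (T.lin.hasFDerivAt (x := y)).const_add (T 0)
  exact h

theorem det_lin (T : Tri) : T.lin.det = T.det := by
  have : T.lin.det = LinearMap.det (T.lin : Plane →ₗ[ℝ] Plane) := rfl
  rw [this, ← LinearMap.det_toMatrix (EuclideanSpace.basisFun (Fin 2) ℝ).toBasis,
    Matrix.det_fin_two]
  simp [LinearMap.toMatrix_apply, lin, det, cross]
  ring

/-- Change of variables to the reference triangle. -/
theorem integral_carrier {T : Tri} (h : T.det ≠ 0) (g : Plane → ℝ) :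
    ∫ x in T.carrier, g x = |T.det| * ∫ y in refTri, g (T.toPlane y) := by
  rw [carrier_eq_image, integral_image_eq_integral_abs_det_fderiv_smul volume
    isCompact_refTri.measurableSet (fun y _ => (T.hasFDerivAt_toPlane y).hasFDerivWithinAt)
    (fun x _ y _ hxy => by rw [← coord_toPlane h x, hxy, coord_toPlane h]) g]
  simp only [det_lin, smul_eq_mul]
  rw [integral_const_mul]

end Tri

/-! ### Polynomials -/

namespace Poly

@[simp] theorem evalAt_add (p q : Poly) (x : Plane) :
    Poly.evalAt (p + q) x = p.evalAt x + q.evalAt x := by simp [Poly.evalAt]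

@[simp] theorem evalAt_sub (p q : Poly) (x : Plane) :
    Poly.evalAt (p - q) x = p.evalAt x - q.evalAt x := by simp [Poly.evalAt]

@[simp] theorem evalAt_neg (p : Poly) (x : Plane) :
    Poly.evalAt (-p) x = -p.evalAt x := by simp [Poly.evalAt]

@[simp] theorem evalAt_mul (p q : Poly) (x : Plane) :
    Poly.evalAt (p * q) x = p.evalAt x * q.evalAt x := by simp [Poly.evalAt]

@[simp] theorem evalAt_pow (p : Poly) (n : ℕ) (x : Plane) :
    Poly.evalAt (p ^ n) x = p.evalAt x ^ n := by simp [Poly.evalAt]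

@[simp] theorem evalAt_smul (c : ℝ) (p : Poly) (x : Plane) :
    Poly.evalAt (c • p) x = c * p.evalAt x := by simp [Poly.evalAt, MvPolynomial.smul_eval]

@[simp] theorem evalAt_zero (x : Plane) : Poly.evalAt 0 x = 0 := by simp [Poly.evalAt]

@[simp] theorem evalAt_one (x : Plane) : Poly.evalAt 1 x = 1 := by simp [Poly.evalAt]

@[simp] theorem evalAt_C (c : ℝ) (x : Plane) : Poly.evalAt (MvPolynomial.C c) x = c := by
  simp [Poly.evalAt]

@[simp] theorem evalAt_X (i : Fin 2) (x : Plane) : Poly.evalAt (MvPolynomial.X i) x = x i := by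
  simp [Poly.evalAt]

/-- The derivative of a polynomial at a point. -/
def deriv (p : Poly) (x : Plane) : Plane →L[ℝ] ℝ :=
  Poly.evalAt (MvPolynomial.pderiv 0 p) x • (EuclideanSpace.proj (0 : Fin 2) : Plane →L[ℝ] ℝ)
    + Poly.evalAt (MvPolynomial.pderiv 1 p) x • (EuclideanSpace.proj (1 : Fin 2) : Plane →L[ℝ] ℝ)

theorem deriv_apply (p : Poly) (x v : Plane) :
    p.deriv x v = Poly.evalAt (MvPolynomial.pderiv 0 p) x * v 0
      + Poly.evalAt (MvPolynomial.pderiv 1 p) x * v 1 := by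
  simp [Poly.deriv]

theorem hasFDerivAt (p : Poly) (x : Plane) : HasFDerivAt p.evalAt (p.deriv x) x := by
  induction p using MvPolynomial.induction_on with
  | C a =>
    have e : Poly.evalAt (MvPolynomial.C a) = fun _ => a := by ext y; simp
    rw [e]
    refine (hasFDerivAt_const a x).congr_fderiv ?_
    ext v; simp [deriv_apply]
  | add p q hp hq =>
    have e : Poly.evalAt (p + q) = fun y => Poly.evalAt p y + Poly.evalAt q y := by ext y; simp
    rw [e]
    refine (hp.add hq).congr_fderiv ?_
    ext v; simp [deriv_apply]; ring
  | mul_X p i hp =>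
    have hX : HasFDerivAt (fun y : Plane => y i)
        (EuclideanSpace.proj i : Plane →L[ℝ] ℝ) x :=
      (EuclideanSpace.proj i : Plane →L[ℝ] ℝ).hasFDerivAt
    have e : Poly.evalAt (p * MvPolynomial.X i) = fun y => Poly.evalAt p y * y i := by
      ext y; simp
    rw [e]
    refine (hp.mul hX).congr_fderiv ?_
    ext v
    fin_cases i <;> simp [deriv_apply, MvPolynomial.pderiv_X] <;> ring

theorem contDiff (p : Poly) : ContDiff ℝ ∞ p.evalAt := by
  induction p using MvPolynomial.induction_on with
  | C a =>
    have : Poly.evalAt (MvPolynomial.C a) = fun _ => a := by ext y; simp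
    rw [this]; exact contDiff_const
  | add p q hp hq =>
    have : Poly.evalAt (p + q) = fun x => Poly.evalAt p x + Poly.evalAt q x := by ext y; simp
    rw [this]; exact hp.add hq
  | mul_X p i hp =>
    have : Poly.evalAt (p * MvPolynomial.X i) = fun x => Poly.evalAt p x * x i := by ext y; simp
    rw [this]
    exact hp.mul (EuclideanSpace.proj i : Plane →L[ℝ] ℝ).contDiff

theorem continuous (p : Poly) : Continuous p.evalAt := p.contDiff.continuous

/-- Substitution of an affine map of the plane into a polynomial. -/
def affSub (a : Plane) (M : Fin 2 → Plane) : Poly →ₐ[ℝ] Poly :=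
  MvPolynomial.aeval fun i => MvPolynomial.C (a i) + (MvPolynomial.C (M 0 i) * MvPolynomial.X 0
    + MvPolynomial.C (M 1 i) * MvPolynomial.X 1)

theorem evalAt_affSub (a : Plane) (M : Fin 2 → Plane) (p : Poly) (y : Plane) :
    (affSub a M p).evalAt y = p.evalAt (a + (y 0 • M 0 + y 1 • M 1)) := by
  induction p using MvPolynomial.induction_on with
  | C c => simp [affSub]
  | add p q hp hq => simp [hp, hq]
  | mul_X p i hp =>
    rw [map_mul, evalAt_mul, hp, evalAt_mul]
    congr 1
    simp [affSub]
    ring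

theorem pderiv_affSub (a : Plane) (M : Fin 2 → Plane) (p : Poly) (j : Fin 2) :
    MvPolynomial.pderiv j (affSub a M p)
      = MvPolynomial.C (M j 0) * affSub a M (MvPolynomial.pderiv 0 p)
        + MvPolynomial.C (M j 1) * affSub a M (MvPolynomial.pderiv 1 p) := by
  induction p using MvPolynomial.induction_on with
  | C c => simp [affSub]
  | add p q hp hq => simp only [map_add, hp, hq]; ring
  | mul_X p i hp =>
    have hX : ∀ i, affSub a M (MvPolynomial.X i) = MvPolynomial.C (a i)
        + (MvPolynomial.C (M 0 i) * MvPolynomial.X 0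
          + MvPolynomial.C (M 1 i) * MvPolynomial.X 1) := by
      intro i; simp [affSub]
    rw [map_mul, Derivation.leibniz, hp, hX]
    fin_cases i <;> fin_cases j <;>
      simp [MvPolynomial.pderiv_X, hX] <;> ring

/-- Each variable is replaced by a polynomial of degree at most one. The bound keeps all transported
polynomials in one finite-dimensional space, so constants on the reference triangle do not depend on
the triangle. -/
theorem totalDegree_affSub_le (a : Plane) (M : Fin 2 → Plane) {p : Poly} {K : ℕ}
    (hp : p ∈ polyLE K) : affSub a M p ∈ polyLE K := by
  rw [polyLE, MvPolynomial.mem_restrictTotalDegree] at hp ⊢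
  have hL : ∀ i : Fin 2, (MvPolynomial.C (a i) + (MvPolynomial.C (M 0 i) * MvPolynomial.X 0
    + MvPolynomial.C (M 1 i) * MvPolynomial.X 1) : Poly).totalDegree ≤ 1 := by
    intro i
    have hm : ∀ (c : ℝ) (j : Fin 2),
        (MvPolynomial.C c * MvPolynomial.X j : Poly).totalDegree ≤ 1 := by
      intro c j
      refine (MvPolynomial.totalDegree_mul _ _).trans ?_
      simp
    refine (MvPolynomial.totalDegree_add _ _).trans (max_le (by simp) ?_)
    exact (MvPolynomial.totalDegree_add _ _).trans (max_le (hm _ _) (hm _ _))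
  rw [affSub, MvPolynomial.aeval_def, MvPolynomial.eval₂_eq]
  refine MvPolynomial.totalDegree_finsetSum_le fun d hd => ?_
  refine (MvPolynomial.totalDegree_mul _ _).trans ?_
  have h1 : (algebraMap ℝ Poly (MvPolynomial.coeff d p)).totalDegree = 0 :=
    MvPolynomial.totalDegree_C _
  rw [h1, zero_add]
  refine (MvPolynomial.totalDegree_finsetProd _ _).trans ?_
  refine le_trans (Finset.sum_le_sum fun i _ =>
    (MvPolynomial.totalDegree_pow _ _).trans (Nat.mul_le_mul_left _ (hL i))) ?_
  simp only [mul_one]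
  exact (MvPolynomial.le_totalDegree hd).trans hp

theorem pderiv_mem_polyLE {p : Poly} {K : ℕ} (hp : p ∈ polyLE K) (i : Fin 2) :
    MvPolynomial.pderiv i p ∈ polyLE K := by
  rw [polyLE, MvPolynomial.mem_restrictTotalDegree] at hp ⊢
  conv_lhs => rw [p.as_sum, map_sum]
  refine MvPolynomial.totalDegree_finsetSum_le fun d hd => ?_
  rw [MvPolynomial.pderiv_monomial]
  refine (MvPolynomial.totalDegree_monomial_le _ _).trans ?_
  refine le_trans ?_ ((MvPolynomial.le_totalDegree hd).trans hp)
  exact Finsupp.degree_mono tsub_le_self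

/-- A polynomial that vanishes in the interior of the reference triangle is zero. -/
theorem eq_zero_of_refTri {p : Poly}
    (h : ∀ y : Plane, 0 < y 0 → 0 < y 1 → y 0 + y 1 < 1 → p.evalAt y = 0) : p = 0 := by
  refine MvPolynomial.funext_set (fun _ => Set.Ioo (0 : ℝ) (1 / 2))
    (fun _ => Set.Ioo_infinite (by norm_num)) fun x hx => ?_
  have h0 := hx 0 (Set.mem_univ _)
  have h1 := hx 1 (Set.mem_univ _)
  have := h (WithLp.toLp 2 x) h0.1 h1.1 (by
    have := h0.2; have := h1.2; simp only [] at *; linarith)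
  simpa [Poly.evalAt] using this

/-- The restriction of a polynomial to a line. -/
def onLine (A B : Plane) : Poly →ₐ[ℝ] Polynomial ℝ :=
  MvPolynomial.aeval fun i => Polynomial.C (A i) + Polynomial.C (B i - A i) * Polynomial.X

theorem eval_onLine (A B : Plane) (p : Poly) (s : ℝ) :
    (onLine A B p).eval s = p.evalAt (AffineMap.lineMap A B s) := by
  induction p using MvPolynomial.induction_on with
  | C c => simp [onLine]
  | add p q hp hq => simp [hp, hq]
  | mul_X p i hp =>
    rw [map_mul, Polynomial.eval_mul, hp, evalAt_mul]
    congr 1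
    simp [onLine, AffineMap.lineMap_apply]
    ring

theorem onLine_mem_degreeLE (A B : Plane) {p : Poly} {K : ℕ} (hp : p ∈ polyLE K) :
    onLine A B p ∈ Polynomial.degreeLE ℝ (K : WithBot ℕ) := by
  have hd : MvPolynomial.totalDegree p ≤ K := (MvPolynomial.mem_restrictTotalDegree _ _ _).1 hp
  have hl : ∀ i : Fin 2,
      (Polynomial.C (A i) + Polynomial.C (B i - A i) * Polynomial.X).natDegree ≤ 1 :=
    fun i => by compute_degree
  have h := MvPolynomial.aeval_natDegree_le p hd _ hl
  rw [mul_one] at h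
  exact Polynomial.mem_degreeLE.2 (Polynomial.natDegree_le_iff_degree_le.1 h)

end Poly

theorem continuous_vecAt (q : Fin 2 → Poly) : Continuous (vecAt q) := by
  have h0 := (q 0).continuous
  have h1 := (q 1).continuous
  unfold vecAt
  refine (PiLp.continuous_toLp 2 _).comp (continuous_pi fun i => ?_)
  fin_cases i
  · exact h0
  · exact h1

@[simp] theorem vecAt_zero (q : Fin 2 → Poly) (x : Plane) : vecAt q x 0 = (q 0).evalAt x := rfl

@[simp] theorem vecAt_one (q : Fin 2 → Poly) (x : Plane) : vecAt q x 1 = (q 1).evalAt x := rfl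

/-! ### Polynomials in reference coordinates -/

namespace Tri

/-- The transformation of a polynomial on `T` to the reference triangle. -/
def pull (T : Tri) : Poly →ₐ[ℝ] Poly := Poly.affSub (T 0) ![T 1 - T 0, T 2 - T 0]

theorem evalAt_pull (T : Tri) (p : Poly) (y : Plane) :
    (T.pull p).evalAt y = p.evalAt (T.toPlane y) := by
  simp [pull, Poly.evalAt_affSub, toPlane]

/-- The transformation of a polynomial on the reference triangle to `T`. -/
def push (T : Tri) : Poly →ₐ[ℝ] Poly :=
  Poly.affSub (T.coord 0)
    ![!₂[(T 2 1 - T 0 1) / T.det, -(T 1 1 - T 0 1) / T.det],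
      !₂[-(T 2 0 - T 0 0) / T.det, (T 1 0 - T 0 0) / T.det]]

theorem evalAt_push (T : Tri) (p : Poly) (x : Plane) :
    (T.push p).evalAt x = p.evalAt (T.coord x) := by
  rw [push, Poly.evalAt_affSub]
  congr 1
  apply plane_ext
  · simp [coord, cross]
    ring
  · simp [coord, cross]
    ring

theorem evalAt_pderiv_zero_push (T : Tri) (p : Poly) (x : Plane) :
    Poly.evalAt (MvPolynomial.pderiv 0 (T.push p)) x
      = ((T 2 1 - T 0 1) * Poly.evalAt (MvPolynomial.pderiv 0 p) (T.coord x)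
        - (T 1 1 - T 0 1) * Poly.evalAt (MvPolynomial.pderiv 1 p) (T.coord x)) / T.det := by
  rw [push, Poly.pderiv_affSub, ← push]
  simp [evalAt_push]
  ring

theorem evalAt_pderiv_one_push (T : Tri) (p : Poly) (x : Plane) :
    Poly.evalAt (MvPolynomial.pderiv 1 (T.push p)) x
      = ((T 1 0 - T 0 0) * Poly.evalAt (MvPolynomial.pderiv 1 p) (T.coord x)
        - (T 2 0 - T 0 0) * Poly.evalAt (MvPolynomial.pderiv 0 p) (T.coord x)) / T.det := by
  rw [push, Poly.pderiv_affSub, ← push]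
  simp [evalAt_push]
  ring

end Tri

/-! ### Green's formula on a triangle -/

/-- Fubini with the second coordinate as outer variable, so that the inner integral runs in the
direction `e₀` and is ready for the fundamental theorem of calculus. -/
theorem integral_refTri {g : Plane → ℝ} (hg : Continuous g) :
    ∫ y in refTri, g y = ∫ t in (0 : ℝ)..1, ∫ s in (0 : ℝ)..(1 - t), g !₂[s, t] := by
  let Φ : ℝ × ℝ ≃ᵐ Plane :=
    MeasurableEquiv.finTwoArrow.symm.trans (MeasurableEquiv.toLp 2 (Fin 2 → ℝ))
  have hΦ : MeasurePreserving Φ :=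
    (PiLp.volume_preserving_toLp (Fin 2)).comp (volume_preserving_finTwoArrow ℝ).symm
  have hval : ∀ p : ℝ × ℝ, Φ p = !₂[p.1, p.2] := by
    intro p
    apply plane_ext <;> rfl
  have hint : IntegrableOn (fun p => g (Φ p)) (Φ ⁻¹' refTri) := by
    have h1 : IntegrableOn g refTri := hg.continuousOn.integrableOn_compact isCompact_refTri
    exact (hΦ.integrableOn_comp_preimage Φ.measurableEmbedding).2 h1
  have hms : MeasurableSet (Φ ⁻¹' refTri) := Φ.measurable isCompact_refTri.measurableSet
  rw [← hΦ.setIntegral_preimage_emb Φ.measurableEmbedding, ← integral_indicator hms,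
    Measure.volume_eq_prod, integral_prod_symm _ ((integrable_indicator_iff hms).2 hint)]
  rw [intervalIntegral.integral_of_le zero_le_one, ← integral_Icc_eq_integral_Ioc,
    ← integral_indicator measurableSet_Icc]
  refine integral_congr_ae (Filter.Eventually.of_forall fun t => ?_)
  by_cases ht : t ∈ Set.Icc (0 : ℝ) 1
  · simp only [Set.indicator_of_mem ht]
    rw [intervalIntegral.integral_of_le (by linarith [ht.2]), ← integral_Icc_eq_integral_Ioc,
      ← integral_indicator measurableSet_Icc]
    refine integral_congr_ae (Filter.Eventually.of_forall fun s => ?_)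
    by_cases hs : s ∈ Set.Icc (0 : ℝ) (1 - t)
    · have hm : (s, t) ∈ Φ ⁻¹' refTri := by
        rw [Set.mem_preimage, hval]
        exact ⟨hs.1, ht.1, by have := hs.2; change s + t ≤ 1; linarith⟩
      simp only [Set.indicator_of_mem hs, Set.indicator_of_mem hm, hval]
    · have hm : (s, t) ∉ Φ ⁻¹' refTri := by
        rw [Set.mem_preimage, hval]
        rintro ⟨h0, h1, h2⟩
        exact hs ⟨h0, by change s + t ≤ 1 at h2; linarith⟩
      simp only [Set.indicator_of_notMem hs, Set.indicator_of_notMem hm]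
  · rw [Set.indicator_of_notMem ht]
    refine integral_eq_zero_of_ae ?_
    refine Filter.Eventually.of_forall fun s => ?_
    have hm : (s, t) ∉ Φ ⁻¹' refTri := by
      rw [Set.mem_preimage, hval]
      rintro ⟨h0, h1, h2⟩
      change 0 ≤ s at h0; change 0 ≤ t at h1; change s + t ≤ 1 at h2
      exact ht ⟨h1, by linarith⟩
    simp only [Set.indicator_of_notMem hm, Pi.zero_apply]

/-- The first standard basis vector. -/
def e₀ : Plane := !₂[1, 0]

/-- The second standard basis vector. -/
def e₁ : Plane := !₂[0, 1]

theorem integral_refTri_fderiv {f : Plane → ℝ} (hf : ContDiff ℝ 1 f) :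
    ∫ y in refTri, fderiv ℝ f y e₀
      = (∫ t in (0 : ℝ)..1, f !₂[1 - t, t]) - ∫ t in (0 : ℝ)..1, f !₂[0, t] := by
  have hc : Continuous fun y => fderiv ℝ f y e₀ :=
    (hf.continuous_fderiv (by simp)).clm_apply continuous_const
  have hfc := hf.continuous
  rw [integral_refTri hc, ← intervalIntegral.integral_sub]
  · refine intervalIntegral.integral_congr fun t _ => ?_
    refine intervalIntegral.integral_eq_sub_of_hasDerivAt
      (f := fun s => f !₂[s, t]) (f' := fun s => fderiv ℝ f !₂[s, t] e₀) ?_ ?_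
    · intro s _
      have h1 : HasDerivAt (fun s : ℝ => (!₂[s, t] : Plane)) e₀ s := by
        have h2 : HasDerivAt (fun s : ℝ => (!₂[0, t] : Plane) + s • e₀) ((1 : ℝ) • e₀) s :=
          ((hasDerivAt_id s).smul_const e₀).const_add _
        rw [one_smul] at h2
        refine h2.congr_of_eventuallyEq (Filter.Eventually.of_forall fun r => ?_)
        apply plane_ext <;> simp [e₀]
      exact ((hf.differentiable (by simp)) _).hasFDerivAt.comp_hasDerivAt s h1
    · refine Continuous.intervalIntegrable ?_ _ _
      exact hc.comp (by fun_prop)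
  · exact Continuous.intervalIntegrable (hfc.comp (by fun_prop)) _ _
  · exact Continuous.intervalIntegrable (hfc.comp (by fun_prop)) _ _

namespace Tri

/-- The affine map carries `e₀` to `T 1 - T 0`. The edge from `T 0` to `T 1` is parallel to this
direction and contributes nothing, so only the other two edges appear. -/
theorem integral_fderiv_edge {T : Tri} (h : T.det ≠ 0) {g : Plane → ℝ} (hg : ContDiff ℝ 1 g) :
    ∫ x in T.carrier, fderiv ℝ g x (T 1 - T 0)
      = |T.det| * ((∫ t in (0 : ℝ)..1, g (AffineMap.lineMap (T 1) (T 2) t))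
        - ∫ t in (0 : ℝ)..1, g (AffineMap.lineMap (T 0) (T 2) t)) := by
  rw [integral_carrier h]
  congr 1
  have hF : ContDiff ℝ 1 T.toPlane := by
    have h0 : ContDiff ℝ 1 (fun y : Plane => T 0 + T.lin y) :=
      contDiff_const.add T.lin.contDiff
    exact h0
  have e : ∀ y, fderiv ℝ (fun y => g (T.toPlane y)) y e₀
      = fderiv ℝ g (T.toPlane y) (T 1 - T 0) := by
    intro y
    have h1 := ((hg.differentiable (by simp)) (T.toPlane y)).hasFDerivAt.comp y
      (T.hasFDerivAt_toPlane y)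
    have h2 := h1.fderiv
    have h3 : T.lin e₀ = T 1 - T 0 := by simp [lin, e₀]
    change fderiv ℝ (g ∘ T.toPlane) y e₀ = _
    rw [h2, ContinuousLinearMap.comp_apply, h3]
  simp only [← e]
  rw [integral_refTri_fderiv (f := fun y => g (T.toPlane y)) (hg.comp hF)]
  congr 1
  · refine intervalIntegral.integral_congr fun t _ => ?_
    refine congrArg g ?_
    apply plane_ext <;> simp [toPlane, AffineMap.lineMap_apply] <;> ring
  · refine intervalIntegral.integral_congr fun t _ => ?_
    refine congrArg g ?_
    apply plane_ext <;> simp [toPlane, AffineMap.lineMap_apply] <;> ring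

/-- The triangle with its vertices permuted. -/
def swap (T : Tri) : Tri := ![T 0, T 2, T 1]

theorem det_swap (T : Tri) : T.swap.det = -T.det := by
  simp [swap, det, cross]
  ring

theorem carrier_swap (T : Tri) : T.swap.carrier = T.carrier := by
  unfold carrier
  congr 1
  rw [range_eq, range_eq]
  simp only [swap, Matrix.cons_val_zero, Matrix.cons_val_one, Matrix.cons_val]
  rw [Set.pair_comm]

theorem fderiv_eq (g : Plane → ℝ) (x v : Plane) :
    fderiv ℝ g x v = v 0 * fderiv ℝ g x e₀ + v 1 * fderiv ℝ g x e₁ := by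
  have : v = v 0 • e₀ + v 1 • e₁ := by apply plane_ext <;> simp [e₀, e₁]
  conv_lhs => rw [this]
  simp

/-- Green's formula for a field that vanishes on two edges. -/
theorem green {T : Tri} (h : T.det ≠ 0) {u₀ u₁ : Plane → ℝ} (hu₀ : ContDiff ℝ 1 u₀)
    (hu₁ : ContDiff ℝ 1 u₁)
    (h12 : ∀ t : ℝ, u₀ (AffineMap.lineMap (T 1) (T 2) t) = 0 ∧
      u₁ (AffineMap.lineMap (T 1) (T 2) t) = 0)
    (h02 : ∀ t : ℝ, u₀ (AffineMap.lineMap (T 0) (T 2) t) = 0 ∧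
      u₁ (AffineMap.lineMap (T 0) (T 2) t) = 0) :
    T.det * ∫ x in T.carrier, (fderiv ℝ u₁ x e₀ - fderiv ℝ u₀ x e₁)
      = |T.det| * ∫ t in (0 : ℝ)..1, (u₀ (AffineMap.lineMap (T 0) (T 1) t) * (T 1 0 - T 0 0)
        + u₁ (AffineMap.lineMap (T 0) (T 1) t) * (T 1 1 - T 0 1)) := by
  have hc : ∀ c d : ℝ, ContDiff ℝ 1 fun x => u₀ x * c + u₁ x * d := fun c d =>
    (hu₀.mul contDiff_const).add (hu₁.mul contDiff_const)
  have hd : ∀ (c d : ℝ) (x v : Plane), fderiv ℝ (fun x => u₀ x * c + u₁ x * d) x v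
      = c * fderiv ℝ u₀ x v + d * fderiv ℝ u₁ x v := by
    intro c d x v
    have := (((hu₀.differentiable (by simp)) x).hasFDerivAt.mul_const c).add
      (((hu₁.differentiable (by simp)) x).hasFDerivAt.mul_const d)
    have e := this.fderiv
    change fderiv ℝ (fun x => u₀ x * c + u₁ x * d) x = _ at e
    rw [e]
    simp
  have hi : ∀ (c d : ℝ) (v : Plane), IntegrableOn
      (fun x => fderiv ℝ (fun x => u₀ x * c + u₁ x * d) x v) T.carrier := fun c d v =>
    (((hc c d).continuous_fderiv (by simp)).clm_apply
      continuous_const).continuousOn.integrableOn_compact T.isCompact_carrier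
  have a1 := integral_fderiv_edge h (hc (T 2 0 - T 0 0) (T 2 1 - T 0 1))
  -- Exchanging two vertices gives the direction `T 2 - T 0`. The determinant changes sign, its
  -- absolute value does not.
  have a2 := integral_fderiv_edge (T := T.swap) (by rw [det_swap]; exact neg_ne_zero.2 h)
    (hc (T 1 0 - T 0 0) (T 1 1 - T 0 1))
  rw [det_swap, carrier_swap, abs_neg] at a2
  have s0 : T.swap 0 = T 0 := rfl
  have s1 : T.swap 1 = T 2 := rfl
  have s2 : T.swap 2 = T 1 := rfl
  rw [s0, s1, s2] at a2
  have h21 : ∀ t : ℝ, u₀ (AffineMap.lineMap (T 2) (T 1) t) = 0 ∧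
      u₁ (AffineMap.lineMap (T 2) (T 1) t) = 0 := by
    intro t
    rw [← AffineMap.lineMap_apply_one_sub]
    exact h12 _
  simp only [h12, h02, zero_mul, add_zero, intervalIntegral.integral_zero, sub_zero,
    mul_zero] at a1
  simp only [h21, zero_mul, add_zero, intervalIntegral.integral_zero, zero_sub] at a2
  rw [← integral_const_mul]
  -- With b = `T 1 - T 0` and c = `T 2 - T 0`, the curl times b × c is the derivative of u·c along b
  -- minus the derivative of u·b along c. This reduces Green's formula to derivatives along edges.
  have e : ∀ x, T.det * (fderiv ℝ u₁ x e₀ - fderiv ℝ u₀ x e₁)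
      = fderiv ℝ (fun x => u₀ x * (T 2 0 - T 0 0) + u₁ x * (T 2 1 - T 0 1)) x (T 1 - T 0)
      - fderiv ℝ (fun x => u₀ x * (T 1 0 - T 0 0) + u₁ x * (T 1 1 - T 0 1)) x (T 2 - T 0) := by
    intro x
    rw [hd, hd, fderiv_eq u₀ x (T 1 - T 0), fderiv_eq u₁ x (T 1 - T 0),
      fderiv_eq u₀ x (T 2 - T 0), fderiv_eq u₁ x (T 2 - T 0)]
    simp [det, cross]
    ring
  simp only [e]
  rw [integral_sub (hi _ _ _) (hi _ _ _), a1, a2]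
  ring

end Tri

/-- `Curl ψ = (-∂₂ψ, ∂₁ψ)`. -/
def vecCurl (ψ : Poly) : Fin 2 → Poly :=
  ![-MvPolynomial.pderiv 1 ψ, MvPolynomial.pderiv 0 ψ]

theorem Poly.fderiv_e₀ (p : Poly) (x : Plane) :
    fderiv ℝ p.evalAt x e₀ = Poly.evalAt (MvPolynomial.pderiv 0 p) x := by
  rw [(p.hasFDerivAt x).fderiv, Poly.deriv_apply]
  simp [e₀]

theorem Poly.fderiv_e₁ (p : Poly) (x : Plane) :
    fderiv ℝ p.evalAt x e₁ = Poly.evalAt (MvPolynomial.pderiv 1 p) x := by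
  rw [(p.hasFDerivAt x).fderiv, Poly.deriv_apply]
  simp [e₁]

theorem fderiv_poly_mul (ψ : Poly) {g : Plane → ℝ} (hg : ContDiff ℝ 1 g) (x v : Plane) :
    fderiv ℝ (fun x => ψ.evalAt x * g x) x v
      = ψ.evalAt x * fderiv ℝ g x v + fderiv ℝ ψ.evalAt x v * g x := by
  have h := (ψ.hasFDerivAt x).mul ((hg.differentiable (by simp)) x).hasFDerivAt
  have e := h.fderiv
  change fderiv ℝ (fun x => ψ.evalAt x * g x) x = _ at e
  rw [e, (ψ.hasFDerivAt x).fderiv]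
  simp [mul_comm]

namespace Tri

/-- Green's formula for the product of a field and a function that vanishes on two edges. -/
theorem integral_curl {T : Tri} (h : T.det ≠ 0) (ψ : Poly) {q₀ q₁ : Plane → ℝ}
    (hq₀ : ContDiff ℝ 1 q₀) (hq₁ : ContDiff ℝ 1 q₁)
    (h12 : ∀ t : ℝ, ψ.evalAt (AffineMap.lineMap (T 1) (T 2) t) = 0)
    (h02 : ∀ t : ℝ, ψ.evalAt (AffineMap.lineMap (T 0) (T 2) t) = 0) :
    T.det * ∫ x in T.carrier, (vecAt (vecCurl ψ) x 0 * q₀ x + vecAt (vecCurl ψ) x 1 * q₁ x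
        - ψ.evalAt x * (fderiv ℝ q₀ x e₁ - fderiv ℝ q₁ x e₀))
      = |T.det| * ∫ t in (0 : ℝ)..1, ψ.evalAt (AffineMap.lineMap (T 0) (T 1) t)
        * (q₀ (AffineMap.lineMap (T 0) (T 1) t) * (T 1 0 - T 0 0)
          + q₁ (AffineMap.lineMap (T 0) (T 1) t) * (T 1 1 - T 0 1)) := by
  have hψ : ContDiff ℝ 1 ψ.evalAt := ψ.contDiff.of_le (by simp)
  have key := green h (hψ.mul hq₀) (hψ.mul hq₁)
    (fun t => by simp only [h12, zero_mul, and_self])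
    (fun t => by simp only [h02, zero_mul, and_self])
  convert key using 3
  · ext x
    have a := fderiv_poly_mul ψ hq₀ x e₁
    have b := fderiv_poly_mul ψ hq₁ x e₀
    rw [a, b, Poly.fderiv_e₀, Poly.fderiv_e₁]
    simp [vecCurl]
    ring
  · ext t
    ring

/-- Integration by parts against a function that vanishes on the boundary. -/
theorem integral_parts {T : Tri} (h : T.det ≠ 0) (ψ : Poly) {g : Plane → ℝ}
    (hg : ContDiff ℝ 1 g)
    (h12 : ∀ t : ℝ, ψ.evalAt (AffineMap.lineMap (T 1) (T 2) t) = 0)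
    (h02 : ∀ t : ℝ, ψ.evalAt (AffineMap.lineMap (T 0) (T 2) t) = 0)
    (h01 : ∀ t : ℝ, ψ.evalAt (AffineMap.lineMap (T 0) (T 1) t) = 0) :
    (∫ x in T.carrier, (ψ.evalAt x * fderiv ℝ g x e₀
        + Poly.evalAt (MvPolynomial.pderiv 0 ψ) x * g x) = 0) ∧
      ∫ x in T.carrier, (ψ.evalAt x * fderiv ℝ g x e₁
        + Poly.evalAt (MvPolynomial.pderiv 1 ψ) x * g x) = 0 := by
  -- A field with one component equal to zero has a single partial derivative as its curl.
  have k0 := integral_curl h ψ (q₀ := fun _ => 0) contDiff_const hg h12 h02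
  have k1 := integral_curl h ψ (q₁ := fun _ => 0) hg contDiff_const h12 h02
  simp only [h01, zero_mul, intervalIntegral.integral_zero, mul_zero] at k0 k1
  constructor
  · rw [← (mul_eq_zero.1 k0).resolve_left h]
    refine integral_congr_ae (Filter.Eventually.of_forall fun x => ?_)
    simp [vecCurl]
    ring
  · rw [← neg_eq_zero, ← (mul_eq_zero.1 k1).resolve_left h, ← integral_neg]
    refine integral_congr_ae (Filter.Eventually.of_forall fun x => ?_)
    simp [vecCurl]
    ring

end Tri

/-! ### Equivalence of norms and estimates on the reference triangle -/

theorem memLp_of_isCompact {E : Type*} [NormedAddCommGroup E] {f : Plane → E}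
    (hf : Continuous f) {s : Set Plane} (hs : IsCompact s) :
    MemLp f 2 (volume.restrict s) := by
  have : IsFiniteMeasure (volume.restrict s) := ⟨by
    rw [Measure.restrict_apply_univ]; exact hs.measure_lt_top⟩
  obtain ⟨C, hC⟩ := hs.exists_bound_of_continuousOn hf.continuousOn
  refine MemLp.of_bound (hf.continuousOn.aestronglyMeasurable_of_isCompact hs hs.measurableSet) C ?_
  filter_upwards [ae_restrict_mem hs.measurableSet] with x hx using hC x hx

theorem memLp_of_continuous_unit {f : ℝ → ℝ} (hf : Continuous f) :
    MemLp f 2 (volume.restrict (Set.Ioc 0 1)) := by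
  have : IsFiniteMeasure (volume.restrict (Set.Ioc (0 : ℝ) 1)) := inferInstance
  obtain ⟨C, hC⟩ := (isCompact_Icc (a := (0 : ℝ)) (b := 1)).exists_bound_of_continuousOn
    hf.continuousOn
  refine MemLp.of_bound hf.aestronglyMeasurable C ?_
  filter_upwards [ae_restrict_mem measurableSet_Ioc] with x hx
    using hC x ⟨hx.1.le, hx.2⟩

theorem norm_sq_eq_integral {X : Type*} [MeasurableSpace X] {μ : Measure X} {f : X → ℝ}
    (hf : MemLp f 2 μ) : ‖hf.toLp‖ ^ 2 = ∫ x, f x ^ 2 ∂μ := by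
  rw [← real_inner_self_eq_norm_sq, L2.inner_def]
  refine integral_congr_ae ?_
  filter_upwards [hf.coeFn_toLp] with x hx
  rw [hx]
  simp [sq]

/-- The map `L₁` embeds the finite-dimensional space V into L². Composing the inverse of this
embedding with `L₂` gives a linear map on a finite-dimensional normed space, which is automatically
continuous. All inverse and bubble estimates below come from this. -/
theorem exists_integral_sq_le {V X Y : Type*} [AddCommGroup V] [Module ℝ V]
    [FiniteDimensional ℝ V] [MeasurableSpace X] [MeasurableSpace Y] {μ : Measure X}
    {ν : Measure Y} (L₁ : V →ₗ[ℝ] X → ℝ) (L₂ : V →ₗ[ℝ] Y → ℝ)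
    (h₁ : ∀ v, MemLp (L₁ v) 2 μ) (h₂ : ∀ v, MemLp (L₂ v) 2 ν)
    (hinj : ∀ v, L₁ v =ᵐ[μ] 0 → v = 0) :
    ∃ C : ℝ, 0 < C ∧ ∀ v, ∫ y, L₂ v y ^ 2 ∂ν ≤ C * ∫ x, L₁ v x ^ 2 ∂μ := by
  let M₁ : V →ₗ[ℝ] Lp ℝ 2 μ :=
    { toFun := fun v => (h₁ v).toLp
      map_add' := fun v w => by
        rw [← MemLp.toLp_add]
        exact MemLp.toLp_congr _ _ (by rw [map_add])
      map_smul' := fun c v => by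
        rw [RingHom.id_apply, ← MemLp.toLp_const_smul]
        exact MemLp.toLp_congr _ _ (by rw [map_smul]) }
  let M₂ : V →ₗ[ℝ] Lp ℝ 2 ν :=
    { toFun := fun v => (h₂ v).toLp
      map_add' := fun v w => by
        rw [← MemLp.toLp_add]
        exact MemLp.toLp_congr _ _ (by rw [map_add])
      map_smul' := fun c v => by
        rw [RingHom.id_apply, ← MemLp.toLp_const_smul]
        exact MemLp.toLp_congr _ _ (by rw [map_smul]) }
  have hi : Function.Injective M₁ := by
    rw [← LinearMap.ker_eq_bot, LinearMap.ker_eq_bot']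
    intro v hv
    exact hinj v ((h₁ v).coeFn_toLp.symm.trans ((Lp.eq_zero_iff_ae_eq_zero).1 hv))
  let e := LinearEquiv.ofInjective M₁ hi
  let g : LinearMap.range M₁ →L[ℝ] Lp ℝ 2 ν :=
    LinearMap.toContinuousLinearMap (M₂ ∘ₗ (e.symm : LinearMap.range M₁ →ₗ[ℝ] V))
  -- The summand 1 only makes the constant positive when `g = 0`.
  refine ⟨‖g‖ ^ 2 + 1, by positivity, fun v => ?_⟩
  have hg : g (e v) = M₂ v := by simp [g]
  have he : ‖e v‖ = ‖M₁ v‖ := rfl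
  have h := g.le_opNorm (e v)
  rw [hg, he] at h
  rw [← norm_sq_eq_integral (h₁ v), ← norm_sq_eq_integral (h₂ v)]
  change ‖M₂ v‖ ^ 2 ≤ _ * ‖M₁ v‖ ^ 2
  have h3 := pow_le_pow_left₀ (norm_nonneg _) h 2
  nlinarith [sq_nonneg ‖M₁ v‖]

/-- Evaluation of polynomials, as a linear map. -/
def Poly.evalLin : Poly →ₗ[ℝ] Plane → ℝ where
  toFun p := p.evalAt
  map_add' p q := by ext x; simp
  map_smul' c p := by ext x; simp

theorem Poly.eq_zero_of_ae_refTri {p : Poly} (h : p.evalAt =ᵐ[volume.restrict refTri] 0) :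
    p = 0 := by
  have ho : IsOpen {y : Plane | 0 < y 0 ∧ 0 < y 1 ∧ y 0 + y 1 < 1} := by
    have c0 : Continuous fun y : Plane => y 0 := by fun_prop
    have c1 : Continuous fun y : Plane => y 1 := by fun_prop
    exact (isOpen_lt continuous_const c0).inter
      ((isOpen_lt continuous_const c1).inter (isOpen_lt (c0.add c1) continuous_const))
  have hsub : {y : Plane | 0 < y 0 ∧ 0 < y 1 ∧ y 0 + y 1 < 1} ⊆ refTri :=
    fun y hy => ⟨hy.1.le, hy.2.1.le, hy.2.2.le⟩
  have h' := ae_restrict_of_ae_restrict_of_subset hsub h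
  have h2 := Measure.eqOn_open_of_ae_eq h' ho p.continuous.continuousOn continuousOn_const
  exact Poly.eq_zero_of_refTri fun y h0 h1 h2' => h2 (x := y) ⟨h0, h1, h2'⟩

theorem exists_refTri_le {V : Type*} [AddCommGroup V] [Module ℝ V]
    [FiniteDimensional ℝ V] (A B : V →ₗ[ℝ] Poly) (hA : ∀ v, A v = 0 → v = 0) :
    ∃ C : ℝ, 0 < C ∧ ∀ v, ∫ y in refTri, (B v).evalAt y ^ 2
      ≤ C * ∫ y in refTri, (A v).evalAt y ^ 2 :=
  exists_integral_sq_le (Poly.evalLin ∘ₗ A) (Poly.evalLin ∘ₗ B)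
    (fun v => memLp_of_isCompact (A v).continuous isCompact_refTri)
    (fun v => memLp_of_isCompact (B v).continuous isCompact_refTri)
    (fun v hv => hA v (Poly.eq_zero_of_ae_refTri hv))

/-- The cubic bubble function of the reference triangle. -/
def bubble : Poly :=
  MvPolynomial.X 0 * MvPolynomial.X 1 * (1 - MvPolynomial.X 0 - MvPolynomial.X 1)

theorem evalAt_bubble (y : Plane) : bubble.evalAt y = y 0 * y 1 * (1 - y 0 - y 1) := by
  simp [bubble]

theorem bubble_ne_zero : bubble ≠ 0 := by
  intro h
  have := evalAt_bubble !₂[1 / 4, 1 / 4]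
  rw [h] at this
  norm_num at this

instance (K : ℕ) : FiniteDimensional ℝ (polyLE K) :=
  inferInstanceAs (Module.Finite ℝ (MvPolynomial.restrictTotalDegree (Fin 2) ℝ K))

/-- The partial derivative as a linear map. -/
def Poly.pdLin (i : Fin 2) : Poly →ₗ[ℝ] Poly :=
  (MvPolynomial.pderiv i : Derivation ℝ Poly Poly).toLinearMap

/-- The test function carries the square of the bubble. Its product with p then integrates to the
square integral of `bubble * p`, the image of p under an injective linear map, which is the form
needed for equivalence of norms. -/
theorem exists_bubble_bounds (K : ℕ) : ∃ C : ℝ, 0 < C ∧ ∀ p ∈ polyLE K,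
    (∫ y in refTri, p.evalAt y ^ 2 ≤ C * ∫ y in refTri, (bubble * p).evalAt y ^ 2) ∧
    (∫ y in refTri, (bubble ^ 2 * p).evalAt y ^ 2 ≤ C * ∫ y in refTri, p.evalAt y ^ 2) ∧
    ∀ i, ∫ y in refTri, Poly.evalAt (MvPolynomial.pderiv i (bubble ^ 2 * p)) y ^ 2
      ≤ C * ∫ y in refTri, p.evalAt y ^ 2 := by
  have hi : ∀ v : polyLE K, (polyLE K).subtype v = 0 → v = 0 := fun v hv => by simpa using hv
  obtain ⟨C₁, h₁, H₁⟩ := exists_refTri_le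
    (LinearMap.mulLeft ℝ bubble ∘ₗ (polyLE K).subtype) (polyLE K).subtype (fun v hv => by
      have : bubble * (v : Poly) = 0 := hv
      simpa using (mul_eq_zero.1 this).resolve_left bubble_ne_zero)
  obtain ⟨C₂, h₂, H₂⟩ := exists_refTri_le (polyLE K).subtype
    (LinearMap.mulLeft ℝ (bubble ^ 2) ∘ₗ (polyLE K).subtype) hi
  obtain ⟨C₃, h₃, H₃⟩ := exists_refTri_le (polyLE K).subtype
    (Poly.pdLin 0 ∘ₗ LinearMap.mulLeft ℝ (bubble ^ 2) ∘ₗ (polyLE K).subtype) hi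
  obtain ⟨C₄, h₄, H₄⟩ := exists_refTri_le (polyLE K).subtype
    (Poly.pdLin 1 ∘ₗ LinearMap.mulLeft ℝ (bubble ^ 2) ∘ₗ (polyLE K).subtype) hi
  refine ⟨C₁ + C₂ + C₃ + C₄, by positivity, fun p hp => ?_⟩
  have n : ∀ f : Plane → ℝ, 0 ≤ ∫ y in refTri, f y ^ 2 :=
    fun f => integral_nonneg fun y => sq_nonneg _
  refine ⟨(H₁ ⟨p, hp⟩).trans ?_, (H₂ ⟨p, hp⟩).trans ?_, fun i => ?_⟩
  · exact mul_le_mul_of_nonneg_right (by linarith) (n _)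
  · exact mul_le_mul_of_nonneg_right (by linarith) (n _)
  · fin_cases i
    · exact (H₃ ⟨p, hp⟩).trans (mul_le_mul_of_nonneg_right (by linarith) (n _))
    · exact (H₄ ⟨p, hp⟩).trans (mul_le_mul_of_nonneg_right (by linarith) (n _))

/-! ### Extension of polynomials from an edge -/

/-- The extension of a polynomial on the edge from `(0, 0)` to `(1, 0)` to a function on the
reference triangle, weighted with the square of the bubble function of this edge. -/
def edgeBubble : Polynomial ℝ →ₗ[ℝ] Poly :=
  LinearMap.mulLeft ℝ (((1 - MvPolynomial.X 0 - MvPolynomial.X 1) * MvPolynomial.X 0) ^ 2)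
    ∘ₗ (Polynomial.aeval (MvPolynomial.X 0 : Poly)).toLinearMap

theorem evalAt_edgeBubble (J : Polynomial ℝ) (y : Plane) :
    (edgeBubble J).evalAt y = ((1 - y 0 - y 1) * y 0) ^ 2 * J.eval (y 0) := by
  have h : Poly.evalAt (Polynomial.aeval (MvPolynomial.X 0 : Poly) J) y = J.eval (y 0) := by
    induction J using Polynomial.induction_on' with
    | add p q hp hq => simp [hp, hq]
    | monomial n a => simp [Polynomial.aeval_monomial, MvPolynomial.algebraMap_eq]
  have e : edgeBubble J = ((1 - MvPolynomial.X 0 - MvPolynomial.X 1) * MvPolynomial.X 0) ^ 2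
    * Polynomial.aeval (MvPolynomial.X 0 : Poly) J := rfl
  rw [e, Poly.evalAt_mul, h]
  simp

instance (K : ℕ) : FiniteDimensional ℝ (Polynomial.degreeLE ℝ (K : WithBot ℕ)) := by
  classical
  rw [Polynomial.degreeLE_eq_span_X_pow]
  exact FiniteDimensional.span_finset ℝ _

/-- Evaluation of univariate polynomials, as a linear map. -/
def polynomialEvalLin : Polynomial ℝ →ₗ[ℝ] ℝ → ℝ where
  toFun p := fun s => p.eval s
  map_add' p q := by ext x; simp
  map_smul' c p := by ext x; simp

theorem polynomial_eq_zero_of_ae {p : Polynomial ℝ}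
    (h : (fun s => p.eval s) =ᵐ[volume.restrict (Set.Ioc (0 : ℝ) 1)] 0) : p = 0 := by
  have h' := ae_restrict_of_ae_restrict_of_subset Set.Ioo_subset_Ioc_self h
  have h2 := Measure.eqOn_open_of_ae_eq h' isOpen_Ioo p.continuous.continuousOn
    continuousOn_const
  refine Polynomial.eq_zero_of_infinite_isRoot p ((Set.Ioo_infinite zero_lt_one).mono ?_)
  exact fun s hs => h2 hs

/-- Here the norm that controls everything lives on the edge, parametrized by the unit interval, and
the extensions are measured on the triangle. As before, squaring the edge bubble turns the weighted
edge integral into the square integral of an injective image. -/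
theorem exists_edgeBubble_bounds (K : ℕ) : ∃ C : ℝ, 0 < C ∧
    ∀ J ∈ Polynomial.degreeLE ℝ (K : WithBot ℕ),
    (∫ s in (0 : ℝ)..1, J.eval s ^ 2 ≤ C * ∫ s in (0 : ℝ)..1, ((1 - s) * s) ^ 2 * J.eval s ^ 2) ∧
    (∫ y in refTri, (edgeBubble J).evalAt y ^ 2 ≤ C * ∫ s in (0 : ℝ)..1, J.eval s ^ 2) ∧
    ∀ i, ∫ y in refTri, Poly.evalAt (MvPolynomial.pderiv i (edgeBubble J)) y ^ 2
      ≤ C * ∫ s in (0 : ℝ)..1, J.eval s ^ 2 := by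
  let V := Polynomial.degreeLE ℝ (K : WithBot ℕ)
  have hm : ∀ p : Polynomial ℝ,
      MemLp (polynomialEvalLin p) 2 (volume.restrict (Set.Ioc (0 : ℝ) 1)) :=
    fun p => memLp_of_continuous_unit p.continuous
  have hi : ∀ v : V, (polynomialEvalLin ∘ₗ V.subtype) v
      =ᵐ[volume.restrict (Set.Ioc (0 : ℝ) 1)] 0 → v = 0 :=
    fun v hv => by
      have := polynomial_eq_zero_of_ae (p := (v : Polynomial ℝ)) hv
      simpa using this
  have hne : ((1 - Polynomial.X) * Polynomial.X : Polynomial ℝ) ≠ 0 := by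
    intro h
    have := congrArg (Polynomial.eval (1 / 2)) h
    norm_num at this
  have hr : ∀ B : V →ₗ[ℝ] Poly, ∃ C : ℝ, 0 < C ∧ ∀ v : V, ∫ y in refTri, (B v).evalAt y ^ 2
      ≤ C * ∫ s in Set.Ioc (0 : ℝ) 1, (v : Polynomial ℝ).eval s ^ 2 := fun B =>
    exists_integral_sq_le (polynomialEvalLin ∘ₗ V.subtype) (Poly.evalLin ∘ₗ B)
      (fun v => hm _) (fun v => memLp_of_isCompact (B v).continuous isCompact_refTri) hi
  obtain ⟨C₁, h₁, H₁⟩ := exists_integral_sq_le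
    (polynomialEvalLin ∘ₗ LinearMap.mulLeft ℝ ((1 - Polynomial.X) * Polynomial.X) ∘ₗ V.subtype)
    (polynomialEvalLin ∘ₗ V.subtype) (μ := volume.restrict (Set.Ioc (0 : ℝ) 1))
    (ν := volume.restrict (Set.Ioc (0 : ℝ) 1)) (fun v => hm _) (fun v => hm _) (fun v hv => by
      have := polynomial_eq_zero_of_ae
        (p := (1 - Polynomial.X) * Polynomial.X * (v : Polynomial ℝ)) (by
          filter_upwards [hv] with s hs
          simpa [polynomialEvalLin, or_assoc] using hs)
      simpa using (mul_eq_zero.1 this).resolve_left hne)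
  obtain ⟨C₂, h₂, H₂⟩ := hr (edgeBubble ∘ₗ V.subtype)
  obtain ⟨C₃, h₃, H₃⟩ := hr (Poly.pdLin 0 ∘ₗ edgeBubble ∘ₗ V.subtype)
  obtain ⟨C₄, h₄, H₄⟩ := hr (Poly.pdLin 1 ∘ₗ edgeBubble ∘ₗ V.subtype)
  refine ⟨C₁ + C₂ + C₃ + C₄, by positivity, fun p hp => ?_⟩
  simp only [intervalIntegral.integral_of_le zero_le_one]
  have n : ∀ f : ℝ → ℝ, 0 ≤ ∫ y in Set.Ioc (0 : ℝ) 1, f y ^ 2 :=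
    fun f => integral_nonneg fun y => sq_nonneg _
  refine ⟨(H₁ ⟨p, hp⟩).trans ?_, (H₂ ⟨p, hp⟩).trans ?_, fun i => ?_⟩
  · have e : ∀ s, (polynomialEvalLin ∘ₗ LinearMap.mulLeft ℝ ((1 - Polynomial.X) * Polynomial.X)
        ∘ₗ V.subtype) ⟨p, hp⟩ s ^ 2 = ((1 - s) * s) ^ 2 * p.eval s ^ 2 := by
      intro s
      simp [polynomialEvalLin]
      ring
    simp only [e]
    refine mul_le_mul_of_nonneg_right (by linarith) (integral_nonneg fun s => ?_)
    positivity
  · exact mul_le_mul_of_nonneg_right (by linarith) (n _)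
  · fin_cases i
    · exact (H₃ ⟨p, hp⟩).trans (mul_le_mul_of_nonneg_right (by linarith) (n _))
    · exact (H₄ ⟨p, hp⟩).trans (mul_le_mul_of_nonneg_right (by linarith) (n _))

/-! ### Newest vertex bisection and shape regularity -/

namespace Tri

/-- The squared length of the refinement edge plus four times the squared length of the median on
it. Both this number and the area are halved by newest vertex bisection. -/
def quad (T : Tri) : ℝ := ‖T 1 - T 0‖ ^ 2 + 4 * ‖T 2 - midpoint ℝ (T 0) (T 1)‖ ^ 2

theorem midpoint_apply (a b : Plane) (i : Fin 2) : midpoint ℝ a b i = (a i + b i) / 2 := by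
  rw [midpoint_eq_smul_add]
  simp
  ring

/-- The refinement edge of the child is an old edge at `T 2`, and twice its median is parallel and
equal in length to the other old edge at `T 2`. So the quantity for the child is the sum of the
squares of these two edges, which the parallelogram law turns into half of the quantity for the
parent. -/
theorem quad_child₁ (T : Tri) : T.child₁.quad = T.quad / 2 := by
  simp [quad, child₁, plane_norm_sq, midpoint_apply]
  ring

theorem quad_child₂ (T : Tri) : T.child₂.quad = T.quad / 2 := by
  simp [quad, child₂, plane_norm_sq, midpoint_apply]
  ring

theorem det_child₁ (T : Tri) : T.child₁.det = -(T.det / 2) := by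
  simp [det, child₁, cross]
  ring

theorem det_child₂ (T : Tri) : T.child₂.det = T.det / 2 := by
  simp [det, child₂, cross]
  ring

theorem quad_nonneg (T : Tri) : 0 ≤ T.quad := by unfold quad; positivity

theorem carrier_subset {T S : Tri} (h : ∀ i, S i ∈ T.carrier) : S.carrier ⊆ T.carrier :=
  convexHull_min (by rintro _ ⟨i, rfl⟩; exact h i) T.convex_carrier

theorem vertex_mem (T : Tri) (i : Fin 3) : T i ∈ T.carrier := subset_convexHull _ _ ⟨i, rfl⟩

theorem carrier_children (T : Tri) : T.child₁.carrier ∪ T.child₂.carrier = T.carrier := by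
  have hm : midpoint ℝ (T 0) (T 1) ∈ T.carrier :=
    T.convex_carrier.midpoint_mem (T.vertex_mem 0) (T.vertex_mem 1)
  apply Set.Subset.antisymm
  · refine Set.union_subset (carrier_subset fun i => ?_) (carrier_subset fun i => ?_)
    · fin_cases i
      · exact T.vertex_mem 0
      · exact T.vertex_mem 2
      · exact hm
    · fin_cases i
      · exact T.vertex_mem 1
      · exact T.vertex_mem 2
      · exact hm
  · rw [T.carrier_eq_image]
    rintro _ ⟨y, ⟨h0, h1, h2⟩, rfl⟩
    -- The median from `T 2` separates points by which of the barycentric coordinates at `T 1` and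
    -- `T 0` is larger. In the child the smaller one is doubled and becomes the coordinate of the
    -- midpoint.
    by_cases h : y 0 ≤ 1 - y 0 - y 1
    · left
      rw [carrier_eq_image]
      refine ⟨!₂[y 1, 2 * y 0], ⟨?_, ?_, ?_⟩, ?_⟩
      · simpa using h1
      · simpa using h0
      · simp; linarith
      · apply plane_ext <;> simp [toPlane, child₁] <;> ring
    · right
      rw [carrier_eq_image]
      refine ⟨!₂[y 1, 2 * (1 - y 0 - y 1)], ⟨?_, ?_, ?_⟩, ?_⟩
      · simpa using h1
      · simp; linarith
      · simp; linarith
      · apply plane_ext <;> simp [toPlane, child₂] <;> ring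

theorem dist_le_diam (T : Tri) (i j : Fin 3) : dist (T i) (T j) ≤ T.diam :=
  Metric.dist_le_diam_of_mem T.isCompact_carrier.isBounded (T.vertex_mem i) (T.vertex_mem j)

theorem diam_nonneg (T : Tri) : 0 ≤ T.diam := Metric.diam_nonneg

theorem diam_sq_le_quad (T : Tri) : T.diam ^ 2 ≤ T.quad := by
  have hd : ∀ i j, dist (T i) (T j) ≤ Real.sqrt T.quad := by
    intro i j
    refine Real.le_sqrt_of_sq_le ?_
    rw [dist_eq_norm, plane_norm_sq]
    simp only [quad, plane_norm_sq, PiLp.sub_apply, midpoint_apply]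
    fin_cases i <;> fin_cases j <;> simp only [Fin.zero_eta, Fin.mk_one, Fin.reduceFinMk] <;>
      nlinarith [sq_nonneg (T 1 0 - T 0 0), sq_nonneg (T 1 1 - T 0 1),
        sq_nonneg (T 2 0 - T 0 0), sq_nonneg (T 2 1 - T 0 1),
        sq_nonneg (T 2 0 - T 1 0), sq_nonneg (T 2 1 - T 1 1),
        sq_nonneg (T 2 0 - (T 0 0 + T 1 0) / 2), sq_nonneg (T 2 1 - (T 0 1 + T 1 1) / 2)]
  have h : T.diam ≤ Real.sqrt T.quad := by
    rw [diam, carrier, convexHull_diam]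
    refine Metric.diam_le_of_forall_dist_le (Real.sqrt_nonneg _) ?_
    rintro _ ⟨i, rfl⟩ _ ⟨j, rfl⟩
    exact hd i j
  calc T.diam ^ 2 ≤ Real.sqrt T.quad ^ 2 := pow_le_pow_left₀ T.diam_nonneg h 2
    _ = T.quad := Real.sq_sqrt T.quad_nonneg

theorem abs_det_le (T : Tri) : |T.det| ≤ T.diam ^ 2 := by
  have h1 := T.dist_le_diam 1 0
  have h2 := T.dist_le_diam 2 0
  rw [dist_eq_norm] at h1 h2
  have a := pow_le_pow_left₀ (norm_nonneg _) h1 2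
  have b := pow_le_pow_left₀ (norm_nonneg _) h2 2
  rw [plane_norm_sq] at a b
  simp only [PiLp.sub_apply] at a b
  rw [abs_le]
  simp only [det, cross, PiLp.sub_apply]
  constructor
  · nlinarith [sq_nonneg (T 1 0 - T 0 0 + (T 2 1 - T 0 1)),
      sq_nonneg (T 1 1 - T 0 1 - (T 2 0 - T 0 0))]
  · nlinarith [sq_nonneg (T 1 0 - T 0 0 - (T 2 1 - T 0 1)),
      sq_nonneg (T 1 1 - T 0 1 + (T 2 0 - T 0 0))]

end Tri

/-- Both sides of the first inequality are halved exactly in every bisection, so shape regularity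
passes to all descendants with the same κ, including through nonconforming intermediate meshes. -/
theorem BisectionRefines.quad_le {𝒯₀ 𝒯 : Finset Tri} (h : BisectionRefines 𝒯₀ 𝒯) {κ Q : ℝ}
    (h₀ : ∀ T ∈ 𝒯₀, T.quad ≤ κ * |T.det| ∧ T.quad ≤ Q) :
    ∀ T ∈ 𝒯, T.quad ≤ κ * |T.det| ∧ T.quad ≤ Q := by
  induction h with
  | refl => exact h₀
  | step h hT ih =>
    rename_i 𝒯 T
    intro S hS
    have hTq := ih T hT
    have hq := T.quad_nonneg
    rw [Finset.mem_insert, Finset.mem_insert] at hS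
    rcases hS with rfl | rfl | hS
    · rw [Tri.quad_child₁, Tri.det_child₁, abs_neg, abs_div, abs_two]
      constructor <;> linarith [hTq.1, hTq.2]
    · rw [Tri.quad_child₂, Tri.det_child₂, abs_div, abs_two]
      constructor <;> linarith [hTq.1, hTq.2]
    · exact ih S (Finset.mem_of_mem_erase hS)

theorem BisectionRefines.iUnion_carrier {𝒯₀ 𝒯 : Finset Tri} (h : BisectionRefines 𝒯₀ 𝒯) :
    ⋃ T ∈ 𝒯, T.carrier = ⋃ T ∈ 𝒯₀, T.carrier := by
  classical
  induction h with
  | refl => rfl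
  | step h hT ih =>
    rename_i 𝒯 T
    rw [← ih, Finset.set_biUnion_insert, Finset.set_biUnion_insert, ← Set.union_assoc,
      Tri.carrier_children, ← Finset.set_biUnion_insert, Finset.insert_erase hT]

theorem exists_shape_bounds {𝒯₀ : Finset Tri} (h : ∀ T ∈ 𝒯₀, T.det ≠ 0) :
    ∃ κ Q : ℝ, 0 < κ ∧ 0 < Q ∧ ∀ T ∈ 𝒯₀, T.quad ≤ κ * |T.det| ∧ T.quad ≤ Q := by
  have n1 : ∀ T ∈ 𝒯₀, 0 ≤ Tri.quad T / |T.det| := fun T _ =>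
    div_nonneg T.quad_nonneg (abs_nonneg _)
  have n2 : ∀ T ∈ 𝒯₀, 0 ≤ Tri.quad T := fun T _ => T.quad_nonneg
  -- A sum over the finite initial mesh bounds each of its nonnegative terms; the summand 1 gives
  -- positivity even for an empty mesh.
  refine ⟨1 + ∑ T ∈ 𝒯₀, T.quad / |T.det|, 1 + ∑ T ∈ 𝒯₀, T.quad,
    by linarith [Finset.sum_nonneg n1], by linarith [Finset.sum_nonneg n2], fun T hT => ⟨?_, ?_⟩⟩
  · have h1 := Finset.single_le_sum n1 hT
    rw [← div_le_iff₀ (abs_pos.2 (h T hT))]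
    linarith
  · have h1 := Finset.single_le_sum n2 hT
    linarith

theorem admissible_isTriangulation {Ω : Set Plane} {𝒯₀ 𝒯 : Finset Tri}
    (h₀ : IsTriangulation Ω 𝒯₀) (h : 𝒯 ∈ admissibleMeshes 𝒯₀) : IsTriangulation Ω 𝒯 :=
  ⟨h.2, by rw [h.1.iUnion_carrier]; exact h₀.interior_eq⟩

theorem exists_admissible_bounds {Ω : Set Plane} {𝒯₀ : Finset Tri}
    (h₀ : IsTriangulation Ω 𝒯₀) : ∃ κ Q : ℝ, 0 < κ ∧ 0 < Q ∧
      ∀ 𝒯 ∈ admissibleMeshes 𝒯₀, ∀ T ∈ 𝒯, T.diam ^ 2 ≤ κ * |T.det| ∧ T.diam ^ 2 ≤ Q := by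
  obtain ⟨κ, Q, hκ, hQ, h⟩ := exists_shape_bounds (𝒯₀ := 𝒯₀)
    fun T hT => Tri.det_ne_zero (h₀.conforming.nondegenerate T hT)
  refine ⟨κ, Q, hκ, hQ, fun 𝒯 h𝒯 T hT => ?_⟩
  have := h𝒯.1.quad_le h T hT
  exact ⟨T.diam_sq_le_quad.trans this.1, T.diam_sq_le_quad.trans this.2⟩

/-! ### Edges and neighbours -/

namespace Tri

/-- The triangle `T` with its vertices permuted so that the edge from `T j` to `T l` comes first. -/
def reorder (T : Tri) (j l : Fin 3) : Tri := ![T j, T l, T (-(j + l))]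

/-- The three indices in `Fin 3` sum to zero, so for different j and l the remaining index is `-(j +
l)`. -/
theorem neg_one_fin : (-1 : Fin 3) = 2 := rfl

theorem neg_two_fin : (-2 : Fin 3) = 1 := rfl

theorem carrier_reorder (T : Tri) {j l : Fin 3} (h : j ≠ l) :
    (T.reorder j l).carrier = T.carrier := by
  unfold carrier
  congr 1
  rw [range_eq, range_eq]
  ext x
  fin_cases j <;> fin_cases l <;> first
    | exact absurd rfl h
    | (simp [reorder, neg_one_fin, neg_two_fin]; tauto)
    | simp [reorder, neg_one_fin]

theorem abs_det_reorder (T : Tri) {j l : Fin 3} (h : j ≠ l) :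
    |(T.reorder j l).det| = |T.det| := by
  rw [abs_eq_abs]
  fin_cases j <;> fin_cases l <;> first
    | exact absurd rfl h
    | (left; rfl)
    | (left; simp [reorder, det, cross, neg_one_fin, neg_two_fin]; ring1)
    | (right; simp [reorder, det, cross, neg_one_fin, neg_two_fin]; ring1)

theorem injective_of_det {T : Tri} (h : T.det ≠ 0) : Function.Injective T := by
  intro i j hij
  by_contra hne
  have := T.abs_det_reorder hne
  rw [show (T.reorder i j).det = 0 by simp [reorder, det, cross, hij]] at this
  simp only [abs_zero] at this
  exact h (abs_eq_zero.1 this.symm)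

/-- The triangle `T` with its vertices permuted so that the edge opposite to vertex `i`
comes first. -/
def edgeFirst (T : Tri) (i : Fin 3) : Tri := T.reorder (i + 1) (i + 2)

theorem carrier_edgeFirst (T : Tri) (i : Fin 3) : (T.edgeFirst i).carrier = T.carrier :=
  T.carrier_reorder (by fin_cases i <;> decide)

theorem abs_det_edgeFirst (T : Tri) (i : Fin 3) : |(T.edgeFirst i).det| = |T.det| :=
  T.abs_det_reorder (by fin_cases i <;> decide)

theorem coord_lineMap {T : Tri} (h : T.det ≠ 0) (s : ℝ) :
    T.coord (AffineMap.lineMap (T 0) (T 1) s) = !₂[s, 0] := by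
  have e : (AffineMap.lineMap (T 0) (T 1) s : Plane) = T.toPlane !₂[s, 0] := by
    simp [toPlane, AffineMap.lineMap_apply, add_comm]
  rw [e, coord_toPlane h]

/-- Two triangles with a common edge and disjoint interiors lie on different sides of it. -/
theorem det_mul_det_neg {V W : Tri} (hV : V.det ≠ 0) (hW : W.det ≠ 0) (h0 : V 0 = W 0)
    (h1 : V 1 = W 1) (hd : Disjoint (interior V.carrier) (interior W.carrier)) :
    V.det * W.det < 0 := by
  by_contra hcon
  have hpos : 0 < V.det * W.det := lt_of_le_of_ne (not_lt.1 hcon) (mul_ne_zero hV hW).symm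
  set y := W.coord (V 2) with hy
  have hβ : 0 < y 1 := by
    have e : y 1 = V.det / W.det := by
      rw [hy, coord_one, ← h0, ← h1]
      rfl
    rw [e]
    have := (div_pos_iff_of_pos_right (b := W.det * W.det) (a := V.det * W.det)
      (mul_self_pos.2 hW)).2 hpos
    rwa [mul_div_mul_right _ _ hW] at this
  -- If the determinants had the same sign, then `y 1 > 0`. The point slightly above the midpoint of
  -- the common edge, with coordinates (1/2, δ) in V, has coordinates (1/2 + δ y₀, δ y₁) in W. This
  -- δ keeps it in the interior of both triangles.
  set δ : ℝ := 1 / (4 * (1 + |y 0| + y 1)) with hδ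
  have hD : 0 < 1 + |y 0| + y 1 := by positivity
  have hδ0 : 0 < δ := by positivity
  have hδD : δ * (1 + |y 0| + y 1) = 1 / 4 := by rw [hδ]; field_simp
  have hp1 : 0 ≤ δ * |y 0| := by positivity
  have hp2 : 0 < δ * y 1 := by positivity
  have ha := neg_abs_le (y 0)
  have hb := le_abs_self (y 0)
  have ha' : -(δ * |y 0|) ≤ δ * y 0 := by nlinarith
  have hb' : δ * y 0 ≤ δ * |y 0| := by nlinarith
  have hsum : δ + δ * |y 0| + δ * y 1 = 1 / 4 := by linarith
  have m1 : V.toPlane !₂[1 / 2, δ] ∈ interior V.carrier :=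
    toPlane_mem_interior hV (by simp) (by simpa using hδ0) (by simp; linarith)
  have m2 : W.toPlane !₂[1 / 2 + δ * y 0, δ * y 1] ∈ interior W.carrier :=
    toPlane_mem_interior hW (by simp; linarith) (by simpa using hp2) (by simp; linarith)
  have e2 : V 2 = W.toPlane y := by rw [hy, toPlane_coord hW]
  have e : V.toPlane !₂[1 / 2, δ] = W.toPlane !₂[1 / 2 + δ * y 0, δ * y 1] := by
    unfold toPlane at e2 ⊢
    rw [e2, h0, h1]
    apply plane_ext <;> simp <;> ring
  rw [e] at m1
  exact Set.disjoint_left.1 hd m1 m2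

end Tri

theorem mem_neighbors {𝒯 : Finset Tri} {T T' : Tri} {i : Fin 3} :
    T' ∈ neighbors 𝒯 T i ↔
      T' ∈ 𝒯 ∧ T' ≠ T ∧ T.edgeA i ∈ Set.range T' ∧ T.edgeB i ∈ Set.range T' := by
  classical
  simp [neighbors]

theorem edgeA_ne_edgeB {T : Tri} (h : T.det ≠ 0) (i : Fin 3) : T.edgeA i ≠ T.edgeB i := by
  intro e
  have := Tri.injective_of_det h e
  fin_cases i <;> exact absurd this (by decide)

namespace IsConforming

variable {𝒯 : Finset Tri}

theorem det_ne_zero (h : IsConforming 𝒯) {T : Tri} (hT : T ∈ 𝒯) : T.det ≠ 0 :=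
  Tri.det_ne_zero (h.nondegenerate T hT)

theorem edgeFirst_det_ne_zero (h : IsConforming 𝒯) {T : Tri} (hT : T ∈ 𝒯) (i : Fin 3) :
    (T.edgeFirst i).det ≠ 0 := by
  rw [← abs_pos, Tri.abs_det_edgeFirst, abs_pos]
  exact h.det_ne_zero hT

theorem exists_neighbor_reorder (h : IsConforming 𝒯) {T T' : Tri} (hT : T ∈ 𝒯) {i : Fin 3}
    (hT' : T' ∈ neighbors 𝒯 T i) :
    ∃ j l : Fin 3, j ≠ l ∧ T'.reorder j l 0 = T.edgeA i ∧ T'.reorder j l 1 = T.edgeB i := by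
  obtain ⟨-, -, ⟨j, hj⟩, ⟨l, hl⟩⟩ := mem_neighbors.1 hT'
  refine ⟨j, l, ?_, hj, hl⟩
  rintro rfl
  exact edgeA_ne_edgeB (h.det_ne_zero hT) i (hj.symm.trans hl)

theorem det_reorder_ne_zero (h : IsConforming 𝒯) {T : Tri} (hT : T ∈ 𝒯) {j l : Fin 3}
    (hjl : j ≠ l) : (T.reorder j l).det ≠ 0 := by
  rw [← abs_pos, Tri.abs_det_reorder _ hjl, abs_pos]
  exact h.det_ne_zero hT

theorem neighbor_det_neg (h : IsConforming 𝒯) {T T' : Tri} (hT : T ∈ 𝒯) {i j l : Fin 3}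
    (hT' : T' ∈ neighbors 𝒯 T i) (hjl : j ≠ l) (h0 : T'.reorder j l 0 = T.edgeA i)
    (h1 : T'.reorder j l 1 = T.edgeB i) : (T.edgeFirst i).det * (T'.reorder j l).det < 0 := by
  have hm := mem_neighbors.1 hT'
  refine Tri.det_mul_det_neg (h.edgeFirst_det_ne_zero hT i) (h.det_reorder_ne_zero hm.1 hjl)
    h0.symm h1.symm ?_
  rw [Tri.carrier_edgeFirst, Tri.carrier_reorder _ hjl]
  exact h.disjoint_interior T hT T' hm.1 hm.2.1.symm

/-- With the common edge oriented alike, any two of the three triangles would have determinants of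
opposite signs, which is impossible for three real numbers. -/
theorem neighbors_subsingleton (h : IsConforming 𝒯) {T T₁ T₂ : Tri} (hT : T ∈ 𝒯) {i : Fin 3}
    (h₁ : T₁ ∈ neighbors 𝒯 T i) (h₂ : T₂ ∈ neighbors 𝒯 T i) : T₁ = T₂ := by
  by_contra hne
  obtain ⟨j₁, l₁, hjl₁, a₁, b₁⟩ := h.exists_neighbor_reorder hT h₁
  obtain ⟨j₂, l₂, hjl₂, a₂, b₂⟩ := h.exists_neighbor_reorder hT h₂
  have m₁ := (mem_neighbors.1 h₁).1
  have m₂ := (mem_neighbors.1 h₂).1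
  have n₁ := h.neighbor_det_neg hT h₁ hjl₁ a₁ b₁
  have n₂ := h.neighbor_det_neg hT h₂ hjl₂ a₂ b₂
  have n₃ := Tri.det_mul_det_neg (h.det_reorder_ne_zero m₁ hjl₁) (h.det_reorder_ne_zero m₂ hjl₂)
    (a₁.trans a₂.symm) (b₁.trans b₂.symm) (by
      rw [Tri.carrier_reorder _ hjl₁, Tri.carrier_reorder _ hjl₂]
      exact h.disjoint_interior T₁ m₁ T₂ m₂ hne)
  have := mul_pos_of_neg_of_neg n₁ n₂
  nlinarith [mul_self_nonneg (T.edgeFirst i).det]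

theorem card_neighbors_le (h : IsConforming 𝒯) {T : Tri} (hT : T ∈ 𝒯) (i : Fin 3) :
    (neighbors 𝒯 T i).card ≤ 1 :=
  Finset.card_le_one.2 fun _ h₁ _ h₂ => h.neighbors_subsingleton hT h₁ h₂

theorem neighbors_symm (h : IsConforming 𝒯) {T T' : Tri} (hT : T ∈ 𝒯) {i : Fin 3}
    (hT' : T' ∈ neighbors 𝒯 T i) : ∃ j, T ∈ neighbors 𝒯 T' j := by
  obtain ⟨j, l, hjl, h0, h1⟩ := h.exists_neighbor_reorder hT hT'
  have hm := mem_neighbors.1 hT'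
  have e0 : T' j = T.edgeA i := h0
  have e1 : T' l = T.edgeB i := h1
  have m0 : T' j ∈ Set.range T := by rw [e0]; exact ⟨_, rfl⟩
  have m1 : T' l ∈ Set.range T := by rw [e1]; exact ⟨_, rfl⟩
  refine ⟨-(j + l), mem_neighbors.2 ⟨hT, hm.2.1.symm, ?_⟩⟩
  unfold Tri.edgeA Tri.edgeB
  revert m0 m1
  generalize Set.range T = R
  fin_cases j <;> fin_cases l <;> first
    | exact absurd rfl hjl
    | exact fun a b => ⟨a, b⟩
    | exact fun a b => ⟨b, a⟩

end IsConforming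

/-- The relative interior of an edge that belongs to one triangle only is not in the domain. -/
theorem IsTriangulation.lineMap_notMem {Ω : Set Plane} {𝒯 : Finset Tri}
    (h : IsTriangulation Ω 𝒯) {T : Tri} (hT : T ∈ 𝒯) {i : Fin 3} (hn : neighbors 𝒯 T i = ∅)
    {s : ℝ} (hs0 : 0 < s) (hs1 : s < 1) :
    (AffineMap.lineMap (T.edgeA i) (T.edgeB i) s : Plane) ∉ Ω := by
  classical
  intro hx
  set V := T.edgeFirst i with hVdef
  have hV : V.det ≠ 0 := h.conforming.edgeFirst_det_ne_zero hT i
  have hVc : V.carrier = T.carrier := T.carrier_edgeFirst i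
  set x : Plane := AffineMap.lineMap (T.edgeA i) (T.edgeB i) s with hxdef
  have hcx : V.coord x = !₂[s, 0] := Tri.coord_lineMap hV s
  have hxT : x ∈ T.carrier := by
    rw [← hVc, Tri.mem_carrier_iff hV, hcx]
    exact ⟨by simpa using hs0.le, by simp, by simpa using hs1.le⟩
  have hcoord : ∀ v ∈ Set.range T, v = V 0 ∨ v = V 1 ∨ v = V 2 := by
    intro v hv
    have : v ∈ Set.range V := by
      rcases hv with ⟨r, rfl⟩
      rw [Tri.range_eq]
      fin_cases i <;> fin_cases r <;> 
        simp [hVdef, Tri.edgeFirst, Tri.reorder, Tri.neg_one_fin, Tri.neg_two_fin]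
    rwa [Tri.range_eq] at this
  have c0 : V.coord (V 0) = !₂[0, 0] := by
    have := Tri.coord_toPlane hV !₂[0, 0]
    rwa [show V.toPlane !₂[0, 0] = V 0 by simp [Tri.toPlane]] at this
  have c1 : V.coord (V 1) = !₂[1, 0] := by
    have := Tri.coord_toPlane hV !₂[1, 0]
    rwa [show V.toPlane !₂[1, 0] = V 1 by simp [Tri.toPlane]] at this
  have c2 : V.coord (V 2) = !₂[0, 1] := by
    have := Tri.coord_toPlane hV !₂[0, 1]
    rwa [show V.toPlane !₂[0, 1] = V 2 by simp [Tri.toPlane]] at this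
  have hlin : ∀ a b : Plane, ∀ α β : ℝ, α + β = 1 →
      V.coord (α • a + β • b) = α • V.coord a + β • V.coord b := by
    intro a b α β hab
    have hi := Tri.coord_toPlane hV
    conv_lhs => rw [← Tri.toPlane_coord hV a, ← Tri.toPlane_coord hV b, ← V.toPlane_combo _ _ hab]
    rw [hi]
  -- A triangle that misses an endpoint of the edge meets T in the hull of the other common
  -- vertices. There the barycentric coordinate of the missing endpoint is at most zero, while at x
  -- it is positive.
  have hother : ∀ T' ∈ 𝒯, T' ≠ T → x ∉ T'.carrier := by
    intro T' hT' hne hxT'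
    have hxi : x ∈ convexHull ℝ (Set.range T ∩ Set.range T') := by
      rw [← h.conforming.inter_eq T hT T' hT' hne.symm]
      exact ⟨hxT, hxT'⟩
    have hA : T.edgeA i ∈ Set.range T' := by
      by_contra hA
      have hsub : convexHull ℝ (Set.range T ∩ Set.range T')
          ⊆ {z | 1 ≤ V.coord z 0 + V.coord z 1} := by
        refine convexHull_min ?_ ?_
        · rintro v ⟨hv, hv'⟩
          rcases hcoord v hv with rfl | rfl | rfl
          · exact absurd hv' hA
          · change 1 ≤ V.coord (V 1) 0 + V.coord (V 1) 1
            rw [c1]; simp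
          · change 1 ≤ V.coord (V 2) 0 + V.coord (V 2) 1
            rw [c2]; simp
        · intro a ha b hb α β hα hβ hab
          change 1 ≤ V.coord a 0 + V.coord a 1 at ha
          change 1 ≤ V.coord b 0 + V.coord b 1 at hb
          change 1 ≤ V.coord (α • a + β • b) 0 + V.coord (α • a + β • b) 1
          rw [hlin a b α β hab]
          simp only [PiLp.add_apply, PiLp.smul_apply, smul_eq_mul]
          nlinarith
      have h1 : 1 ≤ V.coord x 0 + V.coord x 1 := hsub hxi
      rw [hcx] at h1
      simp at h1
      linarith
    have hB : T.edgeB i ∈ Set.range T' := by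
      by_contra hB
      have hsub : convexHull ℝ (Set.range T ∩ Set.range T') ⊆ {z | V.coord z 0 ≤ 0} := by
        refine convexHull_min ?_ ?_
        · rintro v ⟨hv, hv'⟩
          rcases hcoord v hv with rfl | rfl | rfl
          · change V.coord (V 0) 0 ≤ 0
            rw [c0]; simp
          · exact absurd hv' hB
          · change V.coord (V 2) 0 ≤ 0
            rw [c2]; simp
        · intro a ha b hb α β hα hβ hab
          change V.coord a 0 ≤ 0 at ha
          change V.coord b 0 ≤ 0 at hb
          change V.coord (α • a + β • b) 0 ≤ 0
          rw [hlin a b α β hab]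
          simp only [PiLp.add_apply, PiLp.smul_apply, smul_eq_mul]
          nlinarith
      have h1 : V.coord x 0 ≤ 0 := hsub hxi
      rw [hcx] at h1
      simp at h1
      linarith
    have : T' ∈ neighbors 𝒯 T i := mem_neighbors.2 ⟨hT', hne, hA, hB⟩
    rw [hn] at this
    simp at this
  -- Near x the domain is covered by T alone, because the other triangles form a closed set that
  -- avoids x.
  have hxint : x ∈ interior T.carrier := by
    have ho : IsOpen (Ω \ ⋃ T' ∈ 𝒯.erase T, T'.carrier) := by
      refine IsOpen.sdiff (by rw [← h.interior_eq]; exact isOpen_interior) ?_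
      exact Set.Finite.isClosed_biUnion (Finset.finite_toSet _)
        fun T' _ => T'.isCompact_carrier.isClosed
    rw [mem_interior]
    refine ⟨_, ?_, ho, hx, ?_⟩
    · rintro z ⟨hz, hz'⟩
      rw [← h.interior_eq] at hz
      have hz2 := interior_subset hz
      rw [← Finset.insert_erase hT, Finset.set_biUnion_insert] at hz2
      exact hz2.resolve_right hz'
    · intro hmem
      rw [Set.mem_iUnion₂] at hmem
      obtain ⟨T', hT', hxT'⟩ := hmem
      exact hother T' (Finset.mem_of_mem_erase hT') (Finset.ne_of_mem_erase hT') hxT'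
  -- Crossing the edge outwards makes the second reference coordinate negative, so points outside T
  -- accumulate at x. This contradicts interiority.
  have hcont : Filter.Tendsto (fun δ : ℝ => V.toPlane !₂[s, -δ]) (nhdsWithin 0 (Set.Ioi 0))
      (nhds x) := by
    have hc : Continuous fun δ : ℝ => V.toPlane !₂[s, -δ] :=
      V.continuous_toPlane.comp (by fun_prop)
    have h0 : V.toPlane !₂[s, -(0 : ℝ)] = x := by
      rw [neg_zero, ← hcx, Tri.toPlane_coord hV]
    have := (hc.tendsto 0).mono_left (nhdsWithin_le_nhds (s := Set.Ioi 0))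
    simpa only [h0] using this
  have hev := hcont.eventually (isOpen_interior.mem_nhds hxint)
  obtain ⟨δ, hδ, hδ0⟩ := (hev.and self_mem_nhdsWithin).exists
  have hm := interior_subset hδ
  rw [← hVc, Tri.mem_carrier_iff hV, Tri.coord_toPlane hV] at hm
  have := hm.2.1
  simp at this
  exact absurd hδ0 (not_lt.2 this)

/-! ### Testing the continuous problem with piecewise polynomial fields -/

theorem integrable_inner_of_memLp {X E : Type*} [MeasurableSpace X] {μ : Measure X}
    [NormedAddCommGroup E] [InnerProductSpace ℝ E] {f g : X → E} (hf : MemLp f 2 μ)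
    (hg : MemLp g 2 μ) : Integrable (fun x => ⟪f x, g x⟫) μ := by
  refine (L2.integrable_inner (𝕜 := ℝ) hf.toLp hg.toLp).congr ?_
  filter_upwards [hf.coeFn_toLp, hg.coeFn_toLp] with x h1 h2
  rw [h1, h2]

/-- Young's inequality, from the square of ε‖f‖ - ‖g‖. The free weight ε serves later to absorb a
residual into the left side. -/
theorem integral_inner_le {X E : Type*} [MeasurableSpace X] {μ : Measure X}
    [NormedAddCommGroup E] [InnerProductSpace ℝ E] {f g : X → E} (hf : MemLp f 2 μ)
    (hg : MemLp g 2 μ) {ε : ℝ} (hε : 0 < ε) :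
    ∫ x, ⟪f x, g x⟫ ∂μ ≤ (ε * ∫ x, ‖f x‖ ^ 2 ∂μ + ε⁻¹ * ∫ x, ‖g x‖ ^ 2 ∂μ) / 2 := by
  have hi : Integrable (fun x => ⟪f x, g x⟫) μ := integrable_inner_of_memLp hf hg
  have hf2 : Integrable (fun x => ‖f x‖ ^ 2) μ := hf.integrable_norm_pow (by norm_num)
  have hg2 : Integrable (fun x => ‖g x‖ ^ 2) μ := hg.integrable_norm_pow (by norm_num)
  rw [← integral_const_mul, ← integral_const_mul, ← integral_add (hf2.const_mul _)
    (hg2.const_mul _), ← integral_div]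
  refine integral_mono hi (((hf2.const_mul _).add (hg2.const_mul _)).div_const _) fun x => ?_
  have h1 := real_inner_le_norm (f x) (g x)
  have h2 : 0 ≤ ε⁻¹ * (ε * ‖f x‖ - ‖g x‖) ^ 2 := by positivity
  have h3 : ε⁻¹ * (ε * ‖f x‖ - ‖g x‖) ^ 2
      = ε * ‖f x‖ ^ 2 + ε⁻¹ * ‖g x‖ ^ 2 - 2 * (‖f x‖ * ‖g x‖) := by
    field_simp
    ring
  change ⟪f x, g x⟫ ≤ (ε * ‖f x‖ ^ 2 + ε⁻¹ * ‖g x‖ ^ 2) / 2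
  linarith

/-- The function that equals `F T` on each triangle `T` of `𝒩` and vanishes elsewhere. -/
def patch {E : Type*} [NormedAddCommGroup E] (𝒩 : Finset Tri)
    (F : Tri → Plane → E) (x : Plane) : E :=
  ∑ T ∈ 𝒩, T.carrier.indicator (F T) x

namespace IsTriangulation

variable {Ω : Set Plane} {𝒯 : Finset Tri}

theorem isOpen (h : IsTriangulation Ω 𝒯) : IsOpen Ω := by
  rw [← h.interior_eq]; exact isOpen_interior

theorem interior_subset (h : IsTriangulation Ω 𝒯) {T : Tri} (hT : T ∈ 𝒯) :
    interior T.carrier ⊆ Ω := by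
  rw [← h.interior_eq]
  exact interior_mono (Set.subset_biUnion_of_mem (u := fun T : Tri => T.carrier) hT)

/-- The part of T outside Ω lies in the frontier of T, a null set because T is convex. -/
theorem restrict_restrict (h : IsTriangulation Ω 𝒯) {T : Tri} (hT : T ∈ 𝒯) :
    (volume.restrict Ω).restrict T.carrier = volume.restrict T.carrier := by
  rw [Measure.restrict_restrict T.measurableSet_carrier]
  refine Measure.restrict_congr_set ?_
  refine (ae_eq_of_ae_subset_of_measure_ge ?_ ?_ ?_ ?_)
  · exact Filter.Eventually.of_forall fun x hx => hx.1
  · have h0 : volume (frontier T.carrier) = 0 := T.convex_carrier.addHaar_frontier volume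
    have h1 : T.carrier ⊆ (T.carrier ∩ Ω) ∪ frontier T.carrier := by
      intro x hx
      by_cases hi : x ∈ interior T.carrier
      · exact Or.inl ⟨hx, h.interior_subset hT hi⟩
      · exact Or.inr ⟨subset_closure hx, hi⟩
    calc volume T.carrier ≤ volume ((T.carrier ∩ Ω) ∪ frontier T.carrier) := measure_mono h1
      _ ≤ volume (T.carrier ∩ Ω) + volume (frontier T.carrier) := measure_union_le _ _
      _ = volume (T.carrier ∩ Ω) := by rw [h0, add_zero]
  · exact (T.measurableSet_carrier.inter h.isOpen.measurableSet).nullMeasurableSet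
  · exact T.isCompact_carrier.measure_lt_top.ne

theorem memLp_carrier {E : Type*} [NormedAddCommGroup E] (h : IsTriangulation Ω 𝒯) {T : Tri}
    (hT : T ∈ 𝒯) {f : Plane → E} (hf : MemLp f 2 (volume.restrict Ω)) :
    MemLp f 2 (volume.restrict T.carrier) := by
  rw [← h.restrict_restrict hT]
  exact hf.restrict _

theorem ae_carrier (h : IsTriangulation Ω 𝒯) {T : Tri} (hT : T ∈ 𝒯) {p : Plane → Prop}
    (hp : ∀ᵐ x ∂(volume.restrict Ω), x ∈ T.carrier → p x) :
    ∀ᵐ x ∂(volume.restrict T.carrier), p x := by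
  rw [← h.restrict_restrict hT]
  exact (ae_restrict_iff' T.measurableSet_carrier).2 hp

theorem memLp_indicator {E : Type*} [NormedAddCommGroup E] (h : IsTriangulation Ω 𝒯) {T : Tri}
    (hT : T ∈ 𝒯) {f : Plane → E} (hf : Continuous f) :
    MemLp (T.carrier.indicator f) 2 (volume.restrict Ω) := by
  rw [memLp_indicator_iff_restrict T.measurableSet_carrier, h.restrict_restrict hT]
  exact memLp_of_isCompact hf T.isCompact_carrier

theorem memLp_patch {E : Type*} [NormedAddCommGroup E] (h : IsTriangulation Ω 𝒯)
    {𝒩 : Finset Tri} (h𝒩 : 𝒩 ⊆ 𝒯) {F : Tri → Plane → E} (hF : ∀ T, Continuous (F T)) :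
    MemLp (patch 𝒩 F) 2 (volume.restrict Ω) :=
  memLp_finsetSum _ fun T hT => h.memLp_indicator (h𝒩 hT) (hF T)

/-- A patch is a sum of indicator functions, so values on shared edges merely add up and
disjointness of the triangles is not needed. -/
theorem integral_inner_patch {E : Type*} [NormedAddCommGroup E] [InnerProductSpace ℝ E]
    (h : IsTriangulation Ω 𝒯) {𝒩 : Finset Tri} (h𝒩 : 𝒩 ⊆ 𝒯) {F : Tri → Plane → E}
    (hF : ∀ T, Continuous (F T)) {g : Plane → E} (hg : MemLp g 2 (volume.restrict Ω)) :
    ∫ x in Ω, ⟪patch 𝒩 F x, g x⟫ = ∑ T ∈ 𝒩, ∫ x in T.carrier, ⟪F T x, g x⟫ := by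
  have e : ∀ x, ⟪patch 𝒩 F x, g x⟫
      = ∑ T ∈ 𝒩, T.carrier.indicator (fun x => ⟪F T x, g x⟫) x := by
    intro x
    rw [patch, sum_inner]
    refine Finset.sum_congr rfl fun T _ => ?_
    by_cases hx : x ∈ T.carrier
    · simp only [Set.indicator_of_mem hx]
    · simp only [Set.indicator_of_notMem hx, inner_zero_left]
  simp only [e]
  rw [integral_finsetSum]
  · refine Finset.sum_congr rfl fun T hT => ?_
    rw [integral_indicator T.measurableSet_carrier, h.restrict_restrict (h𝒩 hT)]
  · intro T hT
    rw [integrable_indicator_iff T.measurableSet_carrier, IntegrableOn,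
      h.restrict_restrict (h𝒩 hT)]
    exact integrable_inner_of_memLp (memLp_of_isCompact (hF T) T.isCompact_carrier)
      (h.memLp_carrier (h𝒩 hT) hg)

end IsTriangulation

theorem gradient_zero {φ : Plane → ℝ} (hφ : Differentiable ℝ φ) (x : Plane) :
    gradient φ x 0 = fderiv ℝ φ x e₀ := by
  have h := (hφ x).hasGradientAt.hasFDerivAt.fderiv
  rw [h, InnerProductSpace.toDual_apply_apply, plane_inner]
  simp [e₀]

theorem gradient_one {φ : Plane → ℝ} (hφ : Differentiable ℝ φ) (x : Plane) :
    gradient φ x 1 = fderiv ℝ φ x e₁ := by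
  have h := (hφ x).hasGradientAt.hasFDerivAt.fderiv
  rw [h, InnerProductSpace.toDual_apply_apply, plane_inner]
  simp [e₁]

/-- The weak formulation `(σ, τ) + (div τ, u) = 0`, tested with a piecewise polynomial field `Y`
whose weak divergence is the piecewise polynomial `d`. -/
theorem IsG.sum_integral_eq_zero {Ω : Set Plane} {𝒯 : Finset Tri} (h : IsTriangulation Ω 𝒯)
    {u : L2 Ω} {σ : L2v Ω} (hG : IsG Ω (Hdiv Ω) u σ) {𝒩 : Finset Tri} (h𝒩 : 𝒩 ⊆ 𝒯)
    (Y : Tri → Fin 2 → Poly) (d : Tri → Poly)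
    (hY : ∀ φ : Plane → ℝ, ContDiff ℝ ∞ φ → HasCompactSupport φ → tsupport φ ⊆ Ω →
      ∑ T ∈ 𝒩, ((∫ x in T.carrier, ⟪vecAt (Y T) x, gradient φ x⟫)
        + ∫ x in T.carrier, (d T).evalAt x * φ x) = 0) :
    ∑ T ∈ 𝒩, ((∫ x in T.carrier, ⟪vecAt (Y T) x, σ x⟫)
      + ∫ x in T.carrier, (d T).evalAt x * u x) = 0 := by
  have hcY : ∀ T, Continuous (vecAt (Y T)) := fun T => continuous_vecAt _
  have hcd : ∀ T, Continuous (d T).evalAt := fun T => (d T).continuous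
  have mY := h.memLp_patch h𝒩 hcY
  have md := h.memLp_patch h𝒩 hcd
  have hmul : ∀ a b : ℝ, a * b = ⟪a, b⟫ := fun a b => by simp [mul_comm]
  -- The hypothesis on Y and d, summed over the patch, is the definition of the weak divergence.
  -- Hence the field belongs to H(div) and is admissible in the equation for σ.
  have hw : HasWeakDiv Ω mY.toLp md.toLp := by
    intro φ hφ hc hs
    have m1 := memLp_gradient Ω hφ hc
    have m2 : MemLp φ 2 (volume.restrict Ω) :=
      (hφ.continuous.memLp_of_hasCompactSupport (μ := volume) (p := 2) hc).restrict Ω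
    have a1 : ∫ x in Ω, ⟪(mY.toLp _) x, gradient φ x⟫
        = ∑ T ∈ 𝒩, ∫ x in T.carrier, ⟪vecAt (Y T) x, gradient φ x⟫ := by
      rw [← h.integral_inner_patch h𝒩 hcY m1]
      refine integral_congr_ae ?_
      filter_upwards [mY.coeFn_toLp] with x hx
      rw [hx]
    have a2 : ∫ x in Ω, (md.toLp _) x * φ x
        = ∑ T ∈ 𝒩, ∫ x in T.carrier, (d T).evalAt x * φ x := by
      simp only [hmul]
      rw [← h.integral_inner_patch h𝒩 hcd m2]
      refine integral_congr_ae ?_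
      filter_upwards [md.coeFn_toLp] with x hx
      rw [hx]
    rw [a1, a2]
    have := hY φ hφ hc hs
    rw [Finset.sum_add_distrib] at this
    linarith
  have key := hG.2 mY.toLp ⟨_, hw⟩
  simp only [aForm, bForm] at key
  rw [hw.weakDiv_eq h.isOpen, real_inner_comm, L2.inner_def, L2.inner_def] at key
  have b1 : ∫ x in Ω, ⟪(mY.toLp _) x, σ x⟫ = ∑ T ∈ 𝒩, ∫ x in T.carrier, ⟪vecAt (Y T) x, σ x⟫ := by
    rw [← h.integral_inner_patch h𝒩 hcY (Lp.memLp σ)]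
    refine integral_congr_ae ?_
    filter_upwards [mY.coeFn_toLp] with x hx
    rw [hx]
  have b2 : ∫ x in Ω, ⟪(md.toLp _) x, u x⟫
      = ∑ T ∈ 𝒩, ∫ x in T.carrier, (d T).evalAt x * u x := by
    simp only [hmul]
    rw [← h.integral_inner_patch h𝒩 hcd (Lp.memLp u)]
    refine integral_congr_ae ?_
    filter_upwards [md.coeFn_toLp] with x hx
    rw [hx]
  rw [b1, b2] at key
  rw [Finset.sum_add_distrib]
  exact key

/-! ### Bubble functions on triangles -/

namespace Tri

theorem pull_mem_polyLE (T : Tri) {p : Poly} {K : ℕ} (hp : p ∈ polyLE K) : T.pull p ∈ polyLE K :=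
  Poly.totalDegree_affSub_le _ _ hp

theorem abs_sub_le_diam (T : Tri) (i j : Fin 3) (l : Fin 2) : |T i l - T j l| ≤ T.diam := by
  refine le_trans ?_ (T.dist_le_diam i j)
  rw [dist_eq_norm]
  have := PiLp.norm_apply_le (T i - T j) l
  simpa using this

/-- The gradient of a function pushed forward from the reference triangle. -/
theorem integral_pderiv_push_le {T : Tri} (h : T.det ≠ 0) (p : Poly) (i : Fin 2) {B : ℝ}
    (hB : ∀ j, ∫ y in refTri, Poly.evalAt (MvPolynomial.pderiv j p) y ^ 2 ≤ B) :
    |T.det| * ∫ x in T.carrier, Poly.evalAt (MvPolynomial.pderiv i (T.push p)) x ^ 2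
      ≤ 4 * T.diam ^ 2 * B := by
  set P₀ := Poly.evalAt (MvPolynomial.pderiv 0 p) with hP₀
  set P₁ := Poly.evalAt (MvPolynomial.pderiv 1 p) with hP₁
  have hd : 0 < |T.det| := abs_pos.2 h
  -- By the chain rule the derivative is a combination of reference derivatives whose coefficients
  -- are components of edge vectors divided by the determinant. Each such component is at most h_T.
  have hquad : ∀ a b P Q : ℝ, |a| ≤ T.diam → |b| ≤ T.diam →
      ((a * P - b * Q) / T.det) ^ 2 ≤ 2 * T.diam ^ 2 / T.det ^ 2 * (P ^ 2 + Q ^ 2) := by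
    intro a b P Q ha hb
    have ha2 : a ^ 2 ≤ T.diam ^ 2 := sq_le_sq' (by linarith [(abs_le.1 ha).1]) (abs_le.1 ha).2
    have hb2 : b ^ 2 ≤ T.diam ^ 2 := sq_le_sq' (by linarith [(abs_le.1 hb).1]) (abs_le.1 hb).2
    rw [div_pow, div_mul_eq_mul_div]
    refine div_le_div_of_nonneg_right ?_ (sq_nonneg _)
    have := mul_le_mul_of_nonneg_right ha2 (sq_nonneg P)
    have := mul_le_mul_of_nonneg_right hb2 (sq_nonneg Q)
    nlinarith [sq_nonneg (a * P + b * Q)]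
  have hpt : ∀ y, Poly.evalAt (MvPolynomial.pderiv i (T.push p)) (T.toPlane y) ^ 2
      ≤ 2 * T.diam ^ 2 / T.det ^ 2 * (P₀ y ^ 2 + P₁ y ^ 2) := by
    intro y
    fin_cases i
    · change Poly.evalAt (MvPolynomial.pderiv 0 (T.push p)) (T.toPlane y) ^ 2 ≤ _
      rw [evalAt_pderiv_zero_push, coord_toPlane h]
      exact hquad _ _ _ _ (T.abs_sub_le_diam _ _ _) (T.abs_sub_le_diam _ _ _)
    · change Poly.evalAt (MvPolynomial.pderiv 1 (T.push p)) (T.toPlane y) ^ 2 ≤ _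
      rw [evalAt_pderiv_one_push, coord_toPlane h, add_comm (P₀ y ^ 2)]
      exact hquad _ _ _ _ (T.abs_sub_le_diam _ _ _) (T.abs_sub_le_diam _ _ _)
  have hc : ∀ f : Plane → ℝ, Continuous f → IntegrableOn f refTri := fun f hf =>
    hf.continuousOn.integrableOn_compact isCompact_refTri
  have c0 : Continuous P₀ := Poly.continuous _
  have c1 : Continuous P₁ := Poly.continuous _
  have hI : ∫ y in refTri, Poly.evalAt (MvPolynomial.pderiv i (T.push p)) (T.toPlane y) ^ 2
      ≤ 2 * T.diam ^ 2 / T.det ^ 2 * (B + B) := by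
    calc _ ≤ ∫ y in refTri, 2 * T.diam ^ 2 / T.det ^ 2 * (P₀ y ^ 2 + P₁ y ^ 2) := by
          refine integral_mono (hc _ ?_) (hc _ ?_) hpt
          · exact ((Poly.continuous _).comp T.continuous_toPlane).pow 2
          · exact continuous_const.mul ((c0.pow 2).add (c1.pow 2))
      _ = 2 * T.diam ^ 2 / T.det ^ 2
          * ((∫ y in refTri, P₀ y ^ 2) + ∫ y in refTri, P₁ y ^ 2) := by
          rw [integral_const_mul]
          congr 1
          exact integral_add (hc _ (c0.pow 2)) (hc _ (c1.pow 2))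
      _ ≤ _ := mul_le_mul_of_nonneg_left (add_le_add (hB 0) (hB 1)) (by positivity)
  rw [integral_carrier h, ← mul_assoc, abs_mul_abs_self]
  calc T.det * T.det * _ ≤ T.det * T.det * (2 * T.diam ^ 2 / T.det ^ 2 * (B + B)) :=
        mul_le_mul_of_nonneg_left hI (mul_self_nonneg _)
    _ = 4 * T.diam ^ 2 * B := by field_simp; ring

theorem coord_lineMap₁₂ {T : Tri} (h : T.det ≠ 0) (s : ℝ) :
    T.coord (AffineMap.lineMap (T 1) (T 2) s) = !₂[1 - s, s] := by
  have e : (AffineMap.lineMap (T 1) (T 2) s : Plane) = T.toPlane !₂[1 - s, s] := by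
    apply plane_ext <;> simp [toPlane, AffineMap.lineMap_apply] <;> ring
  rw [e, coord_toPlane h]

theorem coord_lineMap₀₂ {T : Tri} (h : T.det ≠ 0) (s : ℝ) :
    T.coord (AffineMap.lineMap (T 0) (T 2) s) = !₂[0, s] := by
  have e : (AffineMap.lineMap (T 0) (T 2) s : Plane) = T.toPlane !₂[0, s] := by
    apply plane_ext <;> simp [toPlane, AffineMap.lineMap_apply] <;> ring
  rw [e, coord_toPlane h]

/-- Local bubble functions: the weighted polynomial `ψ` on `T` that belongs to `r`. -/
theorem exists_bubble (K : ℕ) : ∃ C : ℝ, 0 < C ∧ ∀ (T : Tri) (κ : ℝ), T.det ≠ 0 →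
    T.diam ^ 2 ≤ κ * |T.det| → ∀ r ∈ polyLE K, ∃ ψ : Poly,
      (∀ t : ℝ, ψ.evalAt (AffineMap.lineMap (T 1) (T 2) t) = 0) ∧
      (∀ t : ℝ, ψ.evalAt (AffineMap.lineMap (T 0) (T 2) t) = 0) ∧
      (∀ t : ℝ, ψ.evalAt (AffineMap.lineMap (T 0) (T 1) t) = 0) ∧
      (∫ x in T.carrier, r.evalAt x ^ 2 ≤ C * ∫ x in T.carrier, ψ.evalAt x * r.evalAt x) ∧
      (∫ x in T.carrier, ψ.evalAt x ^ 2 ≤ C * ∫ x in T.carrier, r.evalAt x ^ 2) ∧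
      ∀ i, T.diam ^ 2 * ∫ x in T.carrier, Poly.evalAt (MvPolynomial.pderiv i ψ) x ^ 2
        ≤ C * κ ^ 2 * ∫ x in T.carrier, r.evalAt x ^ 2 := by
  obtain ⟨C, hC, hb⟩ := exists_bubble_bounds K
  refine ⟨4 * C, by positivity, fun T κ h hκ r hr => ?_⟩
  obtain ⟨b1, b2, b3⟩ := hb _ (T.pull_mem_polyLE hr)
  have hd : 0 < |T.det| := abs_pos.2 h
  have hr2 : ∫ x in T.carrier, r.evalAt x ^ 2
      = |T.det| * ∫ y in refTri, (T.pull r).evalAt y ^ 2 := by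
    rw [integral_carrier h]
    simp only [evalAt_pull]
  have n1 : 0 ≤ ∫ y in refTri, (T.pull r).evalAt y ^ 2 := integral_nonneg fun _ => sq_nonneg _
  have hψ : ∀ x, (T.push (bubble ^ 2 * T.pull r)).evalAt x
      = (T.coord x 0 * T.coord x 1 * (1 - T.coord x 0 - T.coord x 1)) ^ 2 * r.evalAt x := by
    intro x
    rw [evalAt_push, Poly.evalAt_mul, Poly.evalAt_pow, evalAt_bubble, evalAt_pull,
      toPlane_coord h]
  refine ⟨T.push (bubble ^ 2 * T.pull r), fun t => ?_, fun t => ?_, fun t => ?_, ?_, ?_,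
    fun i => ?_⟩
  · rw [hψ, coord_lineMap₁₂ h]; simp
  · rw [hψ, coord_lineMap₀₂ h]; simp
  · rw [hψ, coord_lineMap h]; simp
  · have e : ∫ x in T.carrier, (T.push (bubble ^ 2 * T.pull r)).evalAt x * r.evalAt x
        = |T.det| * ∫ y in refTri, (bubble * T.pull r).evalAt y ^ 2 := by
      rw [integral_carrier h]
      congr 1
      refine integral_congr_ae (Filter.Eventually.of_forall fun y => ?_)
      simp only [evalAt_push, coord_toPlane h, Poly.evalAt_mul, Poly.evalAt_pow, evalAt_pull]
      ring
    rw [e, hr2]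
    have n2 : 0 ≤ ∫ y in refTri, (bubble * T.pull r).evalAt y ^ 2 :=
      integral_nonneg fun _ => sq_nonneg _
    calc |T.det| * ∫ y in refTri, (T.pull r).evalAt y ^ 2
        ≤ |T.det| * (C * ∫ y in refTri, (bubble * T.pull r).evalAt y ^ 2) :=
          mul_le_mul_of_nonneg_left b1 hd.le
      _ = C * (|T.det| * ∫ y in refTri, (bubble * T.pull r).evalAt y ^ 2) := by ring
      _ ≤ _ := mul_le_mul_of_nonneg_right (by linarith) (by positivity)
  · rw [integral_carrier h, hr2]
    simp only [evalAt_push, coord_toPlane h]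
    calc |T.det| * ∫ y in refTri, (bubble ^ 2 * T.pull r).evalAt y ^ 2
        ≤ |T.det| * (C * ∫ y in refTri, (T.pull r).evalAt y ^ 2) :=
          mul_le_mul_of_nonneg_left b2 hd.le
      _ = C * (|T.det| * ∫ y in refTri, (T.pull r).evalAt y ^ 2) := by ring
      _ ≤ _ := mul_le_mul_of_nonneg_right (by linarith) (by positivity)
  · have key := integral_pderiv_push_le h _ i b3
    rw [hr2]
    set I := ∫ x in T.carrier,
      Poly.evalAt (MvPolynomial.pderiv i (T.push (bubble ^ 2 * T.pull r))) x ^ 2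
    set R := ∫ y in refTri, (T.pull r).evalAt y ^ 2
    have hκ0 : 0 ≤ κ := by
      by_contra hneg
      have := mul_neg_of_neg_of_pos (not_le.1 hneg) hd
      linarith [sq_nonneg T.diam]
    have hI : 0 ≤ I := integral_nonneg fun _ => sq_nonneg _
    -- Shape regularity is used twice: first to trade h_T² for the determinant that the estimate of
    -- `I` requires, then for the factor h_T² which that estimate produces. Hence κ².
    have s1 : T.diam ^ 2 * I ≤ κ * (4 * T.diam ^ 2 * (C * R)) :=
      calc T.diam ^ 2 * I ≤ κ * |T.det| * I := mul_le_mul_of_nonneg_right hκ hI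
        _ = κ * (|T.det| * I) := by ring
        _ ≤ _ := mul_le_mul_of_nonneg_left key hκ0
    refine s1.trans ?_
    have s2 : T.diam ^ 2 * (κ * 4 * C * R) ≤ κ * |T.det| * (κ * 4 * C * R) :=
      mul_le_mul_of_nonneg_right hκ (by positivity)
    linarith

/-- The constants reflect scaling in two dimensions: square integrals of the extension scale like
h_T², those of its gradient are independent of scale. The polynomial J is a function of the edge
parameter, so no edge length enters. -/
theorem exists_edgeBubble (K : ℕ) : ∃ C : ℝ, 0 < C ∧
    ∀ J ∈ Polynomial.degreeLE ℝ (K : WithBot ℕ),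
      (∫ s in (0 : ℝ)..1, J.eval s ^ 2
        ≤ C * ∫ s in (0 : ℝ)..1, ((1 - s) * s) ^ 2 * J.eval s ^ 2) ∧
      ∀ (T : Tri) (κ : ℝ), T.det ≠ 0 → T.diam ^ 2 ≤ κ * |T.det| →
        (∫ x in T.carrier, (T.push (edgeBubble J)).evalAt x ^ 2
          ≤ C * T.diam ^ 2 * ∫ s in (0 : ℝ)..1, J.eval s ^ 2) ∧
        ∀ i, ∫ x in T.carrier,
          Poly.evalAt (MvPolynomial.pderiv i (T.push (edgeBubble J))) x ^ 2
            ≤ C * κ * ∫ s in (0 : ℝ)..1, J.eval s ^ 2 := by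
  obtain ⟨C, hC, hb⟩ := exists_edgeBubble_bounds K
  refine ⟨4 * C, by positivity, fun J hJ => ?_⟩
  obtain ⟨b1, b2, b3⟩ := hb J hJ
  have n1 : 0 ≤ ∫ s in (0 : ℝ)..1, J.eval s ^ 2 :=
    intervalIntegral.integral_nonneg zero_le_one fun _ _ => sq_nonneg _
  have n2 : 0 ≤ ∫ s in (0 : ℝ)..1, ((1 - s) * s) ^ 2 * J.eval s ^ 2 :=
    intervalIntegral.integral_nonneg zero_le_one fun _ _ => by positivity
  refine ⟨b1.trans (mul_le_mul_of_nonneg_right (by linarith) n2), fun T κ h hκ => ?_⟩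
  have hd : 0 < |T.det| := abs_pos.2 h
  refine ⟨?_, fun i => ?_⟩
  · rw [integral_carrier h]
    simp only [evalAt_push, coord_toPlane h]
    calc |T.det| * ∫ y in refTri, (edgeBubble J).evalAt y ^ 2
        ≤ T.diam ^ 2 * (C * ∫ s in (0 : ℝ)..1, J.eval s ^ 2) :=
          mul_le_mul T.abs_det_le b2 (integral_nonneg fun _ => sq_nonneg _) (sq_nonneg _)
      _ = C * (T.diam ^ 2 * ∫ s in (0 : ℝ)..1, J.eval s ^ 2) := by ring
      _ ≤ 4 * C * (T.diam ^ 2 * ∫ s in (0 : ℝ)..1, J.eval s ^ 2) :=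
          mul_le_mul_of_nonneg_right (by linarith) (by positivity)
      _ = _ := by ring
  · have key := integral_pderiv_push_le h _ i b3
    refine le_of_mul_le_mul_left (key.trans ?_) hd
    have := mul_le_mul_of_nonneg_right hκ
      (show 0 ≤ 4 * (C * ∫ s in (0 : ℝ)..1, J.eval s ^ 2) by positivity)
    linarith

/-- The trace on the first edge depends on J only. The extensions into two triangles therefore match
along a common edge that is parametrized in the same way from both sides. -/
theorem push_edgeBubble_lineMap {T : Tri} (h : T.det ≠ 0) (J : Polynomial ℝ) (t : ℝ) :
    (T.push (edgeBubble J)).evalAt (AffineMap.lineMap (T 1) (T 2) t) = 0 ∧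
    (T.push (edgeBubble J)).evalAt (AffineMap.lineMap (T 0) (T 2) t) = 0 ∧
    (T.push (edgeBubble J)).evalAt (AffineMap.lineMap (T 0) (T 1) t)
      = ((1 - t) * t) ^ 2 * J.eval t := by
  simp only [evalAt_push, coord_lineMap₁₂ h, coord_lineMap₀₂ h, coord_lineMap h,
    evalAt_edgeBubble]
  simp

end Tri

/-! ### Local efficiency: residuals in the triangles -/

theorem abs_integral_inner_le {X E : Type*} [MeasurableSpace X] {μ : Measure X}
    [NormedAddCommGroup E] [InnerProductSpace ℝ E] {f g : X → E} (hf : MemLp f 2 μ)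
    (hg : MemLp g 2 μ) {ε : ℝ} (hε : 0 < ε) :
    |∫ x, ⟪f x, g x⟫ ∂μ| ≤ (ε * ∫ x, ‖f x‖ ^ 2 ∂μ + ε⁻¹ * ∫ x, ‖g x‖ ^ 2 ∂μ) / 2 := by
  rw [abs_le]
  refine ⟨?_, integral_inner_le hf hg hε⟩
  have h := integral_inner_le hf.neg hg hε
  simp only [Pi.neg_apply, inner_neg_left, norm_neg, integral_neg] at h
  linarith

theorem memLp_poly (p : Poly) (T : Tri) : MemLp p.evalAt 2 (volume.restrict T.carrier) :=
  memLp_of_isCompact p.continuous T.isCompact_carrier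

theorem memLp_vecAt (q : Fin 2 → Poly) (T : Tri) :
    MemLp (vecAt q) 2 (volume.restrict T.carrier) :=
  memLp_of_isCompact (continuous_vecAt q) T.isCompact_carrier

theorem integrable_of_continuous {f : Plane → ℝ} (hf : Continuous f) (T : Tri) :
    Integrable f (volume.restrict T.carrier) :=
  hf.continuousOn.integrableOn_compact T.isCompact_carrier

theorem integral_norm_vecAt_sq (q : Fin 2 → Poly) (T : Tri) :
    ∫ x in T.carrier, ‖vecAt q x‖ ^ 2
      = (∫ x in T.carrier, (q 0).evalAt x ^ 2) + ∫ x in T.carrier, (q 1).evalAt x ^ 2 := by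
  refine Eq.trans ?_ (integral_add (integrable_of_continuous ((q 0).continuous.pow 2) T)
    (integrable_of_continuous ((q 1).continuous.pow 2) T))
  refine integral_congr_ae (Filter.Eventually.of_forall fun x => ?_)
  exact plane_norm_sq _

theorem Tri.diam_pos {T : Tri} (h : T.det ≠ 0) : 0 < T.diam := by
  have := T.abs_det_le
  have h0 := abs_pos.2 h
  refine lt_of_le_of_ne T.diam_nonneg fun e => ?_
  rw [← e] at this
  norm_num at this
  exact h this

/-- The divergence of a polynomial field. -/
def polyDiv (q : Fin 2 → Poly) : Poly := MvPolynomial.pderiv 0 (q 0) + MvPolynomial.pderiv 1 (q 1)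

/-- The field G stands for the gradient of g, so that the formula serves both for `gradient φ` of a
test function and for the polynomial gradient of w. -/
theorem Tri.integral_div {T : Tri} (h : T.det ≠ 0) (Ψ : Fin 2 → Poly)
    (h12 : ∀ i, ∀ t : ℝ, (Ψ i).evalAt (AffineMap.lineMap (T 1) (T 2) t) = 0)
    (h02 : ∀ i, ∀ t : ℝ, (Ψ i).evalAt (AffineMap.lineMap (T 0) (T 2) t) = 0)
    (h01 : ∀ i, ∀ t : ℝ, (Ψ i).evalAt (AffineMap.lineMap (T 0) (T 1) t) = 0)
    {g : Plane → ℝ} {G : Plane → Plane} (hg : ContDiff ℝ 1 g)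
    (hG0 : ∀ x, G x 0 = fderiv ℝ g x e₀) (hG1 : ∀ x, G x 1 = fderiv ℝ g x e₁) :
    (∫ x in T.carrier, ⟪vecAt Ψ x, G x⟫) + ∫ x in T.carrier, (polyDiv Ψ).evalAt x * g x = 0 := by
  have k0 := (T.integral_parts h (Ψ 0) hg (h12 0) (h02 0) (h01 0)).1
  have k1 := (T.integral_parts h (Ψ 1) hg (h12 1) (h02 1) (h01 1)).2
  have hc : ∀ v, Continuous fun x => fderiv ℝ g x v := fun v =>
    (hg.continuous_fderiv (by simp)).clm_apply continuous_const
  have c0 : ∀ (i j : Fin 2) (v : Plane), Integrable (fun x => (Ψ i).evalAt x * fderiv ℝ g x v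
      + Poly.evalAt (MvPolynomial.pderiv j (Ψ i)) x * g x) (volume.restrict T.carrier) :=
    fun i j v => integrable_of_continuous (((Ψ i).continuous.mul (hc v)).add
      ((Poly.continuous _).mul hg.continuous)) T
  have e : ∀ x, ⟪vecAt Ψ x, G x⟫
      = (Ψ 0).evalAt x * fderiv ℝ g x e₀ + (Ψ 1).evalAt x * fderiv ℝ g x e₁ := by
    intro x
    rw [plane_inner, hG0, hG1]
    rfl
  simp only [e]
  rw [← integral_add]
  · refine Eq.trans ?_ (((integral_add (c0 0 0 e₀) (c0 1 1 e₁)).trans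
      (congrArg₂ (· + ·) k0 k1)).trans (add_zero 0))
    refine integral_congr_ae (Filter.Eventually.of_forall fun x => ?_)
    simp only [polyDiv, Poly.evalAt_add]
    ring
  · exact integrable_of_continuous
      (((Ψ 0).continuous.mul (hc _)).add ((Ψ 1).continuous.mul (hc _))) T
  · exact integrable_of_continuous ((Poly.continuous _).mul hg.continuous) T

/-- With r = q - ∇w and Ψ a squared bubble times r, ‖r‖² is bounded by a multiple of (Ψ, r). As Ψ
vanishes on the boundary of T, (Ψ, r) equals (Ψ, q - σ) + (div Ψ, w - u), and the inverse estimate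
controls div Ψ by ‖r‖ / h_T. -/
theorem exists_gradient_residual_le (K : ℕ) {κ Q : ℝ} (hκ : 0 < κ) (hQ : 0 < Q) :
    ∃ C : ℝ, 0 < C ∧ ∀ (Ω : Set Plane) (𝒯 : Finset Tri), IsTriangulation Ω 𝒯 →
      ∀ (u : L2 Ω) (σ : L2v Ω), IsG Ω (Hdiv Ω) u σ → ∀ T ∈ 𝒯, T.diam ^ 2 ≤ κ * |T.det| →
      T.diam ^ 2 ≤ Q → ∀ (q : Fin 2 → Poly) (w : Poly), (∀ i, q i ∈ polyLE K) → w ∈ polyLE K →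
      T.diam ^ 2 * ∫ x in T.carrier, ‖vecAt q x - vecAt (polyGrad w) x‖ ^ 2
        ≤ C * ((∫ x in T.carrier, ‖vecAt q x - σ x‖ ^ 2)
          + ∫ x in T.carrier, (u x - w.evalAt x) ^ 2) := by
  obtain ⟨C, hC, hb⟩ := Tri.exists_bubble K
  refine ⟨2 * C ^ 3 * Q + 4 * C ^ 3 * κ ^ 2, by positivity, ?_⟩
  intro Ω 𝒯 h u σ hG T hT hsh hdQ q w hq hw
  have hdet : T.det ≠ 0 := h.conforming.det_ne_zero hT
  have hH := Tri.diam_pos hdet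
  set r : Fin 2 → Poly := fun i => q i - polyGrad w i with hr
  have hrK : ∀ i, r i ∈ polyLE K := fun i =>
    Submodule.sub_mem _ (hq i) (Poly.pderiv_mem_polyLE hw i)
  choose Ψ h12 h02 h01 hR hP hD using fun i => hb T κ hdet hsh (r i) (hrK i)
  have hvr : ∀ x, vecAt q x - vecAt (polyGrad w) x = vecAt r x := by
    intro x
    apply plane_ext <;> simp [hr]
  simp only [hvr]
  rw [integral_norm_vecAt_sq]
  have mσ : MemLp σ 2 (volume.restrict T.carrier) := h.memLp_carrier hT (Lp.memLp σ)
  have mu' : MemLp u 2 (volume.restrict T.carrier) := h.memLp_carrier hT (Lp.memLp u)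
  have mΨ := memLp_vecAt Ψ T
  have md := memLp_poly (polyDiv Ψ) T
  have mq := memLp_vecAt q T
  have mw := memLp_poly w T
  have mgw := memLp_vecAt (polyGrad w) T
  have id1 : (∫ x in T.carrier, ⟪vecAt Ψ x, σ x⟫)
      + ∫ x in T.carrier, (polyDiv Ψ).evalAt x * u x = 0 := by
    have := hG.sum_integral_eq_zero h (𝒩 := {T}) (by simpa using hT) (fun _ => Ψ)
      (fun _ => polyDiv Ψ) (fun φ hφ _ _ => by
        rw [Finset.sum_singleton]
        exact T.integral_div hdet Ψ h12 h02 h01 (hφ.of_le (by simp))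
          (gradient_zero (hφ.differentiable (by simp)))
          (gradient_one (hφ.differentiable (by simp))))
    simpa using this
  have id2 : (∫ x in T.carrier, ⟪vecAt Ψ x, vecAt (polyGrad w) x⟫)
      + ∫ x in T.carrier, (polyDiv Ψ).evalAt x * w.evalAt x = 0 :=
    T.integral_div hdet Ψ h12 h02 h01 (w.contDiff.of_le (by simp))
      (fun x => (w.fderiv_e₀ x).symm) (fun x => (w.fderiv_e₁ x).symm)
  have hmul : ∀ a b : ℝ, a * b = ⟪a, b⟫ := fun a b => by simp [mul_comm]
  have id3 : (∫ x in T.carrier, (Ψ 0).evalAt x * (r 0).evalAt x)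
      + ∫ x in T.carrier, (Ψ 1).evalAt x * (r 1).evalAt x
      = (∫ x in T.carrier, ⟪vecAt Ψ x, vecAt q x - σ x⟫)
        + ∫ x in T.carrier, ⟪(polyDiv Ψ).evalAt x, w.evalAt x - u x⟫ := by
    have e1 : (∫ x in T.carrier, (Ψ 0).evalAt x * (r 0).evalAt x)
        + ∫ x in T.carrier, (Ψ 1).evalAt x * (r 1).evalAt x
        = ∫ x in T.carrier, ⟪vecAt Ψ x, vecAt q x - vecAt (polyGrad w) x⟫ := by
      refine (integral_add
        (integrable_of_continuous ((Ψ 0).continuous.mul (r 0).continuous) T)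
        (integrable_of_continuous ((Ψ 1).continuous.mul (r 1).continuous) T)).symm.trans ?_
      refine integral_congr_ae (Filter.Eventually.of_forall fun x => ?_)
      simp only [hvr]
      rw [plane_inner]
      rfl
    rw [e1]
    simp only [inner_sub_right]
    rw [integral_sub (integrable_inner_of_memLp mΨ mq) (integrable_inner_of_memLp mΨ mgw),
      integral_sub (integrable_inner_of_memLp mΨ mq) (integrable_inner_of_memLp mΨ mσ),
      integral_sub (integrable_inner_of_memLp md mw) (integrable_inner_of_memLp md mu')]
    simp only [← hmul]
    linarith
  -- The two weights are chosen so that, after multiplication by C, the terms with Ψ and with div Ψ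
  -- contribute at most a quarter of ‖r‖² each.
  have y1 := integral_inner_le mΨ (mq.sub mσ) (ε := 1 / (2 * C ^ 2)) (by positivity)
  have y2 := integral_inner_le md (mw.sub mu')
    (ε := T.diam ^ 2 / (4 * C ^ 2 * κ ^ 2)) (by positivity)
  simp only [Pi.sub_apply, Real.norm_eq_abs, sq_abs] at y1 y2
  have esym : ∫ x in T.carrier, (w.evalAt x - u x) ^ 2
      = ∫ x in T.carrier, (u x - w.evalAt x) ^ 2 := by
    congr 1; ext x; ring
  rw [esym] at y2
  rw [integral_norm_vecAt_sq] at y1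
  have hDD : T.diam ^ 2 * ∫ x in T.carrier, (polyDiv Ψ).evalAt x ^ 2
      ≤ 2 * (C * κ ^ 2 * ((∫ x in T.carrier, (r 0).evalAt x ^ 2)
        + ∫ x in T.carrier, (r 1).evalAt x ^ 2)) := by
    have i0 := integrable_of_continuous
      ((Poly.continuous (MvPolynomial.pderiv 0 (Ψ 0))).pow 2) T
    have i1 := integrable_of_continuous
      ((Poly.continuous (MvPolynomial.pderiv 1 (Ψ 1))).pow 2) T
    have : ∫ x in T.carrier, (polyDiv Ψ).evalAt x ^ 2
        ≤ 2 * ((∫ x in T.carrier, Poly.evalAt (MvPolynomial.pderiv 0 (Ψ 0)) x ^ 2)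
          + ∫ x in T.carrier, Poly.evalAt (MvPolynomial.pderiv 1 (Ψ 1)) x ^ 2) := by
      refine le_trans ?_ (mul_le_mul_of_nonneg_left (integral_add i0 i1).le zero_le_two)
      rw [← integral_const_mul]
      refine integral_mono (integrable_of_continuous ((Poly.continuous _).pow 2) T)
        ((i0.add i1).const_mul 2) fun x => ?_
      simp only [polyDiv, Poly.evalAt_add, Pi.pow_apply]
      nlinarith [sq_nonneg (Poly.evalAt (MvPolynomial.pderiv 0 (Ψ 0)) x
        - Poly.evalAt (MvPolynomial.pderiv 1 (Ψ 1)) x)]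
    have := mul_le_mul_of_nonneg_left this (sq_nonneg T.diam)
    have := hD 0 0
    have := hD 1 1
    linarith
  have hR0 := hR 0
  have hR1 := hR 1
  have hP0 := hP 0
  have hP1 := hP 1
  set R := (∫ x in T.carrier, (r 0).evalAt x ^ 2) + ∫ x in T.carrier, (r 1).evalAt x ^ 2
  set A := ∫ x in T.carrier, ‖vecAt q x - σ x‖ ^ 2 with hA
  set B := ∫ x in T.carrier, (u x - w.evalAt x) ^ 2 with hB
  set P := (∫ x in T.carrier, (Ψ 0).evalAt x ^ 2) + ∫ x in T.carrier, (Ψ 1).evalAt x ^ 2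
  set D := ∫ x in T.carrier, (polyDiv Ψ).evalAt x ^ 2
  have hA0 : 0 ≤ A := integral_nonneg fun _ => sq_nonneg _
  have hB0 : 0 ≤ B := integral_nonneg fun _ => sq_nonneg _
  have t1 : R ≤ C * ((1 / (2 * C ^ 2) * P + (1 / (2 * C ^ 2))⁻¹ * A) / 2
      + (T.diam ^ 2 / (4 * C ^ 2 * κ ^ 2) * D
        + (T.diam ^ 2 / (4 * C ^ 2 * κ ^ 2))⁻¹ * B) / 2) := by
    have := mul_le_mul_of_nonneg_left (add_le_add y1 y2) hC.le
    rw [← id3] at this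
    linarith
  have t2 : C * (1 / (2 * C ^ 2) * P) / 2 ≤ R / 4 := by
    have hPR : P ≤ C * R := by linarith
    have e : C * (1 / (2 * C ^ 2) * P) / 2 = P / (4 * C) := by field_simp; ring
    rw [e, div_le_div_iff₀ (by positivity) (by norm_num)]
    linarith
  have t3 : C * (T.diam ^ 2 / (4 * C ^ 2 * κ ^ 2) * D) / 2 ≤ R / 4 := by
    have e : C * (T.diam ^ 2 / (4 * C ^ 2 * κ ^ 2) * D) / 2
        = (T.diam ^ 2 * D) / (8 * C * κ ^ 2) := by field_simp; ring
    rw [e, div_le_div_iff₀ (by positivity) (by norm_num)]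
    linarith
  have t4 : C * ((1 / (2 * C ^ 2))⁻¹ * A) / 2 = C ^ 3 * A := by field_simp
  have t5 : T.diam ^ 2 * (C * ((T.diam ^ 2 / (4 * C ^ 2 * κ ^ 2))⁻¹ * B) / 2)
      = 2 * C ^ 3 * κ ^ 2 * B := by field_simp; ring
  have t6 : R / 2 ≤ C ^ 3 * A + C * ((T.diam ^ 2 / (4 * C ^ 2 * κ ^ 2))⁻¹ * B) / 2 := by
    linarith
  have t7 := mul_le_mul_of_nonneg_left t6 (sq_nonneg T.diam)
  rw [mul_add, t5] at t7
  -- The error q - σ keeps the full factor h_T², which is bounded by Q since meshes are no coarser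
  -- than the initial one.
  have t8 : T.diam ^ 2 * (C ^ 3 * A) ≤ Q * (C ^ 3 * A) :=
    mul_le_mul_of_nonneg_right hdQ (by positivity)
  have t9 : 0 ≤ C ^ 3 * κ ^ 2 * A := by positivity
  have t10 : 0 ≤ C ^ 3 * Q * B := by positivity
  linarith

theorem integral_norm_vecCurl_sq (ψ : Poly) (T : Tri) :
    ∫ x in T.carrier, ‖vecAt (vecCurl ψ) x‖ ^ 2
      = (∫ x in T.carrier, Poly.evalAt (MvPolynomial.pderiv 0 ψ) x ^ 2)
        + ∫ x in T.carrier, Poly.evalAt (MvPolynomial.pderiv 1 ψ) x ^ 2 := by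
  rw [integral_norm_vecAt_sq, add_comm]
  congr 1
  refine integral_congr_ae (Filter.Eventually.of_forall fun x => ?_)
  simp [vecCurl]

/-! ### Green's formulas against a Curl -/

namespace Tri

/-- Green's formula for a polynomial field. -/
theorem integral_curl_poly {T : Tri} (h : T.det ≠ 0) (ψ : Poly) (q : Fin 2 → Poly)
    (h12 : ∀ t : ℝ, ψ.evalAt (AffineMap.lineMap (T 1) (T 2) t) = 0)
    (h02 : ∀ t : ℝ, ψ.evalAt (AffineMap.lineMap (T 0) (T 2) t) = 0) :
    (∫ x in T.carrier, ⟪vecAt (vecCurl ψ) x, vecAt q x⟫)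
        - ∫ x in T.carrier, ψ.evalAt x * (polyCurl q).evalAt x
      = |T.det| / T.det * ∫ t in (0 : ℝ)..1, ψ.evalAt (AffineMap.lineMap (T 0) (T 1) t)
        * ⟪vecAt q (AffineMap.lineMap (T 0) (T 1) t), T 1 - T 0⟫ := by
  have key := T.integral_curl h ψ ((q 0).contDiff.of_le (by simp : (1 : WithTop ℕ∞) ≤ ∞))
    ((q 1).contDiff.of_le (by simp)) h12 h02
  simp only [Poly.fderiv_e₀, Poly.fderiv_e₁] at key
  rw [← integral_sub]
  · rw [div_mul_eq_mul_div, eq_div_iff h, mul_comm]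
    convert key using 2
    · refine integral_congr_ae (Filter.Eventually.of_forall fun x => ?_)
      simp only [plane_inner, polyCurl, Poly.evalAt_sub]
      rfl
    · refine intervalIntegral.integral_congr fun t _ => ?_
      simp only [plane_inner]
      rfl
  · exact integrable_of_continuous
      ((continuous_vecAt _).inner (continuous_vecAt _)) T
  · exact integrable_of_continuous (ψ.continuous.mul (Poly.continuous _)) T

/-- Green's formula for the gradient of a smooth function. -/
theorem integral_curl_gradient {T : Tri} (h : T.det ≠ 0) (ψ : Poly) {φ : Plane → ℝ}
    (hφ : ContDiff ℝ ∞ φ)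
    (h12 : ∀ t : ℝ, ψ.evalAt (AffineMap.lineMap (T 1) (T 2) t) = 0)
    (h02 : ∀ t : ℝ, ψ.evalAt (AffineMap.lineMap (T 0) (T 2) t) = 0) :
    ∫ x in T.carrier, ⟪vecAt (vecCurl ψ) x, gradient φ x⟫
      = |T.det| / T.det * ∫ t in (0 : ℝ)..1, ψ.evalAt (AffineMap.lineMap (T 0) (T 1) t)
        * fderiv ℝ φ (AffineMap.lineMap (T 0) (T 1) t) (T 1 - T 0) := by
  have hd : ContDiff ℝ 1 (fderiv ℝ φ) := (contDiff_infty_iff_fderiv.1 hφ).2.of_le (by simp)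
  have hv : ∀ v : Plane, ContDiff ℝ 1 fun x => fderiv ℝ φ x v := fun v =>
    hd.clm_apply contDiff_const
  have hvv : ∀ v w x : Plane, fderiv ℝ (fun x => fderiv ℝ φ x v) x w
      = fderiv ℝ (fderiv ℝ φ) x w v := by
    intro v w x
    have h1 := ((hd.differentiable (by simp)) x).hasFDerivAt.clm_apply
      (hasFDerivAt_const v x)
    rw [h1.fderiv]
    simp
  have key := T.integral_curl h ψ (hv e₀) (hv e₁) h12 h02
  -- Symmetry of the second derivative: the curl of a gradient vanishes, and only the edge term
  -- survives.
  have hsymm : ∀ x, fderiv ℝ (fun x => fderiv ℝ φ x e₀) x e₁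
      - fderiv ℝ (fun x => fderiv ℝ φ x e₁) x e₀ = 0 := by
    intro x
    rw [hvv, hvv, sub_eq_zero]
    have hs : IsSymmSndFDerivAt ℝ φ x :=
      (hφ.contDiffAt).isSymmSndFDerivAt (by
        rw [minSmoothness_of_isRCLikeNormedField]
        exact WithTop.coe_le_coe.2 (le_top (a := (2 : ℕ∞))))
    exact hs.eq e₁ e₀
  simp only [hsymm, mul_zero, sub_zero] at key
  have hdiff := hφ.differentiable (by simp)
  rw [div_mul_eq_mul_div, eq_div_iff h, mul_comm]
  convert key using 2
  · refine integral_congr_ae (Filter.Eventually.of_forall fun x => ?_)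
    simp only [plane_inner, gradient_zero hdiff, gradient_one hdiff]
  · refine intervalIntegral.integral_congr fun t _ => ?_
    rw [fderiv_eq φ _ (T 1 - T 0)]
    simp only [PiLp.sub_apply]
    ring

end Tri

/-- For a bubble weighted ψ the field Curl ψ, extended by zero, has weak divergence zero and is
orthogonal to σ. Hence (ψ, curl q) = (Curl ψ, q - σ), and the inverse estimate for ψ gives the
factor h_T. -/
theorem exists_curl_residual_le (K : ℕ) {κ : ℝ} (hκ : 0 < κ) :
    ∃ C : ℝ, 0 < C ∧ ∀ (Ω : Set Plane) (𝒯 : Finset Tri), IsTriangulation Ω 𝒯 →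
      ∀ (u : L2 Ω) (σ : L2v Ω), IsG Ω (Hdiv Ω) u σ → ∀ T ∈ 𝒯, T.diam ^ 2 ≤ κ * |T.det| →
      ∀ q : Fin 2 → Poly, (∀ i, q i ∈ polyLE K) →
      T.diam ^ 2 * ∫ x in T.carrier, (polyCurl q).evalAt x ^ 2
        ≤ C * ∫ x in T.carrier, ‖vecAt q x - σ x‖ ^ 2 := by
  obtain ⟨C, hC, hb⟩ := Tri.exists_bubble K
  refine ⟨2 * C ^ 3 * κ ^ 2, by positivity, ?_⟩
  intro Ω 𝒯 h u σ hG T hT hsh q hq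
  have hdet : T.det ≠ 0 := h.conforming.det_ne_zero hT
  have hH := Tri.diam_pos hdet
  have hcK : polyCurl q ∈ polyLE K := Submodule.sub_mem _
    (Poly.pderiv_mem_polyLE (hq 0) 1) (Poly.pderiv_mem_polyLE (hq 1) 0)
  obtain ⟨ψ, h12, h02, h01, hR, -, hD⟩ := hb T κ hdet hsh _ hcK
  have mσ : MemLp σ 2 (volume.restrict T.carrier) := h.memLp_carrier hT (Lp.memLp σ)
  have mψ := memLp_vecAt (vecCurl ψ) T
  have mq := memLp_vecAt q T
  have id1 : ∫ x in T.carrier, ⟪vecAt (vecCurl ψ) x, σ x⟫ = 0 := by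
    have := hG.sum_integral_eq_zero h (𝒩 := {T}) (by simpa using hT) (fun _ => vecCurl ψ)
      (fun _ => 0) (fun φ hφ _ _ => by
        rw [Finset.sum_singleton, Tri.integral_curl_gradient hdet ψ hφ h12 h02]
        simp [h01])
    simpa using this
  have id2 := Tri.integral_curl_poly hdet ψ q h12 h02
  simp only [h01, zero_mul, intervalIntegral.integral_zero, mul_zero] at id2
  have id3 : ∫ x in T.carrier, ψ.evalAt x * (polyCurl q).evalAt x
      = ∫ x in T.carrier, ⟪vecAt (vecCurl ψ) x, vecAt q x - σ x⟫ := by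
    simp only [inner_sub_right]
    rw [integral_sub (integrable_inner_of_memLp mψ mq) (integrable_inner_of_memLp mψ mσ)]
    linarith
  -- This weight makes the term with Curl ψ at most half of the residual.
  have y := integral_inner_le mψ (mq.sub mσ) (ε := T.diam ^ 2 / (2 * C ^ 2 * κ ^ 2))
    (by positivity)
  simp only [Pi.sub_apply] at y
  rw [← id3, integral_norm_vecCurl_sq] at y
  have hD0 := hD 0
  have hD1 := hD 1
  set R := ∫ x in T.carrier, (polyCurl q).evalAt x ^ 2
  set A := ∫ x in T.carrier, ‖vecAt q x - σ x‖ ^ 2 with hA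
  set P := (∫ x in T.carrier, Poly.evalAt (MvPolynomial.pderiv 0 ψ) x ^ 2)
    + ∫ x in T.carrier, Poly.evalAt (MvPolynomial.pderiv 1 ψ) x ^ 2
  have t1 := hR.trans (mul_le_mul_of_nonneg_left y hC.le)
  have t2 : C * (T.diam ^ 2 / (2 * C ^ 2 * κ ^ 2) * P) / 2 ≤ R / 2 := by
    have e : C * (T.diam ^ 2 / (2 * C ^ 2 * κ ^ 2) * P) / 2
        = (T.diam ^ 2 * P) / (4 * C * κ ^ 2) := by field_simp; ring
    rw [e, div_le_div_iff₀ (by positivity) (by norm_num)]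
    linarith
  have t3 : T.diam ^ 2 * (C * ((T.diam ^ 2 / (2 * C ^ 2 * κ ^ 2))⁻¹ * A) / 2)
      = C ^ 3 * κ ^ 2 * A := by field_simp
  have t4 : R / 2 ≤ C * ((T.diam ^ 2 / (2 * C ^ 2 * κ ^ 2))⁻¹ * A) / 2 := by linarith
  have t5 := mul_le_mul_of_nonneg_left t4 (sq_nonneg T.diam)
  rw [t3] at t5
  linarith

/-! ### Local efficiency: tangential jumps -/

/-- The component of a polynomial field in the direction `t`, restricted to the line through
`A` and `B`. -/
def traceOn (A B t : Plane) (q : Fin 2 → Poly) : Polynomial ℝ :=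
  Poly.onLine A B (t 0 • q 0 + t 1 • q 1)

theorem eval_traceOn (A B t : Plane) (q : Fin 2 → Poly) (s : ℝ) :
    (traceOn A B t q).eval s = ⟪vecAt q (AffineMap.lineMap A B s), t⟫ := by
  rw [traceOn, Poly.eval_onLine, plane_inner]
  simp
  ring

theorem traceOn_mem_degreeLE (A B t : Plane) {q : Fin 2 → Poly} {K : ℕ}
    (hq : ∀ i, q i ∈ polyLE K) : traceOn A B t q ∈ Polynomial.degreeLE ℝ (K : WithBot ℕ) :=
  Poly.onLine_mem_degreeLE _ _
    (Submodule.add_mem _ (Submodule.smul_mem _ _ (hq 0)) (Submodule.smul_mem _ _ (hq 1)))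

theorem abs_div_self_eq_neg {a b : ℝ} (h : a * b < 0) : |b| / b = -(|a| / a) := by
  rcases mul_neg_iff.1 h with ⟨ha, hb⟩ | ⟨ha, hb⟩
  · rw [abs_of_pos ha, abs_of_neg hb, neg_div, div_self hb.ne, div_self ha.ne']
  · rw [abs_of_neg ha, abs_of_pos hb, neg_div, div_self hb.ne', div_self ha.ne, neg_neg]

theorem abs_abs_div_self {a : ℝ} (h : a ≠ 0) : |(|a| / a)| = 1 := by
  rw [abs_div, abs_abs, div_self (abs_ne_zero.2 h)]

/-- The jump, weighted by an edge bubble, is extended to the one or two triangles at the edge. The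
Curl of the extension is orthogonal to σ, so Green's formula on these triangles expresses the
weighted square of the jump by q - σ and by the curl of q. The latter is kept on the right side and
estimated separately. -/
theorem exists_jump_residual_le (K : ℕ) {κ : ℝ} (hκ : 0 < κ) :
    ∃ C : ℝ, 0 < C ∧ ∀ (Ω : Set Plane) (𝒯 : Finset Tri), IsTriangulation Ω 𝒯 →
      (∀ T ∈ 𝒯, T.diam ^ 2 ≤ κ * |T.det|) →
      ∀ (u : L2 Ω) (σ : L2v Ω), IsG Ω (Hdiv Ω) u σ → ∀ q : Tri → Fin 2 → Poly,
      (∀ T ∈ 𝒯, ∀ i, q T i ∈ polyLE K) → ∀ T ∈ 𝒯, ∀ i : Fin 3,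
      T.edgeLen i * edgeNormSq T i (fun x => ⟪vecAt (q T) x, T.tangent i⟫
          - ∑ T' ∈ neighbors 𝒯 T i, ⟪vecAt (q T') x, T.tangent i⟫)
        ≤ C * (∑ S ∈ neighbors 𝒯 T i, ((∫ x in S.carrier, ‖vecAt (q S) x - σ x‖ ^ 2)
            + S.diam ^ 2 * ∫ x in S.carrier, (polyCurl (q S)).evalAt x ^ 2)
          + ((∫ x in T.carrier, ‖vecAt (q T) x - σ x‖ ^ 2)
            + T.diam ^ 2 * ∫ x in T.carrier, (polyCurl (q T)).evalAt x ^ 2)) := by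
  classical
  obtain ⟨C, hC, hb⟩ := Tri.exists_edgeBubble K
  refine ⟨2 * C ^ 3 * (2 * κ + 1), by positivity, ?_⟩
  intro Ω 𝒯 h hsh u σ hG q hq T hT i
  have hcf := h.conforming
  set A := T.edgeA i with hA
  set B := T.edgeB i with hB
  set V₀ := T.edgeFirst i with hV₀
  have hV₀d : V₀.det ≠ 0 := hcf.edgeFirst_det_ne_zero hT i
  set 𝒩 := insert T (neighbors 𝒯 T i) with h𝒩
  have hTn : T ∉ neighbors 𝒯 T i := fun hm => (mem_neighbors.1 hm).2.1 rfl
  have h𝒩𝒯 : 𝒩 ⊆ 𝒯 :=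
    Finset.insert_subset hT fun S hS => (mem_neighbors.1 hS).1
  -- Every triangle of the patch is renumbered so that the common edge comes first and runs from A
  -- to B. The signs of the determinants then record the side of the edge and are opposite for T and
  -- its neighbour.
  have hVex : ∀ S ∈ 𝒩, ∃ V : Tri, V.det ≠ 0 ∧ V 0 = A ∧ V 1 = B ∧ V.carrier = S.carrier ∧
      |V.det| = |S.det| ∧ (S ∈ neighbors 𝒯 T i → |V.det| / V.det = -(|V₀.det| / V₀.det)) ∧
      (S = T → V = V₀) := by
    intro S hS
    rcases Finset.mem_insert.1 hS with rfl | hS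
    · exact ⟨V₀, hV₀d, rfl, rfl, Tri.carrier_edgeFirst _ _, Tri.abs_det_edgeFirst _ _,
        fun hm => absurd hm hTn, fun _ => rfl⟩
    · obtain ⟨j, l, hjl, h0, h1⟩ := hcf.exists_neighbor_reorder hT hS
      refine ⟨S.reorder j l, hcf.det_reorder_ne_zero (mem_neighbors.1 hS).1 hjl, h0, h1,
        S.carrier_reorder hjl, S.abs_det_reorder hjl, fun _ => ?_, ?_⟩
      · exact abs_div_self_eq_neg (hcf.neighbor_det_neg hT hS hjl h0 h1)
      · rintro rfl
        exact absurd hS hTn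
  choose! V hVd hVA hVB hVc hVdet hVs hVT using hVex
  have hVTT : V T = V₀ := hVT T (Finset.mem_insert_self _ _) rfl
  set sg := |V₀.det| / V₀.det with hsg
  set J : Polynomial ℝ := traceOn A B (T.tangent i) (q T)
    - ∑ S ∈ neighbors 𝒯 T i, traceOn A B (T.tangent i) (q S) with hJ
  have hJK : J ∈ Polynomial.degreeLE ℝ (K : WithBot ℕ) :=
    Submodule.sub_mem _ (traceOn_mem_degreeLE _ _ _ (hq T hT))
      (Submodule.sum_mem _ fun S hS =>
        traceOn_mem_degreeLE _ _ _ (hq S (mem_neighbors.1 hS).1))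
  obtain ⟨hJJ, hJV⟩ := hb J hJK
  have hJs : ∀ s, J.eval s = ⟪vecAt (q T) (AffineMap.lineMap A B s), T.tangent i⟫
      - ∑ S ∈ neighbors 𝒯 T i, ⟪vecAt (q S) (AffineMap.lineMap A B s), T.tangent i⟫ := by
    intro s
    simp only [hJ, Polynomial.eval_sub, Polynomial.eval_finsetSum, eval_traceOn]
  set L := T.edgeLen i with hL
  have hL0 : 0 < L := dist_pos.2 (edgeA_ne_edgeB (hcf.det_ne_zero hT) i)
  have ht : B - A = L • T.tangent i := by
    rw [Tri.tangent, smul_smul, mul_inv_cancel₀ hL0.ne', one_smul]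
  let ψ : Tri → Poly := fun S => (V S).push (edgeBubble J)
  have hψ := fun S (hS : S ∈ 𝒩) t => Tri.push_edgeBubble_lineMap (hVd S hS) J t
  -- a field with weak divergence zero
  have htest : ∀ φ : Plane → ℝ, ContDiff ℝ ∞ φ → HasCompactSupport φ → tsupport φ ⊆ Ω →
      ∑ S ∈ 𝒩, ((∫ x in S.carrier, ⟪vecAt (vecCurl (ψ S)) x, gradient φ x⟫)
        + ∫ x in S.carrier, Poly.evalAt 0 x * φ x) = 0 := by
    intro φ hφ hc hs
    set I := ∫ t in (0 : ℝ)..1, ((1 - t) * t) ^ 2 * J.eval t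
      * fderiv ℝ φ (AffineMap.lineMap A B t) (B - A) with hI
    have e : ∀ S ∈ 𝒩, ∫ x in S.carrier, ⟪vecAt (vecCurl (ψ S)) x, gradient φ x⟫
        = |(V S).det| / (V S).det * I := by
      intro S hS
      rw [← hVc S hS, Tri.integral_curl_gradient (hVd S hS) (ψ S) hφ (fun t => (hψ S hS t).1)
        (fun t => (hψ S hS t).2.1)]
      congr 1
      refine intervalIntegral.integral_congr fun t _ => ?_
      simp only [ψ, (hψ S hS t).2.2]
      rw [hVA S hS, hVB S hS]
    simp only [Poly.evalAt_zero, zero_mul, integral_zero, add_zero]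
    rw [Finset.sum_congr rfl e, Finset.sum_insert hTn, hVTT]
    rw [Finset.sum_congr rfl (g := fun _ => -(sg * I)) fun S hS => by
      rw [hVs S (Finset.mem_insert_of_mem hS) hS, neg_mul]]
    rw [Finset.sum_const]
    have hcard := hcf.card_neighbors_le hT i
    -- Without a neighbour, φ vanishes along the open edge and so does its tangential derivative.
    -- With one neighbour, the two edge terms cancel because of the opposite signs.
    interval_cases hn : (neighbors 𝒯 T i).card
    · have hI0 : I = 0 := by
        have hempty := Finset.card_eq_zero.1 hn
        have hz : ∀ t ∈ Set.Ioo (0 : ℝ) 1, φ (AffineMap.lineMap A B t) = 0 := by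
          intro t ht'
          by_contra hne
          exact h.lineMap_notMem hT hempty ht'.1 ht'.2 (hs (subset_tsupport _ hne))
        have hz' : ∀ t ∈ Set.Ioo (0 : ℝ) 1,
            fderiv ℝ φ (AffineMap.lineMap A B t) (B - A) = 0 := by
          intro t ht'
          have hd1 : HasDerivAt (fun t : ℝ => (AffineMap.lineMap A B t : Plane)) (B - A) t :=
            AffineMap.hasDerivAt_lineMap
          have hd2 := ((hφ.differentiable (by simp))
            (AffineMap.lineMap A B t)).hasFDerivAt.comp_hasDerivAt t hd1
          have hd3 : HasDerivAt (fun _ : ℝ => (0 : ℝ)) 0 t := hasDerivAt_const _ _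
          refine hd2.unique (hd3.congr_of_eventuallyEq ?_)
          filter_upwards [isOpen_Ioo.mem_nhds ht'] with r hr using hz r hr
        rw [hI, intervalIntegral.integral_of_le zero_le_one, integral_Ioc_eq_integral_Ioo]
        rw [setIntegral_congr_fun (g := fun _ => 0) measurableSet_Ioo fun t ht' => by
          simp only [hz' t ht', mul_zero]]
        simp
      rw [hI0]
      simp
    · rw [one_smul]
      ring
  have hpair := hG.sum_integral_eq_zero h h𝒩𝒯 (fun S => vecCurl (ψ S)) (fun _ => 0) htest
  simp only [Poly.evalAt_zero, zero_mul, integral_zero, add_zero] at hpair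
  -- the jump, weighted with the bubble function
  set X := ∫ s in (0 : ℝ)..1, ((1 - s) * s) ^ 2 * J.eval s ^ 2 with hX
  set R := ∫ s in (0 : ℝ)..1, J.eval s ^ 2 with hR
  have hR0 : 0 ≤ R := intervalIntegral.integral_nonneg zero_le_one fun _ _ => sq_nonneg _
  have hgreen : ∀ S ∈ 𝒩, (∫ x in S.carrier, ⟪vecAt (vecCurl (ψ S)) x, vecAt (q S) x⟫)
      - ∫ x in S.carrier, (ψ S).evalAt x * (polyCurl (q S)).evalAt x
      = |(V S).det| / (V S).det * (L * ∫ t in (0 : ℝ)..1, ((1 - t) * t) ^ 2 * J.eval t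
        * ⟪vecAt (q S) (AffineMap.lineMap A B t), T.tangent i⟫) := by
    intro S hS
    rw [← hVc S hS, Tri.integral_curl_poly (hVd S hS) (ψ S) (q S) (fun t => (hψ S hS t).1)
      (fun t => (hψ S hS t).2.1)]
    congr 1
    rw [← intervalIntegral.integral_const_mul]
    refine intervalIntegral.integral_congr fun t _ => ?_
    simp only [ψ, (hψ S hS t).2.2]
    rw [hVA S hS, hVB S hS, ht, real_inner_smul_right]
    ring
  have hcont : ∀ S, Continuous fun t : ℝ => ((1 - t) * t) ^ 2 * J.eval t
        * ⟪vecAt (q S) (AffineMap.lineMap A B t), T.tangent i⟫ := by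
    intro S
    have hl : Continuous fun t : ℝ => (AffineMap.lineMap A B t : Plane) :=
      AffineMap.lineMap_continuous
    have := J.continuous
    exact (((by fun_prop : Continuous fun t : ℝ => ((1 - t) * t) ^ 2)).mul this).mul
      (((continuous_vecAt (q S)).comp hl).inner continuous_const)
  have hcontI := fun S => (hcont S).intervalIntegrable (μ := volume) 0 1
  -- The signs turn the sum of the edge traces into the jump J, up to the common sign `sg`.
  have hsum : ∑ S ∈ 𝒩, ((∫ x in S.carrier, ⟪vecAt (vecCurl (ψ S)) x, vecAt (q S) x⟫)
      - ∫ x in S.carrier, (ψ S).evalAt x * (polyCurl (q S)).evalAt x) = sg * (L * X) := by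
    rw [Finset.sum_congr rfl hgreen, Finset.sum_insert hTn, hVTT]
    rw [Finset.sum_congr rfl (g := fun S => -(sg * L) * ∫ t in (0 : ℝ)..1,
      ((1 - t) * t) ^ 2 * J.eval t * ⟪vecAt (q S) (AffineMap.lineMap A B t), T.tangent i⟫)
      fun S hS => by rw [hVs S (Finset.mem_insert_of_mem hS) hS]; ring]
    rw [← Finset.mul_sum, ← intervalIntegral.integral_finsetSum fun S _ => hcontI S]
    have eX : X = (∫ t in (0 : ℝ)..1, ((1 - t) * t) ^ 2 * J.eval t
          * ⟪vecAt (q T) (AffineMap.lineMap A B t), T.tangent i⟫)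
        - ∫ t in (0 : ℝ)..1, ∑ S ∈ neighbors 𝒯 T i, ((1 - t) * t) ^ 2 * J.eval t
          * ⟪vecAt (q S) (AffineMap.lineMap A B t), T.tangent i⟫ := by
      have hS : IntervalIntegrable (fun t => ∑ S ∈ neighbors 𝒯 T i, ((1 - t) * t) ^ 2 * J.eval t
          * ⟪vecAt (q S) (AffineMap.lineMap A B t), T.tangent i⟫) volume 0 1 :=
        (continuous_finsetSum _ fun S _ => hcont S).intervalIntegrable 0 1
      refine Eq.trans ?_ (intervalIntegral.integral_sub (hcontI T) hS)
      refine intervalIntegral.integral_congr fun t _ => ?_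
      rw [← Finset.mul_sum, ← mul_sub, ← hJs]
      ring
    rw [eX]
    ring
  have hmem : ∀ S ∈ 𝒩, S ∈ 𝒯 := fun S hS => h𝒩𝒯 hS
  have mσ : ∀ S ∈ 𝒩, MemLp σ 2 (volume.restrict S.carrier) := fun S hS =>
    h.memLp_carrier (hmem S hS) (Lp.memLp σ)
  have hsum2 : sg * (L * X) = ∑ S ∈ 𝒩,
      ((∫ x in S.carrier, ⟪vecAt (vecCurl (ψ S)) x, vecAt (q S) x - σ x⟫)
      - ∫ x in S.carrier, ⟪(ψ S).evalAt x, (polyCurl (q S)).evalAt x⟫) := by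
    rw [← hsum, ← sub_zero (∑ S ∈ 𝒩, _), ← hpair, ← Finset.sum_sub_distrib]
    refine Finset.sum_congr rfl fun S hS => ?_
    simp only [inner_sub_right]
    rw [integral_sub (integrable_inner_of_memLp (memLp_vecAt _ S) (memLp_vecAt _ S))
      (integrable_inner_of_memLp (memLp_vecAt _ S) (mσ S hS))]
    have : ∀ x, ⟪(ψ S).evalAt x, (polyCurl (q S)).evalAt x⟫
        = (ψ S).evalAt x * (polyCurl (q S)).evalAt x := fun x => by simp [mul_comm]
    simp only [this]
    ring
  set Y : Tri → ℝ := fun S => (∫ x in S.carrier, ‖vecAt (q S) x - σ x‖ ^ 2)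
    + S.diam ^ 2 * ∫ x in S.carrier, (polyCurl (q S)).evalAt x ^ 2 with hY
  -- In the factor 2κ + 1, the part 2κ belongs to the two partial derivatives of ψ and 1 to ψ
  -- itself, which is weighted with ε / h_S². Two triangles with this ε contribute, after
  -- multiplication by C, at most half of `L * R`.
  set ε := L / (2 * C ^ 2 * (2 * κ + 1)) with hε
  have hε0 : 0 < ε := by positivity
  have hterm : ∀ S ∈ 𝒩,
      |(∫ x in S.carrier, ⟪vecAt (vecCurl (ψ S)) x, vecAt (q S) x - σ x⟫)
      - ∫ x in S.carrier, ⟪(ψ S).evalAt x, (polyCurl (q S)).evalAt x⟫|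
      ≤ ε * (C * (2 * κ + 1) * R) / 2 + ε⁻¹ * Y S / 2 := by
    intro S hS
    have hdS := Tri.diam_pos (hcf.det_ne_zero (hmem S hS))
    have hdiam : (V S).diam = S.diam := by
      unfold Tri.diam; rw [hVc S hS]
    have hshV : (V S).diam ^ 2 ≤ κ * |(V S).det| := by
      rw [hdiam, hVdet S hS]; exact hsh S (hmem S hS)
    obtain ⟨g1, g2⟩ := hJV (V S) κ (hVd S hS) hshV
    rw [hVc S hS, hdiam] at g1
    simp only [hVc S hS] at g2
    have y1 := abs_integral_inner_le (memLp_vecAt (vecCurl (ψ S)) S)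
      ((memLp_vecAt (q S) S).sub (mσ S hS)) hε0
    have y2 := abs_integral_inner_le (memLp_poly (ψ S) S)
      (memLp_poly (polyCurl (q S)) S) (ε := ε / S.diam ^ 2) (by positivity)
    simp only [Pi.sub_apply, Real.norm_eq_abs, sq_abs] at y1 y2
    rw [integral_norm_vecCurl_sq] at y1
    have g20 := g2 0
    have g21 := g2 1
    change ∫ x in S.carrier, (ψ S).evalAt x ^ 2 ≤ C * S.diam ^ 2 * R at g1
    change ∫ x in S.carrier, Poly.evalAt (MvPolynomial.pderiv 0 (ψ S)) x ^ 2 ≤ C * κ * R at g20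
    change ∫ x in S.carrier, Poly.evalAt (MvPolynomial.pderiv 1 (ψ S)) x ^ 2 ≤ C * κ * R at g21
    have z1 := mul_le_mul_of_nonneg_left (add_le_add g20 g21) hε0.le
    have z2 : ε / S.diam ^ 2 * ∫ x in S.carrier, (ψ S).evalAt x ^ 2 ≤ ε * (C * R) := by
      have := mul_le_mul_of_nonneg_left g1 (show 0 ≤ ε / S.diam ^ 2 by positivity)
      have e : ε / S.diam ^ 2 * (C * S.diam ^ 2 * R) = ε * (C * R) := by field_simp
      rwa [e] at this
    have z3 : (ε / S.diam ^ 2)⁻¹ = ε⁻¹ * S.diam ^ 2 := by rw [inv_div]; field_simp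
    rw [z3] at y2
    refine (abs_sub _ _).trans ?_
    simp only [hY]
    linarith
  have habs : L * X ≤ ∑ S ∈ 𝒩, (ε * (C * (2 * κ + 1) * R) / 2 + ε⁻¹ * Y S / 2) := by
    have e1 : |sg * (L * X)| = |L * X| := by rw [abs_mul, abs_abs_div_self hV₀d, one_mul]
    refine (le_abs_self _).trans ?_
    rw [← e1, hsum2]
    exact (Finset.abs_sum_le_sum_abs _ _).trans (Finset.sum_le_sum hterm)
  have hcard : ((𝒩.card : ℕ) : ℝ) ≤ 2 := by
    have : 𝒩.card = (neighbors 𝒯 T i).card + 1 := Finset.card_insert_of_notMem hTn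
    have := hcf.card_neighbors_le hT i
    exact_mod_cast (by omega : 𝒩.card ≤ 2)
  rw [Finset.sum_add_distrib, Finset.sum_const, nsmul_eq_mul, ← Finset.sum_div,
    ← Finset.mul_sum] at habs
  have hYsum : ∑ S ∈ 𝒩, Y S = ∑ S ∈ neighbors 𝒯 T i, Y S + Y T := by
    rw [Finset.sum_insert hTn, add_comm]
  have hEN : edgeNormSq T i (fun x => ⟪vecAt (q T) x, T.tangent i⟫
          - ∑ T' ∈ neighbors 𝒯 T i, ⟪vecAt (q T') x, T.tangent i⟫) = L * R := by
    rw [edgeNormSq]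
    congr 1
    refine intervalIntegral.integral_congr fun s _ => ?_
    simp only [hJs]
    rfl
  rw [hEN]
  change L * (L * R) ≤ 2 * C ^ 3 * (2 * κ + 1) * (∑ S ∈ neighbors 𝒯 T i, Y S + Y T)
  rw [← hYsum]
  set Z := ∑ S ∈ 𝒩, Y S
  have s1 : (𝒩.card : ℝ) * (ε * (C * (2 * κ + 1) * R) / 2)
      ≤ 2 * (ε * (C * (2 * κ + 1) * R) / 2) :=
    mul_le_mul_of_nonneg_right hcard (by positivity)
  have s2 : C * (2 * (ε * (C * (2 * κ + 1) * R) / 2)) = L * R / 2 := by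
    rw [hε]; field_simp
  have s3 : L * (C * (ε⁻¹ * Z / 2)) = C ^ 3 * (2 * κ + 1) * Z := by
    rw [hε]; field_simp
  have s4 : L * R ≤ C * (L * X) := by
    have := mul_le_mul_of_nonneg_left hJJ hL0.le
    linarith
  have s5 : C * (L * X) ≤ C * (2 * (ε * (C * (2 * κ + 1) * R) / 2) + ε⁻¹ * Z / 2) :=
    mul_le_mul_of_nonneg_left (by linarith) hC.le
  have s6 : L * R / 2 ≤ C * (ε⁻¹ * Z / 2) := by linarith
  have s7 := mul_le_mul_of_nonneg_left s6 hL0.le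
  linarith

/-! ### Piecewise polynomial functions -/

theorem polyLE_mono {K L : ℕ} (h : K ≤ L) : polyLE K ≤ polyLE L := fun _ hp =>
  (MvPolynomial.mem_restrictTotalDegree _ _ _).2
    (((MvPolynomial.mem_restrictTotalDegree _ _ _).1 hp).trans h)

/-- Uniqueness of the representing polynomial transfers degree bounds to the representatives
selected by choice in `polyOn` and `vecOn`. -/
theorem Tri.poly_eq_of_ae {T : Tri} (h : T.det ≠ 0) {p p' : Poly}
    (hp : p.evalAt =ᵐ[volume.restrict T.carrier] p'.evalAt) : p = p' := by
  have h1 := ae_restrict_of_ae_restrict_of_subset (interior_subset (s := T.carrier)) hp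
  have h2 := Measure.eqOn_open_of_ae_eq h1 isOpen_interior p.continuous.continuousOn
    p'.continuous.continuousOn
  have h3 : T.pull (p - p') = 0 := Poly.eq_zero_of_refTri fun y y0 y1 y2 => by
    rw [evalAt_pull, Poly.evalAt_sub, sub_eq_zero]
    exact h2 (toPlane_mem_interior h y0 y1 y2)
  refine MvPolynomial.funext fun z => ?_
  have h4 := T.evalAt_pull (p - p') (T.coord (WithLp.toLp 2 z))
  rw [h3, toPlane_coord h, Poly.evalAt_sub, Poly.evalAt_zero] at h4
  have h5 : Poly.evalAt p (WithLp.toLp 2 z) = Poly.evalAt p' (WithLp.toLp 2 z) := by linarith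
  simpa [Poly.evalAt] using h5

/-- The degree bound k + 1 common to the three families is all that the estimates need to know about
their local spaces. -/
theorem mem_polyLE_of_mem_localSpace {fam : Family} {k : ℕ} {T : Tri} {q : Fin 2 → Poly}
    (hq : q ∈ localSpace fam k T) (i : Fin 2) : q i ∈ polyLE (k + 1) := by
  cases fam with
  | RT =>
    obtain ⟨p, hp, r, hr, h⟩ := hq
    rw [h i]
    refine Submodule.add_mem _ (polyLE_mono k.le_succ (hp i (Set.mem_univ _))) ?_
    rw [polyLE, MvPolynomial.mem_restrictTotalDegree] at hr ⊢
    refine (MvPolynomial.totalDegree_mul _ _).trans ?_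
    rw [MvPolynomial.totalDegree_X]
    omega
  | BDM => exact hq i (Set.mem_univ _)
  | BDFM => exact hq.1 i (Set.mem_univ _)

theorem IsTriangulation.vecOn_spec {Ω : Set Plane} {𝒯 : Finset Tri} (h : IsTriangulation Ω 𝒯)
    {fam : Family} {k : ℕ} {s : L2v Ω} (hs : s ∈ Sh Ω fam k 𝒯) {T : Tri} (hT : T ∈ 𝒯) :
    (∀ i, vecOn Ω T s i ∈ polyLE (k + 1)) ∧
      ∀ᵐ x ∂(volume.restrict T.carrier), s x = vecAt (vecOn Ω T s) x := by
  obtain ⟨q, hq, hqs⟩ := hs.2 T hT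
  have hex : ∃ q, VecRepOn Ω T s q := ⟨q, hqs⟩
  have hrep : VecRepOn Ω T s (vecOn Ω T s) := by
    unfold vecOn
    rw [dif_pos hex]
    exact hex.choose_spec
  have h1 := h.ae_carrier hT hqs
  have h2 := h.ae_carrier hT hrep
  refine ⟨fun i => ?_, h2⟩
  have e : vecOn Ω T s i = q i := by
    refine Tri.poly_eq_of_ae (h.conforming.det_ne_zero hT) ?_
    filter_upwards [h1, h2] with x a b
    have hv := congrArg (fun v : Plane => v i) (b.symm.trans a)
    fin_cases i <;> exact hv
  rw [e]
  exact mem_polyLE_of_mem_localSpace hq i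

theorem IsTriangulation.polyOn_spec {Ω : Set Plane} {𝒯 : Finset Tri} (h : IsTriangulation Ω 𝒯)
    {k : ℕ} {w : L2 Ω} (hw : w ∈ Mh Ω k 𝒯) {T : Tri} (hT : T ∈ 𝒯) :
    polyOn Ω T w ∈ polyLE k ∧
      ∀ᵐ x ∂(volume.restrict T.carrier), w x = (polyOn Ω T w).evalAt x := by
  obtain ⟨p, hp, hpw⟩ := hw T hT
  have hex : ∃ p, RepOn Ω T w p := ⟨p, hpw⟩
  have hrep : RepOn Ω T w (polyOn Ω T w) := by
    unfold polyOn
    rw [dif_pos hex]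
    exact hex.choose_spec
  have h1 := h.ae_carrier hT hpw
  have h2 := h.ae_carrier hT hrep
  refine ⟨?_, h2⟩
  have e : polyOn Ω T w = p := by
    refine Tri.poly_eq_of_ae (h.conforming.det_ne_zero hT) ?_
    filter_upwards [h1, h2] with x a b
    exact b.symm.trans a
  rw [e]
  exact hp

theorem gradOp_mem (Ω : Set Plane) (S : Submodule ℝ (L2v Ω)) (w : L2 Ω) : gradOp Ω S w ∈ S := by
  unfold gradOp
  split_ifs with h
  · exact h.choose_spec.1
  -- The default value of `gradOp` also lies in S, so no solvability argument is needed here.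
  · exact S.zero_mem

theorem DiscreteEigensystem.Lam_mem {Ω : Set Plane} {S : Submodule ℝ (L2v Ω)}
    {M : Submodule ℝ (L2 Ω)} (D : DiscreteEigensystem Ω S M) (n m : ℕ) (lam : ℝ) (g : L2 Ω) :
    D.Lam n m lam g ∈ M := by
  have h1 : D.clusterSpace n m ≤ M := by
    conv_rhs => rw [← D.span_eq]
    refine Submodule.span_mono ?_
    rintro _ ⟨j, rfl⟩
    exact ⟨_, rfl⟩
  exact h1 (Submodule.starProjection_apply_mem _ _)

/-! ### Summation over the mesh -/

theorem norm_sq_eq_integral_norm_sq {X E : Type*} [MeasurableSpace X] {μ : Measure X}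
    [NormedAddCommGroup E] [InnerProductSpace ℝ E] (f : Lp E 2 μ) :
    ‖f‖ ^ 2 = ∫ x, ‖f x‖ ^ 2 ∂μ := by
  rw [← real_inner_self_eq_norm_sq, L2.inner_def]
  simp only [real_inner_self_eq_norm_sq]

/-- Up to null sets the triangles may be replaced by their interiors, which are disjoint subsets of
Ω. -/
theorem IsTriangulation.sum_integral_norm_sq_le {Ω : Set Plane} {𝒯 : Finset Tri}
    (h : IsTriangulation Ω 𝒯) {E : Type*} [NormedAddCommGroup E] [InnerProductSpace ℝ E]
    (f : Lp E 2 (volume.restrict Ω)) :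
    ∑ T ∈ 𝒯, ∫ x in T.carrier, ‖f x‖ ^ 2 ≤ ‖f‖ ^ 2 := by
  have hint : IntegrableOn (fun x => ‖f x‖ ^ 2) Ω volume :=
    (Lp.memLp f).integrable_norm_pow (by norm_num)
  have e : ∀ T ∈ 𝒯, ∫ x in T.carrier, ‖f x‖ ^ 2 = ∫ x in interior T.carrier, ‖f x‖ ^ 2 := by
    intro T _
    exact (setIntegral_congr_set
      (interior_ae_eq_of_null_frontier (T.convex_carrier.addHaar_frontier volume))).symm
  rw [norm_sq_eq_integral_norm_sq, Finset.sum_congr rfl e,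
    ← integral_biUnion_finset 𝒯 (fun T _ => isOpen_interior.measurableSet)
      (fun T hT T' hT' hne => h.conforming.disjoint_interior T hT T' hT' hne)
      (fun T hT => hint.mono_set (h.interior_subset hT))]
  refine setIntegral_mono_set hint (Filter.Eventually.of_forall fun x => sq_nonneg _) ?_
  have hsub : (⋃ T ∈ 𝒯, interior T.carrier) ⊆ Ω :=
    Set.iUnion₂_subset fun T hT => h.interior_subset hT
  exact hsub.eventuallyLE

/-- The order of summation is exchanged by symmetry of the neighbour relation. For each of the three
i, a triangle S is counted at most once through each of its three edges, which gives the crude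
factor 9. -/
theorem IsConforming.sum_neighbors_le {𝒯 : Finset Tri} (h : IsConforming 𝒯) {a : Tri → ℝ}
    (ha : ∀ T, 0 ≤ a T) :
    ∑ T ∈ 𝒯, ∑ i : Fin 3, ∑ S ∈ neighbors 𝒯 T i, a S ≤ 9 * ∑ T ∈ 𝒯, a T := by
  classical
  have h1 : ∀ T ∈ 𝒯, ∀ i : Fin 3, ∑ S ∈ neighbors 𝒯 T i, a S
      ≤ ∑ S ∈ 𝒯, ∑ j : Fin 3, if T ∈ neighbors 𝒯 S j then a S else 0 := by
    intro T hT i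
    have hn : ∀ S, ∀ j ∈ (Finset.univ : Finset (Fin 3)),
        0 ≤ if T ∈ neighbors 𝒯 S j then a S else 0 := by
      intro S j _
      split_ifs
      · exact ha S
      · exact le_rfl
    refine le_trans (Finset.sum_le_sum fun S hS => ?_)
      (Finset.sum_le_sum_of_subset_of_nonneg (fun S hS => (mem_neighbors.1 hS).1)
        fun S _ _ => Finset.sum_nonneg (hn S))
    obtain ⟨j, hj⟩ := h.neighbors_symm hT hS
    refine le_trans (le_of_eq ?_) (Finset.single_le_sum (hn S) (Finset.mem_univ j))
    rw [if_pos hj]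
  have h2 : ∀ S ∈ 𝒯, ∀ j : Fin 3, ∑ T ∈ 𝒯, (if T ∈ neighbors 𝒯 S j then a S else 0) ≤ a S := by
    intro S hS j
    rw [← Finset.sum_filter, Finset.sum_const, nsmul_eq_mul]
    have hc : (𝒯.filter fun T => T ∈ neighbors 𝒯 S j).card ≤ 1 :=
      (Finset.card_le_card fun T hT => (Finset.mem_filter.1 hT).2).trans
        (h.card_neighbors_le hS j)
    have hc' : (((𝒯.filter fun T => T ∈ neighbors 𝒯 S j).card : ℕ) : ℝ) ≤ 1 := by
      exact_mod_cast hc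
    nlinarith [ha S]
  calc ∑ T ∈ 𝒯, ∑ i : Fin 3, ∑ S ∈ neighbors 𝒯 T i, a S
      ≤ ∑ T ∈ 𝒯, ∑ _i : Fin 3, ∑ S ∈ 𝒯, ∑ j : Fin 3,
          (if T ∈ neighbors 𝒯 S j then a S else 0) :=
        Finset.sum_le_sum fun T hT => Finset.sum_le_sum fun i _ => h1 T hT i
    _ = 3 * ∑ T ∈ 𝒯, ∑ S ∈ 𝒯, ∑ j : Fin 3, (if T ∈ neighbors 𝒯 S j then a S else 0) := by
        rw [Finset.mul_sum]
        simp
    _ = 3 * ∑ S ∈ 𝒯, ∑ j : Fin 3, ∑ T ∈ 𝒯, (if T ∈ neighbors 𝒯 S j then a S else 0) := by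
        rw [Finset.sum_comm]
        congr 1
        exact Finset.sum_congr rfl fun S _ => Finset.sum_comm
    _ ≤ 3 * ∑ S ∈ 𝒯, ∑ _j : Fin 3, a S :=
        mul_le_mul_of_nonneg_left (Finset.sum_le_sum fun S hS =>
          Finset.sum_le_sum fun j _ => h2 S hS j) (by norm_num)
    _ = 9 * ∑ T ∈ 𝒯, a T := by
        simp only [Finset.sum_const, Finset.card_univ, Fintype.card_fin, nsmul_eq_mul]
        rw [← Finset.mul_sum]
        push_cast
        ring

/-! ### The global estimate for arbitrary discrete functions -/

theorem etaSq_nonneg (Ω : Set Plane) (S : Submodule ℝ (L2v Ω)) (𝒯 : Finset Tri) (g : L2 Ω)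
    (T : Tri) : 0 ≤ etaSq Ω S 𝒯 g T := by
  have hl : ∀ i, 0 ≤ T.edgeLen i := fun i => dist_nonneg
  refine add_nonneg (add_nonneg (integral_nonneg fun _ => sq_nonneg _)
    (integral_nonneg fun _ => sq_nonneg _)) (Finset.sum_nonneg fun i _ => ?_)
  exact mul_nonneg (hl i) (mul_nonneg (hl i)
    (intervalIntegral.integral_nonneg zero_le_one fun _ _ => sq_nonneg _))

theorem exists_sum_etaSq_le (fam : Family) (k : ℕ) {κ Q : ℝ} (hκ : 0 < κ) (hQ : 0 < Q) :
    ∃ C : ℝ, 0 < C ∧ ∀ (Ω : Set Plane) (𝒯 : Finset Tri), IsTriangulation Ω 𝒯 →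
      (∀ T ∈ 𝒯, T.diam ^ 2 ≤ κ * |T.det| ∧ T.diam ^ 2 ≤ Q) →
      ∀ (u : L2 Ω) (σ : L2v Ω), IsG Ω (Hdiv Ω) u σ → ∀ w ∈ Mh Ω k 𝒯,
      ∑ T ∈ 𝒯, etaSq Ω (Sh Ω fam k 𝒯) 𝒯 w T
        ≤ C * (‖u - w‖ ^ 2 + ‖σ - gradOp Ω (Sh Ω fam k 𝒯) w‖ ^ 2) := by
  obtain ⟨C₁, hC₁, H₁⟩ := exists_gradient_residual_le (k + 1) hκ hQ
  obtain ⟨C₂, hC₂, H₂⟩ := exists_curl_residual_le (k + 1) hκ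
  obtain ⟨C₃, hC₃, H₃⟩ := exists_jump_residual_le (k + 1) hκ
  -- The factor 1 + C₂ removes the curl terms from the jump estimate. The 12 consists of 9 for the
  -- sums over neighbours and 3 for the edges of the triangle itself.
  refine ⟨C₁ + C₂ + 12 * C₃ * (1 + C₂), by positivity, ?_⟩
  intro Ω 𝒯 h hsh u σ hG w hw
  set s := gradOp Ω (Sh Ω fam k 𝒯) w with hs
  have hsS : s ∈ Sh Ω fam k 𝒯 := gradOp_mem _ _ _
  set q : Tri → Fin 2 → Poly := fun T => vecOn Ω T s with hq
  have hqK : ∀ T ∈ 𝒯, ∀ i, q T i ∈ polyLE (k + 1) := fun T hT => (h.vecOn_spec hsS hT).1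
  set A : Tri → ℝ := fun T => ∫ x in T.carrier, ‖vecAt (q T) x - σ x‖ ^ 2 with hA
  set B : Tri → ℝ := fun T => ∫ x in T.carrier, (u x - (polyOn Ω T w).evalAt x) ^ 2 with hB
  have hA0 : ∀ T, 0 ≤ A T := fun T => integral_nonneg fun _ => sq_nonneg _
  have hB0 : ∀ T, 0 ≤ B T := fun T => integral_nonneg fun _ => sq_nonneg _
  have hAsum : ∑ T ∈ 𝒯, A T ≤ ‖σ - s‖ ^ 2 := by
    refine le_trans (le_of_eq (Finset.sum_congr rfl fun T hT => ?_))
      (h.sum_integral_norm_sq_le (σ - s))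
    refine integral_congr_ae ?_
    filter_upwards [(h.vecOn_spec hsS hT).2, h.ae_carrier hT
      ((Lp.coeFn_sub σ s).mono fun x hx _ => hx)] with x h1 h2
    rw [h2, Pi.sub_apply, h1, norm_sub_rev]
  have hBsum : ∑ T ∈ 𝒯, B T ≤ ‖u - w‖ ^ 2 := by
    refine le_trans (le_of_eq (Finset.sum_congr rfl fun T hT => ?_))
      (h.sum_integral_norm_sq_le (u - w))
    refine integral_congr_ae ?_
    filter_upwards [(h.polyOn_spec hw hT).2, h.ae_carrier hT
      ((Lp.coeFn_sub u w).mono fun x hx _ => hx)] with x h1 h2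
    rw [h2, Pi.sub_apply, h1, Real.norm_eq_abs, sq_abs]
  have hcurl : ∀ T ∈ 𝒯, T.diam ^ 2 * ∫ x in T.carrier, (polyCurl (q T)).evalAt x ^ 2
      ≤ C₂ * A T := fun T hT => H₂ Ω 𝒯 h u σ hG T hT (hsh T hT).1 (q T) (hqK T hT)
  have hloc : ∀ T ∈ 𝒯, etaSq Ω (Sh Ω fam k 𝒯) 𝒯 w T
      ≤ C₁ * (A T + B T) + C₂ * A T
        + ∑ i : Fin 3, C₃ * (1 + C₂) * (∑ S ∈ neighbors 𝒯 T i, A S + A T) := by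
    intro T hT
    refine add_le_add (add_le_add ?_ ?_) (Finset.sum_le_sum fun i _ => ?_)
    · have := H₁ Ω 𝒯 h u σ hG T hT (hsh T hT).1 (hsh T hT).2 (q T) (polyOn Ω T w) (hqK T hT)
        (polyLE_mono k.le_succ (h.polyOn_spec hw hT).1)
      rw [← integral_const_mul] at this
      refine le_trans (le_of_eq (integral_congr_ae (Filter.Eventually.of_forall fun x => ?_))) this
      simp only [norm_smul, mul_pow, Real.norm_eq_abs, sq_abs]
      rfl
    · refine le_trans (le_of_eq ?_) (hcurl T hT)
      rw [← integral_const_mul]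
      refine integral_congr_ae (Filter.Eventually.of_forall fun x => ?_)
      simp only [mul_pow]
      rfl
    · have hYle : ∀ S ∈ 𝒯, A S + S.diam ^ 2 * ∫ x in S.carrier, (polyCurl (q S)).evalAt x ^ 2
          ≤ (1 + C₂) * A S := fun S hS => by linarith [hcurl S hS]
      have hj := H₃ Ω 𝒯 h (fun T hT => (hsh T hT).1) u σ hG q hqK T hT i
      refine le_trans hj ?_
      rw [mul_assoc C₃, mul_add (1 + C₂), Finset.mul_sum]
      refine mul_le_mul_of_nonneg_left (add_le_add (Finset.sum_le_sum fun S hS => ?_) ?_) hC₃.le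
      · exact hYle S (mem_neighbors.1 hS).1
      · exact hYle T hT
  have hnb := h.conforming.sum_neighbors_le hA0
  refine (Finset.sum_le_sum hloc).trans ?_
  have e : ∑ T ∈ 𝒯, (C₁ * (A T + B T) + C₂ * A T
        + ∑ i : Fin 3, C₃ * (1 + C₂) * (∑ S ∈ neighbors 𝒯 T i, A S + A T))
      = C₁ * (∑ T ∈ 𝒯, A T + ∑ T ∈ 𝒯, B T) + C₂ * ∑ T ∈ 𝒯, A T
        + C₃ * (1 + C₂) * (∑ T ∈ 𝒯, ∑ i : Fin 3, ∑ S ∈ neighbors 𝒯 T i, A S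
          + 3 * ∑ T ∈ 𝒯, A T) := by
    simp only [Finset.sum_add_distrib, ← Finset.mul_sum, Finset.sum_const, Finset.card_univ,
      Fintype.card_fin, nsmul_eq_mul]
    push_cast
    ring
  rw [e]
  have hAn : 0 ≤ ∑ T ∈ 𝒯, A T := Finset.sum_nonneg fun T _ => hA0 T
  have hBn : 0 ≤ ∑ T ∈ 𝒯, B T := Finset.sum_nonneg fun T _ => hB0 T
  set sA := ∑ T ∈ 𝒯, A T
  set sB := ∑ T ∈ 𝒯, B T
  calc C₁ * (sA + sB) + C₂ * sA + C₃ * (1 + C₂) * (_ + 3 * sA)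
      ≤ C₁ * (sA + sB) + C₂ * sA + C₃ * (1 + C₂) * (9 * sA + 3 * sA) := by gcongr
    _ ≤ (C₁ + C₂ + 12 * C₃ * (1 + C₂)) * (sB + sA) := by
        have : 0 ≤ (C₂ + 12 * C₃ * (1 + C₂)) * sB := by positivity
        linarith
    _ ≤ _ := by gcongr

end MixedFEM

end

/-! ### Efficiency for the projected eigenfunction -/

theorem propositionl (Ω : Set MixedFEM.Plane) (𝒯₀ : Finset MixedFEM.Tri)
    (h𝒯₀ : MixedFEM.IsTriangulation Ω 𝒯₀) (fam : MixedFEM.Family) (k n m : ℕ)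
    (lam : ℝ) (σ : MixedFEM.L2v Ω) (u : MixedFEM.L2 Ω)
    (hu : MixedFEM.IsEigenpair Ω (MixedFEM.Hdiv Ω) ⊤ lam σ u) :
    ∃ C : ℝ, 0 < C ∧ ∀ 𝒯 ∈ MixedFEM.admissibleMeshes 𝒯₀,
      ∀ D : MixedFEM.DiscreteEigensystem Ω (MixedFEM.Sh Ω fam k 𝒯) (MixedFEM.Mh Ω k 𝒯),
        MixedFEM.mu D 𝒯 n m lam u 𝒯
          ≤ C * MixedFEM.errDist Ω (MixedFEM.Sh Ω fam k 𝒯) u (D.Lam n m lam u) := by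
  obtain ⟨κ, Q, hκ, hQ, hsh⟩ := MixedFEM.exists_admissible_bounds h𝒯₀
  obtain ⟨C, hC, H⟩ := MixedFEM.exists_sum_etaSq_le fam k hκ hQ
  refine ⟨Real.sqrt C, Real.sqrt_pos.2 hC, fun 𝒯 h𝒯 D => ?_⟩
  -- The first equation of the eigenvalue problem says that σ = G(u), which also identifies the term
  -- G(u) in the distance.
  have hG : MixedFEM.IsG Ω (MixedFEM.Hdiv Ω) u σ := ⟨hu.mem_S, hu.eq_a⟩
  have key := H Ω 𝒯 (MixedFEM.admissible_isTriangulation h𝒯₀ h𝒯) (hsh 𝒯 h𝒯) u σ hG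
    (D.Lam n m lam u) (D.Lam_mem n m lam u)
  have e : ∀ T, MixedFEM.muLocal D 𝒯 n m lam u T ^ 2
      = MixedFEM.etaSq Ω (MixedFEM.Sh Ω fam k 𝒯) 𝒯 (D.Lam n m lam u) T := fun T =>
    Real.sq_sqrt (MixedFEM.etaSq_nonneg _ _ _ _ _)
  simp only [MixedFEM.mu, MixedFEM.errDist, MixedFEM.aForm, e, hG.gradOp_eq,
    real_inner_self_eq_norm_sq]
  rw [← Real.sqrt_mul hC.le]
  exact Real.sqrt_le_sqrt key
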